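/- Let $M$ be a connected, simply connected smooth $3$-manifold and let $(\varphi,\xi,\eta,g)$ be a Lorentzian Sasakian structure on $M$, that is: $g$ is a smooth Lorentzian metric of signature $(-,+,+)$, $\varphi$ a smooth field of endomorphisms of $TM$, $\xi$ a smooth vector field and $\eta$ a smooth one-form with $$\eta(\xi)=1,\quad \varphi^2=-\mathrm{id}+\eta\otimes\xi,\quad g(\varphi X,\varphi Y)=g(X,Y)+\eta(X)\eta(Y),\quad d\eta(X,Y)=g(X,\varphi Y),$$ where $2\,d\eta(X,Y)=X\eta(Y)-Y\eta(X)-\eta([X,Y])$, and the Levi-Civita curvature $R(X,Y)=[\nabla_X,\nabla_Y]-\nabla_{[X,Y]}$ of $g$ satisfies $R(X,Y)\xi=\eta(Y)X-\eta(X)Y$. Suppose that $M$ is a space-form with $\varphi$-sectional curvature $H\in\mathbb{R}$: every plane spanned by $X$ and $\varphi X$ with $0\neq X\perp\xi$ has sectional curvature $g(R(X,\varphi X)\varphi X,X)/\bigl(g(X,X)g(\varphi X,\varphi X)-g(X,\varphi X)^2\bigr)=H$. Orient $M$ by $\eta\wedge d\eta$ and time-orient it by $\xi$. Spinors are smooth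 sections of the complex rank-$2$ spinor bundle in which an oriented, time-oriented orthonormal frame $(e_1,e_2,e_3)$ with $e_1$ timelike acts by Clifford multiplication through the matrices $\gamma_1=\sigma_1$, $\gamma_2=\sqrt{-1}\,\sigma_2$, $\gamma_3=\sqrt{-1}\,\sigma_3$ ($\sigma_i$ the Pauli matrices; so $X\cdot X=-g(X,X)$ and $\gamma_1\gamma_2\gamma_3=-\sqrt{-1}$), and $\nabla$ denotes the spin connection induced by the Levi-Civita connection. For $a,b\in\mathbb{R}$, a spinor $\psi$ is an SqK-spinor (Sasakian quasi-Killing spinor) of type $(a,b)$ if $$\nabla_X\psi=a\sqrt{-1}\,X\cdot\psi+b\sqrt{-1}\,\eta(X)\,\xi\cdot\psi\qquad\text{for all vectors }X.$$ Then $M$ has a spin structure, and for every spin structure on $M$: 1. there exists an SqK-spinor, not identically zero, of type $\left(-\tfrac12,\tfrac{H+1}{4}\right)$; 2. if $H<3$, then for each choice of sign there exists an SqK-spinor, not identically zero, of type $\left(\tfrac{-1\pm\sqrt{3-H}}{2},\tfrac{2\mp\sqrt{3-H}}{2}\right)$. -/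

import Mathlib

open scoped Manifold ContDiff Bundle

universe u w

noncomputable section

namespace LorentzSasaki

/-- The model space of three-dimensional manifolds. -/
abbrev E3 : Type := EuclideanSpace ℝ (Fin 3)

/-- The signs of a Lorentzian orthonormal frame `(e₀, e₁, e₂)`: `e₀` is timelike. -/
def sgn : Fin 3 → ℝ := ![-1, 1, 1]

section Geometry

variable {M : Type*} [TopologicalSpace M] [ChartedSpace E3 M]

/-- Vector fields on `M` (no regularity). -/
abbrev VField (M : Type*) [TopologicalSpace M] [ChartedSpace E3 M] : Type _ :=
  (x : M) → TangentSpace (𝓡 3) x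

/-- Families of bilinear forms on the tangent spaces of `M` (no regularity). -/
abbrev BForm (M : Type*) [TopologicalSpace M] [ChartedSpace E3 M] : Type _ :=
  (x : M) → TangentSpace (𝓡 3) x →L[ℝ] TangentSpace (𝓡 3) x →L[ℝ] ℝ

variable [IsManifold (𝓡 3) ∞ M]

/-- The vector field `X` is smooth on the set `U`. -/
def VField.SmoothOn (X : VField M) (U : Set M) : Prop :=
  ContMDiffOn (𝓡 3) ((𝓡 3).prod 𝓘(ℝ, E3)) ∞ (fun x => (⟨x, X x⟩ : TangentBundle (𝓡 3) M)) U

/-- The vector field `X` is smooth. -/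
def VField.Smooth (X : VField M) : Prop :=
  ContMDiff (𝓡 3) ((𝓡 3).prod 𝓘(ℝ, E3)) ∞ (fun x => (⟨x, X x⟩ : TangentBundle (𝓡 3) M))

/-- The derivative `X f` of a function `f` at `x` in the direction of the vector `v`. -/
def dirDeriv (f : M → ℝ) (x : M) (v : TangentSpace (𝓡 3) x) : ℝ :=
  mvfderiv (𝓡 3) f x v

/-- The bracket `[X, Y]` of vector fields. -/
def bracket (X Y : VField M) : VField M := VectorField.mlieBracket (𝓡 3) X Y

/-- The right-hand side of the Koszul formula,
`X g(Y,Z) + Y g(X,Z) - Z g(X,Y) + g([X,Y],Z) - g([X,Z],Y) - g([Y,Z],X)`, at `x`. -/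
def koszul (g : BForm M) (X Y Z : VField M) (x : M) : ℝ :=
  dirDeriv (fun y => g y (Y y) (Z y)) x (X x)
    + dirDeriv (fun y => g y (X y) (Z y)) x (Y x)
    - dirDeriv (fun y => g y (X y) (Y y)) x (Z x)
    + g x (bracket X Y x) (Z x)
    - g x (bracket X Z x) (Y x)
    - g x (bracket Y Z x) (X x)

/-- The Levi-Civita covariant derivative `∇_X Y` of `g`: its value at `x` is the vector `w` with
`2 g(w, Z) = koszul g X Y Z` at `x` for all vector fields `Z` that are differentiable at `x`.
For a smooth nondegenerate symmetric `g` and `X`, `Y` smooth near `x` there is exactly one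
such `w`. -/
def nabla (g : BForm M) (X Y : VField M) : VField M := fun x =>
  Classical.epsilon fun w : TangentSpace (𝓡 3) x =>
    ∀ Z : VField M,
      MDifferentiableAt (𝓡 3) ((𝓡 3).prod 𝓘(ℝ, E3))
        (fun y => (⟨y, Z y⟩ : TangentBundle (𝓡 3) M)) x →
      2 * g x w (Z x) = koszul g X Y Z x

/-- The curvature `R(X, Y) Z = ∇_X ∇_Y Z - ∇_Y ∇_X Z - ∇_[X, Y] Z` of `g`. -/
def curv (g : BForm M) (X Y Z : VField M) : VField M :=
  nabla g X (nabla g Y Z) - nabla g Y (nabla g X Z) - nabla g (bracket X Y) Z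

/-- The sectional curvature `K(X, Y) = g(R(X,Y)Y, X) / (g(X,X) g(Y,Y) - g(X,Y)²)` at `x`. -/
def sectionalCurv (g : BForm M) (X Y : VField M) (x : M) : ℝ :=
  g x (curv g X Y Y x) (X x)
    / (g x (X x) (X x) * g x (Y x) (Y x) - (g x (X x) (Y x)) ^ 2)

/-- The exterior derivative of a one-form,
`dη(X, Y) = (X η(Y) - Y η(X) - η([X, Y])) / 2` (the convention of contact metric geometry). -/
def extD (η : (x : M) → TangentSpace (𝓡 3) x →L[ℝ] ℝ) (X Y : VField M) (x : M) : ℝ :=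
  (dirDeriv (fun y => η y (Y y)) x (X x) - dirDeriv (fun y => η y (X y)) x (Y x)
    - η x (bracket X Y x)) / 2

variable (M) in
/-- A smooth Lorentzian metric, of signature `(-, +, +)`, on a three-dimensional manifold. -/
structure LorentzianMetric where
  /-- the bilinear form on each tangent space -/
  form : BForm M
  symm : ∀ (x : M) (v w : TangentSpace (𝓡 3) x), form x v w = form x w v
  signature : ∀ x : M, ∃ b : Module.Basis (Fin 3) ℝ (TangentSpace (𝓡 3) x),
    ∀ i j, form x (b i) (b j) = if i = j then sgn i else 0
  smooth : ContMDiff (𝓡 3) ((𝓡 3).prod 𝓘(ℝ, E3 →L[ℝ] E3 →L[ℝ] ℝ)) ∞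
    (fun x => Bundle.TotalSpace.mk' (E3 →L[ℝ] E3 →L[ℝ] ℝ)
      (E := fun x : M => TangentSpace (𝓡 3) x →L[ℝ] TangentSpace (𝓡 3) x →L[ℝ] ℝ) x (form x))

variable (M) in
/-- A three-dimensional Lorentzian Sasakian manifold `(M, φ, ξ, η, g)`: a contact metric structure
with timelike Reeb field `ξ` such that `R(X, Y) ξ = η(Y) X - η(X) Y`. -/
structure LorentzianSasakian where
  /-- the Lorentzian metric -/
  metric : LorentzianMetric M
  /-- the field of endomorphisms -/
  phi : (x : M) → TangentSpace (𝓡 3) x →L[ℝ] TangentSpace (𝓡 3) x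
  /-- the Reeb vector field -/
  xi : VField M
  /-- the contact form -/
  eta : (x : M) → TangentSpace (𝓡 3) x →L[ℝ] ℝ
  phi_smooth : ContMDiff (𝓡 3) ((𝓡 3).prod 𝓘(ℝ, E3 →L[ℝ] E3)) ∞
    (fun x => Bundle.TotalSpace.mk' (E3 →L[ℝ] E3)
      (E := fun x : M => TangentSpace (𝓡 3) x →L[ℝ] TangentSpace (𝓡 3) x) x (phi x))
  xi_smooth : xi.Smooth
  eta_smooth : ContMDiff (𝓡 3) ((𝓡 3).prod 𝓘(ℝ, E3 →L[ℝ] ℝ)) ∞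
    (fun x => Bundle.TotalSpace.mk' (E3 →L[ℝ] ℝ)
      (E := fun x : M => TangentSpace (𝓡 3) x →L[ℝ] ℝ) x (eta x))
  eta_xi : ∀ x : M, eta x (xi x) = 1
  phi_phi : ∀ (x : M) (v : TangentSpace (𝓡 3) x), phi x (phi x v) = - v + eta x v • xi x
  metric_phi : ∀ (x : M) (v w : TangentSpace (𝓡 3) x),
    metric.form x (phi x v) (phi x w) = metric.form x v w + eta x v * eta x w
  d_eta : ∀ X Y : VField M, X.Smooth → Y.Smooth → ∀ x : M,
    extD eta X Y x = metric.form x (X x) (phi x (Y x))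
  curv_xi : ∀ X Y : VField M, X.Smooth → Y.Smooth → ∀ x : M,
    curv metric.form X Y xi x = eta x (Y x) • X x - eta x (X x) • Y x

/-- All `φ`-sectional curvatures `K(X, φ X)`, `X ≠ 0` orthogonal to `ξ`, are equal to `H`. -/
def LorentzianSasakian.HasPhiSectionalCurv (S : LorentzianSasakian M) (H : ℝ) : Prop :=
  ∀ X : VField M, X.Smooth → ∀ x : M, X x ≠ 0 → S.metric.form x (X x) (S.xi x) = 0 →
    sectionalCurv S.metric.form X (fun y => S.phi y (X y)) x = H

end Geometry

section Spin

/-- The Pauli matrices. -/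
def pauli : Fin 3 → Matrix (Fin 2) (Fin 2) ℂ :=
  ![!![0, 1; 1, 0], !![0, -Complex.I; Complex.I, 0], !![1, 0; 0, -1]]

/-- The gamma matrices `γ₀ = σ₁`, `γ₁ = i σ₂`, `γ₂ = i σ₃`; they satisfy
`γₐ γ_b + γ_b γₐ = -2 ηₐ_b` with `η = diag(-1, 1, 1)`, and `γ₀ γ₁ γ₂ = -i`. -/
def gam : Fin 3 → Matrix (Fin 2) (Fin 2) ℂ :=
  ![pauli 0, Complex.I • pauli 1, Complex.I • pauli 2]

variable {M : Type*} [TopologicalSpace M] [ChartedSpace E3 M] [IsManifold (𝓡 3) ∞ M]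

/-- The coordinates `vᵃ = εₐ g(v, eₐ)` of a vector with respect to an orthonormal frame `e`. -/
def coord (g : BForm M) (e : Fin 3 → VField M) (x : M) (v : TangentSpace (𝓡 3) x)
    (a : Fin 3) : ℝ :=
  sgn a * g x v (e a x)

/-- Clifford multiplication by the vector `v`, with respect to the orthonormal frame `e`. -/
def cliff (g : BForm M) (e : Fin 3 → VField M) (x : M) (v : TangentSpace (𝓡 3) x) :
    Matrix (Fin 2) (Fin 2) ℂ :=
  ∑ a, (coord g e x v a : ℂ) • gam a

/-- The spin connection form with respect to the orthonormal frame `e`,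
`ω(v) = (1/4) ∑ₐ_b εₐ ε_b g(∇_v eₐ, e_b) γₐ γ_b`, where `v = ∑_c v^c e_c`. -/
def spinConn (g : BForm M) (e : Fin 3 → VField M) (x : M) (v : TangentSpace (𝓡 3) x) :
    Matrix (Fin 2) (Fin 2) ℂ :=
  ∑ c, ∑ a, ∑ b, ((1 / 4 * coord g e x v c * (sgn a * sgn b)
    * g x (nabla g (e c) (e a) x) (e b x) : ℝ) : ℂ) • (gam a * gam b)

/-- `s` is a lift to the spin group of the Lorentz transformation with matrix `L`: it has
determinant one and `s γ(v) s⁻¹ = γ(L v)` for all vectors `v`. (The elements of `SL(2, ℂ)` that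
satisfy this for some `L` in the identity component of `SO(1, 2)` form the connected spin group
`Spin(1, 2)`, and every such `L` has exactly two lifts `± s`.) -/
def IsSpinLift (s : Matrix (Fin 2) (Fin 2) ℂ) (L : Matrix (Fin 3) (Fin 3) ℝ) : Prop :=
  s.det = 1 ∧ ∀ b, s * gam b = (∑ a, (L a b : ℂ) • gam a) * s

/-- A spin structure on `M`, given by a cocycle: local smooth orthonormal frames whose domains cover
`M`, positively oriented for the orientation `η ∧ dη > 0` and time-oriented by `ξ`, together with
smooth lifts of the transition matrices to the spin group that satisfy the cocycle condition.
The orientation is expressed through `dη(X, Y) = g(X, φ Y)`. -/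
structure SpinStructure {M : Type u} [TopologicalSpace M] [ChartedSpace E3 M]
    [IsManifold (𝓡 3) ∞ M] (S : LorentzianSasakian M) where
  /-- the index set of the cover -/
  ι : Type w
  /-- the domains of the frames -/
  U : ι → Set M
  /-- the frames -/
  e : ι → Fin 3 → VField M
  /-- the lifts of the transition matrices -/
  lift : ι → ι → M → Matrix (Fin 2) (Fin 2) ℂ
  isOpen_U : ∀ i, IsOpen (U i)
  cover : ∀ x : M, ∃ i, x ∈ U i
  e_smooth : ∀ i a, (e i a).SmoothOn (U i)
  orthonormal : ∀ i, ∀ x ∈ U i, ∀ a b,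
    S.metric.form x (e i a x) (e i b x) = if a = b then sgn a else 0
  oriented : ∀ i, ∀ x ∈ U i,
    0 < S.eta x (e i 0 x) * S.metric.form x (e i 1 x) (S.phi x (e i 2 x))
      + S.eta x (e i 1 x) * S.metric.form x (e i 2 x) (S.phi x (e i 0 x))
      + S.eta x (e i 2 x) * S.metric.form x (e i 0 x) (S.phi x (e i 1 x))
  timeOriented : ∀ i, ∀ x ∈ U i, 0 < S.eta x (e i 0 x)
  lift_smooth : ∀ i j k l,
    ContMDiffOn (𝓡 3) 𝓘(ℝ, ℂ) ∞ (fun x => lift i j x k l) (U i ∩ U j)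
  lift_spec : ∀ i j, ∀ x ∈ U i ∩ U j,
    IsSpinLift (lift i j x) (Matrix.of fun a b => coord S.metric.form (e i) x (e j b x) a)
  cocycle : ∀ i j k, ∀ x ∈ U i ∩ U j ∩ U k, lift i j x * lift j k x = lift i k x

/-- A spinor: a smooth section of the complex rank two spinor bundle associated with a spin
structure, given by its components in the local frames (`comp i` is only relevant on `U i`). -/
structure Spinor {S : LorentzianSasakian M} (P : SpinStructure S) where
  /-- the components in the local frames -/
  comp : P.ι → M → Fin 2 → ℂ
  smooth : ∀ i, ContMDiffOn (𝓡 3) 𝓘(ℝ, Fin 2 → ℂ) ∞ (comp i) (P.U i)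
  compatible : ∀ i j, ∀ x ∈ P.U i ∩ P.U j, comp i x = (P.lift i j x).mulVec (comp j x)

variable {S : LorentzianSasakian M} {P : SpinStructure S}

/-- The covariant derivative `∇_v ψ = dψ(v) + ω(v) ψ` of a spinor, in the `i`-th frame. -/
def Spinor.nabla (ψ : Spinor P) (i : P.ι) (x : M) (v : TangentSpace (𝓡 3) x) : Fin 2 → ℂ :=
  mvfderiv (𝓡 3) (ψ.comp i) x v + (spinConn S.metric.form (P.e i) x v).mulVec (ψ.comp i x)

/-- The Clifford product `v · ψ`, in the `i`-th frame. -/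
def Spinor.clifford (ψ : Spinor P) (i : P.ι) (x : M) (v : TangentSpace (𝓡 3) x) : Fin 2 → ℂ :=
  (cliff S.metric.form (P.e i) x v).mulVec (ψ.comp i x)

/-- `ψ` is a Sasakian quasi-Killing spinor of type `(a, b)`:
`∇_X ψ = a √-1 X · ψ + b √-1 η(X) ξ · ψ`. -/
def Spinor.IsSqK (ψ : Spinor P) (a b : ℝ) : Prop :=
  ∀ i, ∀ x ∈ P.U i, ∀ v : TangentSpace (𝓡 3) x,
    ψ.nabla i x v = ((a : ℂ) * Complex.I) • ψ.clifford i x v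
      + ((b : ℂ) * Complex.I * (S.eta x v : ℂ)) • ψ.clifford i x (S.xi x)

/-- The spinor does not vanish identically. -/
def Spinor.Nontrivial (ψ : Spinor P) : Prop := ∃ i, ∃ x ∈ P.U i, ψ.comp i x ≠ 0

end Spin

end LorentzSasaki

end

open scoped Topology

set_option linter.unusedSectionVars false

noncomputable section

namespace LorentzSasaki

/-! Near any point there is an orthonormal frame (ξ, e₁, e₂) with φe₁ = -e₂ and φe₂ = e₁. The
contact condition fixes the ξ-components of its brackets, and the Sasakian curvature condition is a
Riccati equation for ∇ξ along ξ that kills the symmetric part of ∇ξ (`structureFun_symm_traceless`).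
What remains free is a rotation of (e₁, e₂). It is governed by a one-form θ, `rotForm`, depending on
λ = (3 - H)/2; two Jacobi identities and the value H of the φ-sectional curvature say exactly that
dθ = 0 (`rotForm_closed`). Integrating θ rotates the frame into one with [ξ,e₁] = λe₂, [ξ,e₂] =
-λe₁, [e₁,e₂] = -2ξ, and simple connectedness makes it global (`exists_global_special`,
`exists_global_adaptedFrame`). So M is parallelized by a frame with the brackets of a Lie algebra;
in particular it is spin.

In this frame the spin connection has constant coefficients. Put A₀ = it²γ₀, A₁ = itγ₁, A₂ = itγ₂.
The solutions of dΨ(eₐ) = AₐΨ are quasi-Killing of type (t - 1/2, t² - t + 1 - λ/2). The bracket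
[e₁,e₂] explains the t² in A₀; the other two brackets make the system flat when t(2t² - λ) = 0. The
root t = 0 gives the first type, the roots t = ±√(3 - H)/2 give the other two. Flat systems are
solved locally by a Frobenius theorem (`exists_fundamental_solution`), and globally because locally
constant transitions have no monodromy on a simply connected space
(`exists_section_of_locally_constant_transition`).

For an arbitrary spin structure, the Lorentz matrices between its frames and the global frame have
two lifts ±s, which are chosen coherently, again by simple connectedness
(`SpinStructure.exists_global_lift`). Such lifts satisfy ds = sω' - ωs (`mvfderiv_spinLift`), so the
components sᵢΨf, with f a constant vector, define the required spinor. -/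

/-! ### Gluing over simply connected spaces. -/

/-- A locally constant family of local sections of a family of types over a simply connected space
can be glued to a global section. -/
theorem exists_section_of_locally_constant_transition {X : Type*} [TopologicalSpace X]
    [SimplyConnectedSpace X] [LocallyPathConnectedSpace X] {ι F : Type*} {B : X → Type*}
    (V : ι → Set X) (hV : ∀ i, IsOpen (V i)) (idx : X → ι) (hidx : ∀ x, x ∈ V (idx x))
    (τ : ι → (x : X) → F → B x) (inj : ∀ i, ∀ x ∈ V i, Function.Injective (τ i x))
    (trans : ∀ i j, ∀ x ∈ V i ∩ V j, ∀ f, ∃ f', ∀ᶠ y in 𝓝 x, τ i y f = τ j y f')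
    (x₀ : X) (f₀ : F) :
    ∃ σ : (x : X) → B x, σ x₀ = τ (idx x₀) x₀ f₀ ∧
      ∀ i, ∀ x ∈ V i, ∃ f, ∀ᶠ y in 𝓝 x, σ y = τ i y f := by
  classical
  -- With a discrete fibre, the bundle assembled from the local sections is a covering.
  let _ : TopologicalSpace F := ⊥
  have _ : DiscreteTopology F := ⟨rfl⟩
  have trans' : ∀ i j, ∀ x ∈ V i ∩ V j, ∀ f, ∃ f', τ i x f = τ j x f' := fun i j x hx f =>
    (trans i j x hx f).imp fun f' h => h.self_of_nhds
  -- On overlaps, injectivity of `τ j x` makes the chosen parameter unique, which yields the cocycle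
  -- identity; elsewhere the value is arbitrary.
  let c : ι → ι → X → F → F := fun i j x f =>
    if h : x ∈ V i ∩ V j then (trans' i j x h f).choose else f
  have hc : ∀ i j x f, x ∈ V i ∩ V j → τ j x (c i j x f) = τ i x f := by
    intro i j x f h
    simp only [c, dif_pos h]
    exact (trans' i j x h f).choose_spec.symm
  let Z : FiberBundleCore ι X F :=
    { baseSet := V
      isOpen_baseSet := hV
      indexAt := idx
      mem_baseSet_at := hidx
      coordChange := c
      coordChange_self := fun i x hx v => inj i x hx (hc i i x v ⟨hx, hx⟩)
      continuousOn_coordChange := by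
        rintro i j ⟨x, f⟩ ⟨hx, -⟩
        refine ContinuousAt.continuousWithinAt ?_
        obtain ⟨f', hf'⟩ := trans i j x hx f
        refine (continuousAt_const (y := f')).congr ?_
        have h1 : ∀ᶠ p : X × F in 𝓝 (x, f), p.2 = f :=
          (continuous_snd.tendsto (x, f)).eventually (show ∀ᶠ g in 𝓝 f, g = f by simp)
        have h2 : ∀ᶠ p : X × F in 𝓝 (x, f), τ i p.1 f = τ j p.1 f' :=
          (continuous_fst.tendsto (x, f)).eventually hf'
        have h3 : ∀ᶠ p : X × F in 𝓝 (x, f), p.1 ∈ V i ∩ V j :=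
          (continuous_fst.tendsto (x, f)).eventually (((hV i).inter (hV j)).mem_nhds hx)
        filter_upwards [h1, h2, h3] with p p1 p2 p3
        refine inj j p.1 p3.2 ?_
        rw [hc i j p.1 p.2 p3, p1, p2]
      coordChange_comp := by
        rintro i j k x ⟨⟨hi, hj⟩, hk⟩ v
        refine inj k x hk ?_
        rw [hc j k x _ ⟨hj, hk⟩, hc i j x _ ⟨hi, hj⟩, hc i k x _ ⟨hi, hk⟩] }
  have cov : IsCoveringMap (Bundle.TotalSpace.proj : Bundle.TotalSpace F Z.Fiber → X) :=
    FiberBundle.isCoveringMap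
  -- The identity of a simply connected base lifts to any covering: this lift is the global section.
  obtain ⟨s, ⟨hs0, hs⟩, -⟩ := cov.existsUnique_continuousMap_lifts (ContinuousMap.id X) x₀
    (⟨x₀, f₀⟩ : Bundle.TotalSpace F Z.Fiber) rfl
  have hs' : ∀ x, (s x).proj = x := fun x => congrFun hs x
  let σ₀ : X → F := fun x => (s x).2
  refine ⟨fun x => τ (idx x) x (σ₀ x), ?_, ?_⟩
  · have : σ₀ x₀ = f₀ := by simp only [σ₀]; rw [hs0]
    simp only [this]
  · intro i x hx
    have hcont : ContinuousAt (fun y => (Z.localTriv i (s y)).2) x := by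
      have : ContinuousAt (Z.localTriv i) (s x) := by
        refine (Z.localTriv i).continuousAt ?_
        rw [Z.mem_localTriv_source, hs' x]
        exact hx
      exact continuous_snd.continuousAt.comp (this.comp s.continuous.continuousAt)
    refine ⟨(Z.localTriv i (s x)).2, ?_⟩
    have h1 : ∀ᶠ y in 𝓝 x, (Z.localTriv i (s y)).2 = (Z.localTriv i (s x)).2 :=
      hcont.eventually (show ∀ᶠ g in 𝓝 _, g = _ by simp)
    filter_upwards [h1, (hV i).mem_nhds hx] with y hy hyi
    rw [← hy]
    have : (Z.localTriv i (s y)).2 = c (idx y) i y (σ₀ y) := by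
      rw [Z.localTriv_apply]
      simp only [hs' y]
      rfl
    rw [this, hc _ _ _ _ ⟨hidx y, hyi⟩]

/-! ### The Frobenius theorem for linear systems in a normed algebra. -/

section Frobenius

open Set Metric

/-- A Grönwall estimate on the unit interval. -/
theorem norm_le_of_norm_deriv_le {F : Type*} [NormedAddCommGroup F] [NormedSpace ℝ F]
    {f f' : ℝ → F} {δ ε : ℝ} (hδ : 0 ≤ δ) (hε : 0 ≤ ε)
    (hf : ∀ t ∈ Icc (0 : ℝ) 1, HasDerivWithinAt f (f' t) (Icc 0 1) t) (h0 : ‖f 0‖ ≤ δ)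
    (bound : ∀ t ∈ Icc (0 : ℝ) 1, ‖f' t‖ ≤ ‖f t‖ + ε) :
    ∀ t ∈ Icc (0 : ℝ) 1, ‖f t‖ ≤ 3 * (δ + ε) := by
  intro t ht
  have h := norm_le_gronwallBound_of_norm_deriv_right_le (f := f) (f' := f') (δ := δ) (K := 1)
    (ε := ε) (a := 0) (b := 1) (fun t ht => (hf t ht).continuousWithinAt)
    (fun t ht => (hf t ⟨ht.1, ht.2.le⟩).mono_of_mem_nhdsWithin
      (Icc_mem_nhdsGE_of_mem ht)) h0
    (fun t ht => by simpa using bound t ⟨ht.1, ht.2.le⟩) t ht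
  refine h.trans ?_
  rw [gronwallBound_of_K_ne_0 one_ne_zero]
  -- The constant 3 is an upper bound for e.
  have h1 : Real.exp (1 * (t - 0)) ≤ 3 := by
    have : Real.exp (1 * (t - 0)) ≤ Real.exp 1 := Real.exp_le_exp.2 (by simpa using ht.2)
    linarith [Real.exp_one_lt_d9]
  have h2 : 0 < Real.exp (1 * (t - 0)) := Real.exp_pos _
  simp only [div_one]
  nlinarith

theorem eventually_norm_lt_add_one {X F : Type*} [TopologicalSpace X] [NormedAddCommGroup F]
    {f : X → F} {x : X} (hf : ContinuousAt f x) : ∀ᶠ y in 𝓝 x, ‖f y‖ < ‖f x‖ + 1 :=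
  hf.norm.eventually (gt_mem_nhds (lt_add_one _))

variable {E 𝔸 : Type*} [NormedAddCommGroup E] [NormedSpace ℝ E] [NormedRing 𝔸] [NormedAlgebra ℝ 𝔸]

/-- The linear equation `u' = a(t) u` with a small coefficient is solvable on the unit interval. -/
theorem exists_linear_ode_solution [CompleteSpace 𝔸] {a : ℝ → 𝔸} (ha : ContinuousOn a (Icc 0 1)) {c : ℝ} (hc : 0 ≤ c)
    (hac : ∀ t ∈ Icc (0 : ℝ) 1, ‖a t‖ ≤ c) (hc1 : c * (‖(1 : 𝔸)‖ + 1) ≤ 1) :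
    ∃ u : ℝ → 𝔸, u 0 = 1 ∧
      ∀ t ∈ Icc (0 : ℝ) 1, HasDerivWithinAt u (a t * u t) (Icc 0 1) t := by
  lift c to NNReal using hc
  -- On the ball of radius 1 about `1` the speed is at most `c * (‖1‖ + 1) ≤ 1`, so the solution
  -- stays there up to time 1.
  have hp : IsPicardLindelof (fun t u => a t * u) (tmin := 0) (tmax := 1) ⟨0, by simp⟩ (1 : 𝔸) 1 0 1
      c :=
    { lipschitzOnWith := by
        intro t ht
        refine LipschitzOnWith.of_dist_le_mul fun x _ y _ => ?_
        rw [dist_eq_norm, dist_eq_norm, ← mul_sub]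
        exact (norm_mul_le _ _).trans (by gcongr; exact hac t ht)
      continuousOn := fun x _ => ha.mul continuousOn_const
      norm_le := by
        intro t ht x hx
        have hx' : ‖x‖ ≤ ‖(1 : 𝔸)‖ + 1 := by
          have := norm_le_norm_add_norm_sub' x 1
          rw [mem_closedBall, dist_eq_norm] at hx
          simp at hx
          linarith
        refine (norm_mul_le _ _).trans ?_
        calc ‖a t‖ * ‖x‖ ≤ c * (‖(1 : 𝔸)‖ + 1) := by gcongr; exact hac t ht
          _ ≤ _ := by simpa using hc1
      mul_max_le := by simp }
  exact hp.exists_eq_forall_mem_Icc_hasDerivWithinAt₀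

/-- Quantitative form of the radial integration of a flat linear system. -/
theorem hasFDerivAt_of_radial_solution {A : E → E →L[ℝ] 𝔸} {x₀ : E} {R C : ℝ} (hC : 0 ≤ C)
    (hR1 : R ≤ 1) (hCR : C * R ≤ 1)
    (hdiff : ∀ y ∈ ball x₀ R, DifferentiableAt ℝ A y)
    (hA : ∀ y ∈ ball x₀ R, ‖A y‖ ≤ C) (hA' : ∀ y ∈ ball x₀ R, ‖fderiv ℝ A y‖ ≤ C)
    (hA1 : ∀ y ∈ ball x₀ R, ∀ z ∈ ball x₀ R, ‖A z - A y‖ ≤ C * ‖z - y‖)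
    (hA2 : ∀ y ∈ ball x₀ R, ∀ z ∈ ball x₀ R,
      ‖A z - A y - fderiv ℝ A y (z - y)‖ ≤ C * ‖z - y‖ ^ 2)
    (flat : ∀ y ∈ ball x₀ R, ∀ u v, fderiv ℝ A y u v + A y v * A y u
      = fderiv ℝ A y v u + A y u * A y v)
    {u : E → ℝ → 𝔸} (hu0 : ∀ k ∈ ball (0 : E) R, u k 0 = 1)
    (hu : ∀ k ∈ ball (0 : E) R, ∀ t ∈ Icc (0 : ℝ) 1,
      HasDerivWithinAt (u k) (A (x₀ + t • k) k * u k t) (Icc 0 1) t)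
    {k : E} (hk : k ∈ ball (0 : E) R) :
    HasFDerivAt (fun k => u k 1) ((ContinuousLinearMap.mul ℝ 𝔸).flip (u k 1) ∘L A (x₀ + k)) k := by
  have hmem : ∀ k ∈ ball (0 : E) R, ∀ t ∈ Icc (0 : ℝ) 1, x₀ + t • k ∈ ball x₀ R := by
    intro k hk t ht
    rw [mem_ball_zero_iff] at hk
    rw [mem_ball, dist_eq_norm, add_sub_cancel_left, norm_smul, Real.norm_of_nonneg ht.1]
    nlinarith [ht.2, norm_nonneg k]
  set N : ℝ := ‖(1 : 𝔸)‖ with hN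
  have hN0 : 0 ≤ N := norm_nonneg _
  have hAk : ∀ k ∈ ball (0 : E) R, ∀ t ∈ Icc (0 : ℝ) 1, ‖A (x₀ + t • k) k‖ ≤ 1 := by
    intro k hk t ht
    refine ((A _).le_opNorm k).trans (le_trans ?_ hCR)
    exact mul_le_mul (hA _ (hmem k hk t ht)) (mem_ball_zero_iff.1 hk).le (norm_nonneg _) hC
  have hub : ∀ k ∈ ball (0 : E) R, ∀ t ∈ Icc (0 : ℝ) 1, ‖u k t‖ ≤ 3 * N := by
    intro k hk t ht
    have := norm_le_of_norm_deriv_le hN0 le_rfl (hu k hk) (by rw [hu0 k hk]) (fun t ht => by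
      rw [add_zero]
      refine (norm_mul_le _ _).trans ?_
      exact mul_le_of_le_one_left (norm_nonneg _) (hAk k hk t ht)) t ht
    simpa using this
  have hkR := mem_ball_zero_iff.1 hk
  -- the increment of the solutions
  have key : ∀ h : E, k + h ∈ ball (0 : E) R →
      ‖u (k + h) 1 - u k 1 - A (x₀ + k) h * u k 1‖ ≤ 300 * (N * (C + 1) ^ 2) * ‖h‖ ^ 2 := by
    intro h hkh
    have hkhR := mem_ball_zero_iff.1 hkh
    have hsub : ∀ t : ℝ, (x₀ + t • (k + h)) - (x₀ + t • k) = t • h := by intro t; module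
    have hth : ∀ t ∈ Icc (0 : ℝ) 1, ‖t • h‖ ≤ ‖h‖ := by
      intro t ht
      rw [norm_smul, Real.norm_of_nonneg ht.1]
      exact mul_le_of_le_one_left (norm_nonneg _) ht.2
    -- Zeroth-order estimate: neighbouring radial solutions differ by O(‖h‖).
    have hd : ∀ t ∈ Icc (0 : ℝ) 1, ‖u (k + h) t - u k t‖ ≤ 18 * N * C * ‖h‖ := by
      have := norm_le_of_norm_deriv_le (f := fun t => u (k + h) t - u k t)
        (f' := fun t => A (x₀ + t • (k + h)) (k + h) * u (k + h) t - A (x₀ + t • k) k * u k t)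
        (δ := 0) (ε := 6 * N * C * ‖h‖) le_rfl (by positivity)
        (fun t ht => (hu _ hkh t ht).sub (hu _ hk t ht))
        (by rw [hu0 _ hkh, hu0 _ hk]; simp) ?_
      · intro t ht
        refine (this t ht).trans (by linarith)
      · intro t ht
        have hid : A (x₀ + t • (k + h)) (k + h) * u (k + h) t - A (x₀ + t • k) k * u k t
            = A (x₀ + t • k) k * (u (k + h) t - u k t)
              + ((A (x₀ + t • (k + h)) - A (x₀ + t • k)) (k + h) + A (x₀ + t • k) h)
                * u (k + h) t := by
          simp only [sub_apply, map_add]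
          noncomm_ring
        rw [hid]
        refine (norm_add_le _ _).trans (add_le_add ?_ ?_)
        · exact (norm_mul_le _ _).trans (mul_le_of_le_one_left (norm_nonneg _) (hAk k hk t ht))
        · refine (norm_mul_le _ _).trans ?_
          have h1 : ‖(A (x₀ + t • (k + h)) - A (x₀ + t • k)) (k + h)‖ ≤ C * ‖h‖ := by
            refine (ContinuousLinearMap.le_opNorm _ _).trans ?_
            have := hA1 _ (hmem k hk t ht) _ (hmem _ hkh t ht)
            rw [hsub] at this
            calc _ ≤ (C * ‖h‖) * 1 := mul_le_mul
                  (this.trans (mul_le_mul_of_nonneg_left (hth t ht) hC)) (hkhR.le.trans hR1)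
                  (norm_nonneg _) (by positivity)
              _ = _ := mul_one _
          have h2 : ‖A (x₀ + t • k) h‖ ≤ C * ‖h‖ :=
            ((A _).le_opNorm h).trans
              (mul_le_mul_of_nonneg_right (hA _ (hmem k hk t ht)) (norm_nonneg _))
          calc _ ≤ (C * ‖h‖ + C * ‖h‖) * (3 * N) :=
                mul_le_mul ((norm_add_le _ _).trans (add_le_add h1 h2)) (hub _ hkh t ht)
                  (norm_nonneg _) (by positivity)
            _ = _ := by ring
    -- First-order estimate. The candidate for the variation of `u k` is `A (x₀ + t • k) (t • h) * u
    -- k t`; the remainder solves the same linear equation up to an error O(‖h‖²), and starts at 0.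
    have hw := norm_le_of_norm_deriv_le
      (f := fun t => u (k + h) t - u k t - A (x₀ + t • k) (t • h) * u k t)
      (f' := fun t => A (x₀ + t • (k + h)) (k + h) * u (k + h) t - A (x₀ + t • k) k * u k t
        - ((fderiv ℝ A (x₀ + t • k) k (t • h) + A (x₀ + t • k) h) * u k t
          + A (x₀ + t • k) (t • h) * (A (x₀ + t • k) k * u k t)))
      (δ := 0) (ε := 100 * (N * (C + 1) ^ 2) * ‖h‖ ^ 2) le_rfl (by positivity) ?_
      (by rw [hu0 _ hkh, hu0 _ hk]; simp) ?_ 1 (by simp)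
    · simp only [one_smul] at hw
      refine hw.trans (by linarith)
    · intro t ht
      refine ((hu _ hkh t ht).sub (hu _ hk t ht)).sub ?_
      have hl : HasDerivAt (fun t : ℝ => x₀ + t • k) k t := by
        simpa using ((hasDerivAt_id t).smul_const k).const_add x₀
      have hAt : HasDerivAt (fun t : ℝ => A (x₀ + t • k)) (fderiv ℝ A (x₀ + t • k) k) t :=
        (hdiff _ (hmem k hk t ht)).hasFDerivAt.comp_hasDerivAt t hl
      have hth' : HasDerivAt (fun t : ℝ => t • h) h t := by
        simpa using (hasDerivAt_id t).smul_const h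
      exact ((hAt.clm_apply hth').hasDerivWithinAt).mul (hu _ hk t ht)
    · intro t ht
      -- Flatness trades the derivative of `A` along `k` for the one along `h`, which matches the
      -- increment of `A`; otherwise an error of first order in `h` would survive.
      have hfl := flat _ (hmem k hk t ht) k (t • h)
      have hid : A (x₀ + t • (k + h)) (k + h) * u (k + h) t - A (x₀ + t • k) k * u k t
          - ((fderiv ℝ A (x₀ + t • k) k (t • h) + A (x₀ + t • k) h) * u k t
            + A (x₀ + t • k) (t • h) * (A (x₀ + t • k) k * u k t))
          = A (x₀ + t • k) k * (u (k + h) t - u k t - A (x₀ + t • k) (t • h) * u k t)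
            + ((A (x₀ + t • (k + h)) - A (x₀ + t • k) - fderiv ℝ A (x₀ + t • k) (t • h)) (k + h)
                * u (k + h) t
              + fderiv ℝ A (x₀ + t • k) (t • h) h * u (k + h) t
              + (fderiv ℝ A (x₀ + t • k) (t • h) k + A (x₀ + t • k) h)
                * (u (k + h) t - u k t)) := by
        have h3 : (fderiv ℝ A (x₀ + t • k) k (t • h) + A (x₀ + t • k) h) * u k t
            + A (x₀ + t • k) (t • h) * (A (x₀ + t • k) k * u k t)
            = (fderiv ℝ A (x₀ + t • k) (t • h) k + A (x₀ + t • k) k * A (x₀ + t • k) (t • h)) * u k t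
              + A (x₀ + t • k) h * u k t := by
          rw [← hfl]; noncomm_ring
        rw [h3]
        simp only [sub_apply, map_add]
        noncomm_ring
      rw [hid]
      refine (norm_add_le _ _).trans (add_le_add ?_ ?_)
      · exact (norm_mul_le _ _).trans (mul_le_of_le_one_left (norm_nonneg _) (hAk k hk t ht))
      have hy := hmem k hk t ht
      have e1 : ‖(A (x₀ + t • (k + h)) - A (x₀ + t • k) - fderiv ℝ A (x₀ + t • k) (t • h)) (k + h)
          * u (k + h) t‖ ≤ C * ‖h‖ ^ 2 * (3 * N) := by
        refine (norm_mul_le _ _).trans (mul_le_mul ?_ (hub _ hkh t ht) (norm_nonneg _)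
          (by positivity))
        refine (ContinuousLinearMap.le_opNorm _ _).trans ?_
        have := hA2 _ hy _ (hmem _ hkh t ht)
        rw [hsub] at this
        calc _ ≤ (C * ‖h‖ ^ 2) * 1 := mul_le_mul
              (this.trans (by gcongr; exact hth t ht)) (hkhR.le.trans hR1)
              (norm_nonneg _) (by positivity)
          _ = _ := mul_one _
      have hDh : ∀ v : E, ‖fderiv ℝ A (x₀ + t • k) (t • h) v‖ ≤ C * ‖h‖ * ‖v‖ := by
        intro v
        refine (ContinuousLinearMap.le_opNorm _ _).trans ?_
        gcongr
        refine (ContinuousLinearMap.le_opNorm _ _).trans ?_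
        exact mul_le_mul (hA' _ hy) (hth t ht) (norm_nonneg _) hC
      have e2 : ‖fderiv ℝ A (x₀ + t • k) (t • h) h * u (k + h) t‖ ≤ C * ‖h‖ * ‖h‖ * (3 * N) :=
        (norm_mul_le _ _).trans (mul_le_mul (hDh h) (hub _ hkh t ht) (norm_nonneg _)
          (by positivity))
      have e3 : ‖(fderiv ℝ A (x₀ + t • k) (t • h) k + A (x₀ + t • k) h) * (u (k + h) t - u k t)‖
          ≤ (C * ‖h‖ * 1 + C * ‖h‖) * (18 * N * C * ‖h‖) := by
        refine (norm_mul_le _ _).trans (mul_le_mul ?_ (hd t ht) (norm_nonneg _) (by positivity))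
        refine (norm_add_le _ _).trans (add_le_add ?_ ?_)
        · refine (hDh k).trans ?_
          gcongr
          exact hkR.le.trans hR1
        · exact ((A _).le_opNorm h).trans (mul_le_mul_of_nonneg_right (hA _ hy) (norm_nonneg _))
      calc _ ≤ C * ‖h‖ ^ 2 * (3 * N) + C * ‖h‖ * ‖h‖ * (3 * N)
            + (C * ‖h‖ * 1 + C * ‖h‖) * (18 * N * C * ‖h‖) :=
            (norm_add_le _ _).trans (add_le_add ((norm_add_le _ _).trans (add_le_add e1 e2)) e3)
        _ = (6 * C + 36 * C ^ 2) * (N * ‖h‖ ^ 2) := by ring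
        _ ≤ (100 * (C + 1) ^ 2) * (N * ‖h‖ ^ 2) := by
            gcongr
            nlinarith
        _ = _ := by ring
  rw [hasFDerivAt_iff_isLittleO_nhds_zero]
  have hO : (fun h : E => u (k + h) 1 - u k 1
      - ((ContinuousLinearMap.mul ℝ 𝔸).flip (u k 1) ∘L A (x₀ + k)) h) =O[𝓝 0] fun h => ‖h‖ ^ 2 := by
    refine Asymptotics.IsBigO.of_bound (300 * (N * (C + 1) ^ 2)) ?_
    have : ∀ᶠ h : E in 𝓝 0, k + h ∈ ball (0 : E) R := by
      have hc : ContinuousAt (fun h : E => k + h) 0 := by fun_prop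
      exact hc.eventually (isOpen_ball.mem_nhds (by simpa using hk))
    filter_upwards [this] with h hh
    simpa using key h hh
  refine hO.trans_isLittleO ?_
  have := (Asymptotics.isLittleO_norm_pow_id (E' := E) (n := 2) (by norm_num))
  exact this

/-- A function of class `C²` satisfies uniform first and second order estimates near a point. -/
theorem exists_uniform_taylor_bounds {F : Type*} [NormedAddCommGroup F] [NormedSpace ℝ F]
    {f : E → F} {x₀ : E} {U : Set E} (hU : IsOpen U) (hx₀ : x₀ ∈ U) (hf : ContDiffOn ℝ 2 f U) :
    ∃ R > 0, ∃ C ≥ 0, ∀ r ≤ R, ball x₀ r ⊆ U ∧ (∀ y ∈ ball x₀ r, DifferentiableAt ℝ f y) ∧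
      (∀ y ∈ ball x₀ r, ‖f y‖ ≤ C) ∧ (∀ y ∈ ball x₀ r, ‖fderiv ℝ f y‖ ≤ C) ∧
      (∀ y ∈ ball x₀ r, ∀ z ∈ ball x₀ r, ‖f z - f y‖ ≤ C * ‖z - y‖) ∧
      (∀ y ∈ ball x₀ r, ∀ z ∈ ball x₀ r,
        ‖f z - f y - fderiv ℝ f y (z - y)‖ ≤ C * ‖z - y‖ ^ 2) := by
  have hf0 : ContDiffAt ℝ 2 f x₀ := hf.contDiffAt (hU.mem_nhds hx₀)
  have hf1 : ContDiffAt ℝ 1 (fderiv ℝ f) x₀ := hf0.fderiv_right (by norm_num)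
  obtain ⟨K, s, hs, hK⟩ := hf1.exists_lipschitzOnWith
  have hb1 := eventually_norm_lt_add_one hf0.continuousAt
  have hb2 := eventually_norm_lt_add_one hf1.continuousAt
  obtain ⟨R, hR, hball⟩ := Metric.eventually_nhds_iff_ball.1
    (((hU.eventually_mem hx₀).and hs).and (hb1.and hb2))
  have hn1 := norm_nonneg (f x₀)
  have hn2 := norm_nonneg (fderiv ℝ f x₀)
  have hn3 : (0 : ℝ) ≤ K := K.2
  refine ⟨R, hR, ‖f x₀‖ + 1 + (‖fderiv ℝ f x₀‖ + 1) + K, by positivity, fun r hr => ?_⟩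
  have hB := fun y (hy : y ∈ ball x₀ r) => hball y (ball_subset_ball hr hy)
  have hdiff : ∀ y ∈ ball x₀ r, DifferentiableAt ℝ f y := fun y hy =>
    (hf.contDiffAt (hU.mem_nhds (hB y hy).1.1)).differentiableAt (by norm_num)
  have hf' : ∀ y ∈ ball x₀ r, ‖fderiv ℝ f y‖ ≤ ‖f x₀‖ + 1 + (‖fderiv ℝ f x₀‖ + 1) + K :=
    fun y hy => by linarith [(hB y hy).2.2]
  refine ⟨fun y hy => (hB y hy).1.1, hdiff, fun y hy => by linarith [(hB y hy).2.1], hf',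
    fun y hy z hz => (convex_ball x₀ r).norm_image_sub_le_of_norm_fderiv_le hdiff hf' hy hz,
    fun y hy z hz => ?_⟩
  have hseg : segment ℝ y z ⊆ ball x₀ r := (convex_ball x₀ r).segment_subset hy hz
  -- Mean value inequality for `f` minus its linearization at `y`: on the segment, `fderiv` varies
  -- by at most `K * ‖z - y‖`.
  have := (convex_segment y z).norm_image_sub_le_of_norm_hasFDerivWithin_le' (f := f)
    (f' := fderiv ℝ f) (φ := fderiv ℝ f y) (C := K * ‖z - y‖)
    (fun w hw => (hdiff w (hseg hw)).hasFDerivAt.hasFDerivWithinAt) ?_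
    (left_mem_segment ℝ y z) (right_mem_segment ℝ y z)
  · calc _ ≤ K * ‖z - y‖ * ‖z - y‖ := this
      _ = K * ‖z - y‖ ^ 2 := by ring
      _ ≤ _ := by gcongr; linarith
  · intro w hw
    refine (hK.norm_sub_le (hB w (hseg hw)).1.2 (hB y hy).1.2).trans ?_
    gcongr
    obtain ⟨a, b, ha, hb, hab, rfl⟩ := hw
    have : a • y + b • z - y = b • (z - y) := by
      have : a = 1 - b := by linarith
      subst this; module
    rw [this, norm_smul, Real.norm_of_nonneg hb]
    exact mul_le_of_le_one_left (norm_nonneg _) (by linarith)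

/-- A flat linear system has a local fundamental solution. -/
theorem exists_fundamental_solution [CompleteSpace 𝔸] {A : E → E →L[ℝ] 𝔸} {x₀ : E} {U : Set E}
    (hU : IsOpen U) (hx₀ : x₀ ∈ U) (hA : ContDiffOn ℝ 2 A U)
    (flat : ∀ y ∈ U, ∀ u v, fderiv ℝ A y u v + A y v * A y u = fderiv ℝ A y v u + A y u * A y v) :
    ∃ R > 0, ball x₀ R ⊆ U ∧ ∃ Φ : E → 𝔸, Φ x₀ = 1 ∧
      ∀ y ∈ ball x₀ R, HasFDerivAt Φ ((ContinuousLinearMap.mul ℝ 𝔸).flip (Φ y) ∘L A y) y := by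
  obtain ⟨R₀, hR₀, C, hC, hT⟩ := exists_uniform_taylor_bounds hU hx₀ hA
  -- The last condition is the smallness that `exists_linear_ode_solution` needs, since each radial
  -- coefficient is bounded by `C * R`.
  obtain ⟨R, hR, hRR, hR1, hCR'⟩ : ∃ R : ℝ, 0 < R ∧ R ≤ R₀ ∧ R ≤ 1 ∧
      C * R * (‖(1 : 𝔸)‖ + 1) ≤ 1 := by
    have hN : 0 ≤ ‖(1 : 𝔸)‖ := norm_nonneg _
    refine ⟨min R₀ (min 1 (1 / ((C + 1) * (‖(1 : 𝔸)‖ + 1)))), by positivity, min_le_left _ _,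
      (min_le_right _ _).trans (min_le_left _ _), ?_⟩
    have : min R₀ (min 1 (1 / ((C + 1) * (‖(1 : 𝔸)‖ + 1)))) ≤ 1 / ((C + 1) * (‖(1 : 𝔸)‖ + 1)) :=
      (min_le_right _ _).trans (min_le_right _ _)
    calc _ ≤ (C + 1) * (1 / ((C + 1) * (‖(1 : 𝔸)‖ + 1))) * (‖(1 : 𝔸)‖ + 1) := by
          gcongr
          linarith
      _ = 1 := by field_simp
  have hCR : C * R ≤ 1 := by
    have : 0 ≤ C * R := by positivity
    nlinarith [norm_nonneg (1 : 𝔸)]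
  obtain ⟨hBU, hdiff, hAC, hAC', hA1, hA2⟩ := hT R hRR
  have hmem : ∀ k ∈ ball (0 : E) R, ∀ t ∈ Icc (0 : ℝ) 1, x₀ + t • k ∈ ball x₀ R := by
    intro k hk t ht
    rw [mem_ball_zero_iff] at hk
    rw [mem_ball, dist_eq_norm, add_sub_cancel_left, norm_smul, Real.norm_of_nonneg ht.1]
    nlinarith [ht.2, norm_nonneg k]
  have hex : ∀ k ∈ ball (0 : E) R, ∃ u : ℝ → 𝔸, u 0 = 1 ∧ ∀ t ∈ Icc (0 : ℝ) 1,
      HasDerivWithinAt u (A (x₀ + t • k) k * u t) (Icc 0 1) t := by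
    intro k hk
    refine exists_linear_ode_solution (a := fun t => A (x₀ + t • k) k) (c := C * R) ?_
      (by positivity) ?_ hCR'
    · intro t ht
      refine ContinuousAt.continuousWithinAt ?_
      have h1 : ContinuousAt A (x₀ + t • k) := (hdiff _ (hmem k hk t ht)).continuousAt
      have h2 : ContinuousAt (fun t : ℝ => A (x₀ + t • k)) t :=
        ContinuousAt.comp (f := fun t : ℝ => x₀ + t • k) h1 (by fun_prop)
      exact h2.clm_apply continuousAt_const
    · intro t ht
      exact ((A _).le_opNorm k).trans (mul_le_mul (hAC _ (hmem k hk t ht))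
        (mem_ball_zero_iff.1 hk).le (norm_nonneg _) hC)
  choose! u hu0 hu using hex
  -- The value at `y` is transported along the straight ray from `x₀`; for `y = x₀` the radial
  -- equation reads u' = 0.
  refine ⟨R, hR, hBU, fun y => u (y - x₀) 1, ?_, ?_⟩
  · have h0 := hu 0 (mem_ball_self hR)
    have : ∀ t ∈ Icc (0 : ℝ) 1, ‖u 0 t - 1‖ ≤ 3 * (0 + 0) :=
      norm_le_of_norm_deriv_le (f := fun t => u 0 t - 1) (f' := fun _ => 0) le_rfl le_rfl
        (fun t ht => by simpa using (h0 t ht).sub_const 1) (by simp [hu0 0 (mem_ball_self hR)])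
        (fun t _ => by simp)
    have h1 := this 1 (by simp)
    simp only [add_zero, mul_zero, norm_le_zero_iff] at h1
    simpa [sub_eq_zero] using h1
  · intro y hy
    have hy' : y - x₀ ∈ ball (0 : E) R := by
      rw [mem_ball_zero_iff, ← dist_eq_norm]; exact hy
    have h := hasFDerivAt_of_radial_solution hC hR1 hCR hdiff hAC hAC' hA1 hA2
      (fun y hy => flat y (hBU hy)) hu0 hu hy'
    rw [add_sub_cancel] at h
    have h2 := h.comp y ((hasFDerivAt_id y).sub_const x₀)
    rw [ContinuousLinearMap.comp_id] at h2
    exact h2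

/-- Solutions of a smooth linear system are smooth. -/
theorem contDiffOn_of_hasFDerivAt_mul {A : E → E →L[ℝ] 𝔸} {U : Set E} (hU : IsOpen U)
    (hA : ContDiffOn ℝ ∞ A U) {Φ : E → 𝔸}
    (hΦ : ∀ y ∈ U, HasFDerivAt Φ ((ContinuousLinearMap.mul ℝ 𝔸).flip (Φ y) ∘L A y) y) :
    ContDiffOn ℝ ∞ Φ U := by
  -- Bootstrapping: the derivative of `Φ` is a smooth expression in `Φ` and `A`, so class Cⁿ
  -- improves to Cⁿ⁺¹.
  refine contDiffOn_infty.2 fun n => ?_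
  induction n with
  | zero => exact contDiffOn_zero.2 fun y hy => (hΦ y hy).continuousAt.continuousWithinAt
  | succ n ih =>
    rw [show ((n + 1 : ℕ) : WithTop ℕ∞) = (n : WithTop ℕ∞) + 1 by push_cast; rfl]
    refine (contDiffOn_succ_iff_fderiv_of_isOpen hU).2
      ⟨fun y hy => (hΦ y hy).differentiableAt.differentiableWithinAt,
        fun h => absurd h (by simp), ?_⟩
    have : ContDiffOn ℝ n
        (fun y => (ContinuousLinearMap.mul ℝ 𝔸).flip (Φ y) ∘L A y) U :=
      ((ContinuousLinearMap.contDiff _).comp_contDiffOn ih).clm_comp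
        (hA.of_le (by exact_mod_cast le_top))
    exact this.congr fun y hy => (hΦ y hy).fderiv

end Frobenius

/-! ### The Levi-Civita connection from the Koszul formula. -/

section LeviCivita

variable {M : Type*} [TopologicalSpace M] [ChartedSpace E3 M] [IsManifold (𝓡 3) ∞ M]

/-- The vector field `X` is differentiable at `x`. -/
abbrev VField.DiffAt (X : VField M) (x : M) : Prop :=
  MDifferentiableAt (𝓡 3) ((𝓡 3).prod 𝓘(ℝ, E3)) (fun y => (⟨y, X y⟩ : TangentBundle (𝓡 3) M)) x

/-- The real function `f` is differentiable at `x`. -/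
abbrev FDiffAt (f : M → ℝ) (x : M) : Prop := MDifferentiableAt (𝓡 3) 𝓘(ℝ, ℝ) f x

section Basic

variable {x : M} {X X' Y Y' Z Z' : VField M} {f f' : M → ℝ}

theorem VField.SmoothOn.contMDiffAt {U : Set M} (hU : IsOpen U) (hX : X.SmoothOn U) (hx : x ∈ U) :
    ContMDiffAt (𝓡 3) ((𝓡 3).prod 𝓘(ℝ, E3)) ∞ (fun y => (⟨y, X y⟩ : TangentBundle (𝓡 3) M)) x :=
  ContMDiffOn.contMDiffAt hX (hU.mem_nhds hx)

theorem VField.SmoothOn.diffAt {U : Set M} (hU : IsOpen U) (hX : X.SmoothOn U) (hx : x ∈ U) :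
    X.DiffAt x :=
  (hX.contMDiffAt hU hx).mdifferentiableAt (by simp)

theorem VField.DiffAt.add (hX : X.DiffAt x) (hY : Y.DiffAt x) : VField.DiffAt (X + Y) x :=
  mdifferentiableAt_add_section hX hY

theorem VField.DiffAt.smul (hf : FDiffAt f x) (hX : X.DiffAt x) : VField.DiffAt (f • X) x :=
  MDifferentiableAt.smul_section hf hX

theorem VField.DiffAt.congr (hX : X.DiffAt x) (h : X =ᶠ[𝓝 x] Y) : Y.DiffAt x :=
  MDifferentiableAt.congr_of_eventuallyEq hX (h.mono fun y hy => by simp only [hy])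

theorem dirDeriv_congr (h : f =ᶠ[𝓝 x] f') (v : TangentSpace (𝓡 3) x) :
    dirDeriv f x v = dirDeriv f' x v := by
  simp only [dirDeriv, mvfderiv]
  rw [show mfderiv (𝓡 3) 𝓘(ℝ, ℝ) f x = mfderiv (𝓡 3) 𝓘(ℝ, ℝ) f' x from h.mfderiv_eq]
  rfl

theorem dirDeriv_const (c : ℝ) (v : TangentSpace (𝓡 3) x) : dirDeriv (fun _ => c) x v = 0 := by
  rw [dirDeriv, mvfderiv_const]; rfl

theorem dirDeriv_eq_zero {c : ℝ} (h : ∀ᶠ y in 𝓝 x, f y = c) (v : TangentSpace (𝓡 3) x) :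
    dirDeriv f x v = 0 := by
  rw [dirDeriv_congr (f' := fun _ => c) h, dirDeriv_const]

theorem dirDeriv_add (hf : FDiffAt f x) (hf' : FDiffAt f' x) (v : TangentSpace (𝓡 3) x) :
    dirDeriv (fun y => f y + f' y) x v = dirDeriv f x v + dirDeriv f' x v := by
  simp only [dirDeriv]
  rw [mvfderiv_fun_add hf hf']
  rfl

theorem dirDeriv_sub (hf : FDiffAt f x) (hf' : FDiffAt f' x) (v : TangentSpace (𝓡 3) x) :
    dirDeriv (fun y => f y - f' y) x v = dirDeriv f x v - dirDeriv f' x v := by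
  simp only [dirDeriv]
  rw [mvfderiv_fun_sub hf hf']
  rfl

theorem dirDeriv_mul (hf : FDiffAt f x) (hf' : FDiffAt f' x) (v : TangentSpace (𝓡 3) x) :
    dirDeriv (fun y => f y * f' y) x v = f x * dirDeriv f' x v + f' x * dirDeriv f x v := by
  simp only [dirDeriv]
  rw [mvfderiv_fun_mul hf hf']
  rfl

theorem dirDeriv_vadd (v w : TangentSpace (𝓡 3) x) :
    dirDeriv f x (v + w) = dirDeriv f x v + dirDeriv f x w := by
  simp only [dirDeriv, map_add]

theorem dirDeriv_vsmul (c : ℝ) (v : TangentSpace (𝓡 3) x) :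
    dirDeriv f x (c • v) = c * dirDeriv f x v := by
  simp only [dirDeriv, map_smul, smul_eq_mul]

theorem bracket_congr (hX : X =ᶠ[𝓝 x] X') (hY : Y =ᶠ[𝓝 x] Y') :
    bracket X Y x = bracket X' Y' x :=
  hX.mlieBracket_vectorField_eq hY

theorem bracket_swap (X Y : VField M) (x : M) : bracket X Y x = - bracket Y X x :=
  VectorField.mlieBracket_swap_apply

theorem bracket_self (X : VField M) (x : M) : bracket X X x = 0 := by
  simp [bracket]

theorem bracket_add_left (hX : X.DiffAt x) (hX' : X'.DiffAt x) :
    bracket (X + X') Y x = bracket X Y x + bracket X' Y x :=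
  VectorField.mlieBracket_add_left hX hX'

theorem bracket_add_right (hY : Y.DiffAt x) (hY' : Y'.DiffAt x) :
    bracket X (Y + Y') x = bracket X Y x + bracket X Y' x :=
  VectorField.mlieBracket_add_right hY hY'

theorem bracket_smul_left (hf : FDiffAt f x) (hX : X.DiffAt x) :
    bracket (f • X) Y x = - dirDeriv f x (Y x) • X x + f x • bracket X Y x :=
  VectorField.mlieBracket_smul_left hf hX

theorem bracket_smul_right (hf : FDiffAt f x) (hY : Y.DiffAt x) :
    bracket X (f • Y) x = dirDeriv f x (X x) • Y x + f x • bracket X Y x :=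
  VectorField.mlieBracket_smul_right hf hY

end Basic

namespace LorentzianMetric

variable (G : LorentzianMetric M) {x : M} {X X' Y Y' Z Z' : VField M} {f : M → ℝ}

theorem contMDiffOn_apply {U : Set M} (hX : X.SmoothOn U) (hY : Y.SmoothOn U) :
    ContMDiffOn (𝓡 3) 𝓘(ℝ, ℝ) ∞ (fun y => G.form y (X y) (Y y)) U := by
  have h := ContMDiffOn.clm_bundle_apply₂ (IB := 𝓡 3) (IM := 𝓡 3) (n := ∞) (s := U) (b := fun y : M => y)
    (F₃ := ℝ) (E₃ := fun _ : M => ℝ) (ψ := fun y => G.form y) G.smooth.contMDiffOn hX hY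
  exact fun y hy => (Bundle.contMDiffWithinAt_totalSpace.1 (h y hy)).2

theorem fdiffAt_apply (hX : X.DiffAt x) (hY : Y.DiffAt x) :
    FDiffAt (fun y => G.form y (X y) (Y y)) x := by
  have h := MDifferentiableAt.clm_bundle_apply₂ (IB := 𝓡 3) (IM := 𝓡 3) (x := x)
    (b := fun y : M => y)
    (F₃ := ℝ) (E₃ := fun _ : M => ℝ) (ψ := fun y => G.form y)
    (G.smooth.contMDiffAt.mdifferentiableAt (by simp)) hX hY
  exact ((mdifferentiableAt_totalSpace _ _).1 h).2

theorem nondegenerate {v w : TangentSpace (𝓡 3) x}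
    (h : ∀ u : TangentSpace (𝓡 3) x, G.form x v u = G.form x w u) : v = w := by
  obtain ⟨b, hb⟩ := G.signature x
  refine b.repr.injective (Finsupp.ext fun i => ?_)
  have hv : ∀ v : TangentSpace (𝓡 3) x, G.form x v (b i) = b.repr v i * sgn i := by
    intro v
    conv_lhs => rw [← b.sum_repr v]
    simp only [map_sum, map_smul, sum_apply, smul_apply, hb, smul_eq_mul]
    simp
  have h1 := h (b i)
  rw [hv, hv] at h1
  refine mul_right_cancel₀ ?_ h1
  fin_cases i <;> simp [sgn]

theorem exists_dual (L : TangentSpace (𝓡 3) x →ₗ[ℝ] ℝ) :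
    ∃ w : TangentSpace (𝓡 3) x, ∀ u, G.form x w u = L u := by
  obtain ⟨b, hb⟩ := G.signature x
  refine ⟨∑ i, (sgn i * L (b i)) • b i, fun u => ?_⟩
  have : (G.form x (∑ i, (sgn i * L (b i)) • b i)).toLinearMap = L := by
    refine b.ext fun j => ?_
    simp only [map_sum, map_smul, ContinuousLinearMap.coe_coe, sum_apply, smul_apply, hb,
      smul_eq_mul]
    have hj : sgn j * sgn j = 1 := by fin_cases j <;> simp [sgn]
    simp [mul_comm, ← mul_assoc, hj]
  exact congrArg (fun l => l u) this

/-- The terms that differentiate the factor `f` cancel between the derivatives and the brackets.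
Hence the Koszul expression is a covector in the value of `Z` at `x`. -/
theorem tensorialAt_koszul (hX : X.DiffAt x) (hY : Y.DiffAt x) :
    TensorialAt (𝓡 3) E3 (fun Z => koszul G.form X Y Z x) x where
  smul := by
    intro f Z hf hZ
    simp only [koszul]
    have e1 : (fun y => G.form y (Y y) ((f • Z) y)) = fun y => f y * G.form y (Y y) (Z y) := by
      funext y; simp
    have e2 : (fun y => G.form y (X y) ((f • Z) y)) = fun y => f y * G.form y (X y) (Z y) := by
      funext y; simp
    rw [e1, e2, dirDeriv_mul hf (G.fdiffAt_apply hY hZ), dirDeriv_mul hf (G.fdiffAt_apply hX hZ),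
      bracket_smul_right hf hZ, bracket_smul_right hf hZ]
    simp only [Pi.smul_apply', dirDeriv_vsmul, map_add, map_smul, add_apply, smul_apply, smul_eq_mul]
    rw [G.symm x (Z x) (Y x), G.symm x (Z x) (X x)]
    ring
  add := by
    intro Z Z' hZ hZ'
    simp only [koszul]
    have e1 : (fun y => G.form y (Y y) ((Z + Z') y))
        = fun y => G.form y (Y y) (Z y) + G.form y (Y y) (Z' y) := by
      funext y; simp
    have e2 : (fun y => G.form y (X y) ((Z + Z') y))
        = fun y => G.form y (X y) (Z y) + G.form y (X y) (Z' y) := by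
      funext y; simp
    rw [e1, e2, dirDeriv_add (G.fdiffAt_apply hY hZ) (G.fdiffAt_apply hY hZ'),
      dirDeriv_add (G.fdiffAt_apply hX hZ) (G.fdiffAt_apply hX hZ'),
      bracket_add_right hZ hZ', bracket_add_right hZ hZ']
    simp only [Pi.add_apply, dirDeriv_vadd, map_add, add_apply]
    ring

/-- By tensoriality the Koszul expression is a covector, and nondegeneracy represents it by a
vector; so the choice made in `nabla` meets its specification. -/
theorem nabla_spec (hX : X.DiffAt x) (hY : Y.DiffAt x) (hZ : Z.DiffAt x) :
    2 * G.form x (nabla G.form X Y x) (Z x) = koszul G.form X Y Z x := by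
  have hT := G.tensorialAt_koszul hX hY
  obtain ⟨w, hw⟩ := G.exists_dual
    ((TensorialAt.mkHom (F := E3) (fun Z => koszul G.form X Y Z x) x hT).toLinearMap)
  have hex : ∃ w : TangentSpace (𝓡 3) x, ∀ Z : VField M,
      MDifferentiableAt (𝓡 3) ((𝓡 3).prod 𝓘(ℝ, E3))
        (fun y => (⟨y, Z y⟩ : TangentBundle (𝓡 3) M)) x →
      2 * G.form x w (Z x) = koszul G.form X Y Z x := by
    refine ⟨(1 / 2 : ℝ) • w, fun Z hZ => ?_⟩
    have := TensorialAt.mkHom_apply hT hZ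
    simp only [map_smul, smul_apply, smul_eq_mul, hw]
    simp only [ContinuousLinearMap.coe_coe]
    rw [this]
    ring
  exact Classical.epsilon_spec hex Z hZ

/-- Two tangent vectors agree if they have the same products with all differentiable fields. -/
theorem ext_of_form {v w : TangentSpace (𝓡 3) x}
    (h : ∀ Z : VField M, Z.DiffAt x → 2 * G.form x v (Z x) = 2 * G.form x w (Z x)) : v = w := by
  refine G.nondegenerate fun u => ?_
  have := h (FiberBundle.extend E3 u) (FiberBundle.mdifferentiableAt_extend (𝓡 3) E3 u)
  rw [FiberBundle.extend_apply_self] at this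
  linarith

theorem nabla_congr (hX : X =ᶠ[𝓝 x] X') (hY : Y =ᶠ[𝓝 x] Y') :
    nabla G.form X Y x = nabla G.form X' Y' x := by
  have : ∀ Z, koszul G.form X Y Z x = koszul G.form X' Y' Z x := by
    intro Z
    have hX0 := hX.self_of_nhds
    have hY0 := hY.self_of_nhds
    simp only [koszul]
    rw [bracket_congr hX hY, bracket_congr hX (Filter.EventuallyEq.refl (𝓝 x) Z),
      bracket_congr hY (Filter.EventuallyEq.refl (𝓝 x) Z), hX0, hY0,
      dirDeriv_congr (f := fun y => G.form y (Y y) (Z y)) (f' := fun y => G.form y (Y' y) (Z y))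
        (hY.mono fun y hy => by simp only [hy]),
      dirDeriv_congr (f := fun y => G.form y (X y) (Z y)) (f' := fun y => G.form y (X' y) (Z y))
        (hX.mono fun y hy => by simp only [hy]),
      dirDeriv_congr (f := fun y => G.form y (X y) (Y y)) (f' := fun y => G.form y (X' y) (Y' y))
        (by filter_upwards [hX, hY] with y h1 h2; simp only [h1, h2])]
  simp only [nabla, this]

/-- Torsion-freeness: the part of the Koszul expression symmetric in `X` and `Y` drops out. -/
theorem nabla_sub_nabla (hX : X.DiffAt x) (hY : Y.DiffAt x) :
    nabla G.form X Y x - nabla G.form Y X x = bracket X Y x := by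
  refine G.ext_of_form fun Z hZ => ?_
  rw [map_sub, sub_apply, mul_sub, G.nabla_spec hX hY hZ, G.nabla_spec hY hX hZ]
  simp only [koszul]
  rw [bracket_swap Y X, show (fun y => G.form y (Y y) (X y)) = fun y => G.form y (X y) (Y y) from
    funext fun y => G.symm y _ _]
  simp only [map_neg, neg_apply]
  ring

/-- Metric compatibility, from the sum of two Koszul formulas with `Y` and `Z` exchanged. -/
theorem dirDeriv_form (hX : X.DiffAt x) (hY : Y.DiffAt x) (hZ : Z.DiffAt x) :
    dirDeriv (fun y => G.form y (Y y) (Z y)) x (X x)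
      = G.form x (nabla G.form X Y x) (Z x) + G.form x (Y x) (nabla G.form X Z x) := by
  have h1 := G.nabla_spec hX hY hZ
  have h2 := G.nabla_spec hX hZ hY
  rw [G.symm x (Y x)]
  simp only [koszul] at h1 h2
  rw [bracket_swap Z Y, show (fun y => G.form y (Z y) (Y y)) = fun y => G.form y (Y y) (Z y) from
    funext fun y => G.symm y _ _] at h2
  simp only [map_neg, neg_apply] at h2
  linarith

theorem nabla_add_right (hX : X.DiffAt x) (hY : Y.DiffAt x) (hY' : Y'.DiffAt x) :
    nabla G.form X (Y + Y') x = nabla G.form X Y x + nabla G.form X Y' x := by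
  refine G.ext_of_form fun Z hZ => ?_
  rw [map_add, add_apply, mul_add, G.nabla_spec hX hY hZ, G.nabla_spec hX hY' hZ,
    G.nabla_spec hX (hY.add hY') hZ]
  simp only [koszul]
  have e1 : (fun y => G.form y ((Y + Y') y) (Z y))
      = fun y => G.form y (Y y) (Z y) + G.form y (Y' y) (Z y) := by
    funext y; simp
  have e2 : (fun y => G.form y (X y) ((Y + Y') y))
      = fun y => G.form y (X y) (Y y) + G.form y (X y) (Y' y) := by
    funext y; simp
  rw [e1, e2, dirDeriv_add (G.fdiffAt_apply hY hZ) (G.fdiffAt_apply hY' hZ),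
    dirDeriv_add (G.fdiffAt_apply hX hY) (G.fdiffAt_apply hX hY'), bracket_add_right hY hY',
    bracket_add_left hY hY']
  simp only [Pi.add_apply, dirDeriv_vadd, map_add, add_apply]
  ring

theorem nabla_smul_right (hf : FDiffAt f x) (hX : X.DiffAt x) (hY : Y.DiffAt x) :
    nabla G.form X (f • Y) x = dirDeriv f x (X x) • Y x + f x • nabla G.form X Y x := by
  refine G.ext_of_form fun Z hZ => ?_
  simp only [map_add, add_apply, map_smul, smul_apply, smul_eq_mul]
  have h := G.nabla_spec hX hY hZ
  have h' := G.nabla_spec hX (hY.smul hf) hZ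
  rw [h', mul_add]
  simp only [koszul] at h ⊢
  have e1 : (fun y => G.form y ((f • Y) y) (Z y)) = fun y => f y * G.form y (Y y) (Z y) := by
    funext y; simp
  have e2 : (fun y => G.form y (X y) ((f • Y) y)) = fun y => f y * G.form y (X y) (Y y) := by
    funext y; simp
  rw [e1, e2, dirDeriv_mul hf (G.fdiffAt_apply hY hZ), dirDeriv_mul hf (G.fdiffAt_apply hX hY),
    bracket_smul_right hf hY, bracket_smul_left hf hY]
  simp only [Pi.smul_apply', dirDeriv_vsmul, map_add, map_smul, add_apply, smul_apply, smul_eq_mul]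
  rw [G.symm x (Y x) (X x)]
  linear_combination -(f x) * h

/-- Torsion-freeness transfers additivity from the differentiated field to the direction; the same
device serves for function multiples. -/
theorem nabla_add_left (hX : X.DiffAt x) (hX' : X'.DiffAt x) (hY : Y.DiffAt x) :
    nabla G.form (X + X') Y x = nabla G.form X Y x + nabla G.form X' Y x := by
  have h1 := G.nabla_sub_nabla (hX.add hX') hY
  have h2 := G.nabla_sub_nabla hX hY
  have h3 := G.nabla_sub_nabla hX' hY
  rw [bracket_add_left hX hX', ← h2, ← h3, G.nabla_add_right hY hX hX'] at h1
  rw [sub_eq_iff_eq_add.1 h1]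
  abel

theorem nabla_smul_left (hf : FDiffAt f x) (hX : X.DiffAt x) (hY : Y.DiffAt x) :
    nabla G.form (f • X) Y x = f x • nabla G.form X Y x := by
  have h1 := G.nabla_sub_nabla (hX.smul hf) hY
  have h2 := G.nabla_sub_nabla hX hY
  rw [bracket_smul_left hf hX, ← h2, G.nabla_smul_right hf hY hX] at h1
  rw [sub_eq_iff_eq_add.1 h1]
  module

theorem tensorialAt_nabla (hY : Y.DiffAt x) :
    TensorialAt (𝓡 3) E3 (fun X => nabla G.form X Y x) x where
  smul := fun hf hX => G.nabla_smul_left hf hX hY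
  add := fun hX hX' => G.nabla_add_left hX hX' hY

end LorentzianMetric

end LeviCivita

/-! ### Orthonormal frames and their structure functions. -/

section Frames

variable {M : Type*} [TopologicalSpace M] [ChartedSpace E3 M] [IsManifold (𝓡 3) ∞ M]

/-- A smooth vector field on an open set agrees near every point of it with a global one. -/
theorem VField.SmoothOn.exists_smooth_eventuallyEq [T2Space M] {X : VField M} {U : Set M}
    (hU : IsOpen U) (hX : X.SmoothOn U) {x : M} (hx : x ∈ U) :
    ∃ X' : VField M, X'.Smooth ∧ X' =ᶠ[𝓝 x] X := by
  obtain ⟨f, -, hf⟩ := (SmoothBumpFunction.nhds_basis_tsupport (I := 𝓡 3) x).mem_iff.1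
    (hU.mem_nhds hx)
  refine ⟨(f : M → ℝ) • X, ContMDiffOn.smul_section_of_tsupport f.contMDiff.contMDiffOn hU hf hX, ?_⟩
  filter_upwards [f.eventuallyEq_one] with y hy
  change f y • X y = X y
  rw [hy]
  exact one_smul ℝ _

theorem VField.SmoothOn.add {X Y : VField M} {U : Set M} (hX : X.SmoothOn U) (hY : Y.SmoothOn U) :
    VField.SmoothOn (X + Y) U := ContMDiffOn.add_section hX hY

theorem VField.SmoothOn.neg {X : VField M} {U : Set M} (hX : X.SmoothOn U) :
    VField.SmoothOn (-X) U := ContMDiffOn.neg_section hX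

theorem VField.SmoothOn.smul {f : M → ℝ} {X : VField M} {U : Set M}
    (hf : ContMDiffOn (𝓡 3) 𝓘(ℝ, ℝ) ∞ f U) (hX : X.SmoothOn U) :
    VField.SmoothOn (f • X) U := ContMDiffOn.smul_section hf hX

theorem VField.SmoothOn.mono {X : VField M} {U V : Set M} (hX : X.SmoothOn U) (h : V ⊆ U) :
    X.SmoothOn V := ContMDiffOn.mono hX h

theorem VField.SmoothOn.bracket {X Y : VField M} {U : Set M} (hU : IsOpen U) (hX : X.SmoothOn U)
    (hY : Y.SmoothOn U) : VField.SmoothOn (LorentzSasaki.bracket X Y) U := by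
  intro x hx
  have hM : IsManifold (𝓡 3) (((⊤ : ℕ∞) : WithTop ℕ∞) + 1) M := ‹IsManifold (𝓡 3) ∞ M›
  have hM' : IsManifold (𝓡 3) (minSmoothness ℝ 2) M := by
    rw [minSmoothness_of_isRCLikeNormedField]
    infer_instance
  have hM'' : IsManifold (𝓡 3) (minSmoothness ℝ 3) M := by
    rw [minSmoothness_of_isRCLikeNormedField]
    infer_instance
  exact (ContMDiffAt.mlieBracket_vectorField (m := ⊤) (n := ⊤) (hX.contMDiffAt hU hx)
    (hY.contMDiffAt hU hx) (by simp)).contMDiffWithinAt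

theorem fdiffAt_of_contMDiffOn {f : M → ℝ} {U : Set M} (hU : IsOpen U)
    (hf : ContMDiffOn (𝓡 3) 𝓘(ℝ, ℝ) ∞ f U) {x : M} (hx : x ∈ U) : FDiffAt f x :=
  (hf.contMDiffAt (hU.mem_nhds hx)).mdifferentiableAt (by simp)

/-- `e` is a smooth orthonormal frame on the open set `U`. -/
structure OrthoFrame (G : LorentzianMetric M) (U : Set M) (e : Fin 3 → VField M) : Prop where
  isOpen : IsOpen U
  smooth : ∀ a, (e a).SmoothOn U
  ortho : ∀ x ∈ U, ∀ a b, G.form x (e a x) (e b x) = if a = b then sgn a else 0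

/-- The structure functions `g([eₐ, e_b], e_c)` of a frame. -/
def structureFun (G : LorentzianMetric M) (e : Fin 3 → VField M) (a b c : Fin 3) (x : M) : ℝ :=
  G.form x (bracket (e a) (e b) x) (e c x)

/-- The connection coefficients of an orthonormal frame. -/
def connCoeff (G : LorentzianMetric M) (e : Fin 3 → VField M) (a b c : Fin 3) (x : M) : ℝ :=
  (structureFun G e a b c x - structureFun G e a c b x - structureFun G e b c a x) / 2

theorem structureFun_swap (G : LorentzianMetric M) (e : Fin 3 → VField M) (a b c : Fin 3) (x : M) :
    structureFun G e a b c x = - structureFun G e b a c x := by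
  simp [structureFun, bracket_swap (e a) (e b) x]

theorem structureFun_self (G : LorentzianMetric M) (e : Fin 3 → VField M) (a c : Fin 3) (x : M) :
    structureFun G e a a c x = 0 := by
  simp [structureFun, bracket_self]

theorem curv_congr (G : LorentzianMetric M) {X X' Y Y' Z Z' : VField M} {x : M} (hX : X =ᶠ[𝓝 x] X')
    (hY : Y =ᶠ[𝓝 x] Y') (hZ : Z =ᶠ[𝓝 x] Z') :
    curv G.form X Y Z x = curv G.form X' Y' Z' x := by
  have key : ∀ {A A' B B' : VField M}, A =ᶠ[𝓝 x] A' → B =ᶠ[𝓝 x] B' →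
      nabla G.form A B =ᶠ[𝓝 x] nabla G.form A' B' := by
    intro A A' B B' hA hB
    filter_upwards [hA.eventuallyEq_nhds, hB.eventuallyEq_nhds] with y h1 h2
    exact G.nabla_congr h1 h2
  have hb : bracket X Y =ᶠ[𝓝 x] bracket X' Y' := hX.mlieBracket_vectorField hY
  simp only [curv, Pi.sub_apply]
  rw [G.nabla_congr hX (key hY hZ), G.nabla_congr hY (key hX hZ), G.nabla_congr hb hZ]

namespace OrthoFrame

variable {G : LorentzianMetric M} {U : Set M} {e : Fin 3 → VField M} (hE : OrthoFrame G U e)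
include hE

theorem diffAt {x : M} (hx : x ∈ U) (a : Fin 3) : (e a).DiffAt x := (hE.smooth a).diffAt hE.isOpen hx

theorem linearIndependent {x : M} (hx : x ∈ U) : LinearIndependent ℝ fun a => e a x := by
  rw [Fintype.linearIndependent_iff]
  intro c hc a
  have h := congrArg (fun v => G.form x v (e a x)) hc
  simp only [map_sum, map_smul, sum_apply, smul_apply, hE.ortho x hx, smul_eq_mul, map_zero,
    zero_apply] at h
  have ha : sgn a ≠ 0 := by fin_cases a <;> simp [sgn]
  simpa [ha] using h

theorem expand {x : M} (hx : x ∈ U) (v : TangentSpace (𝓡 3) x) :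
    v = ∑ a, coord G.form e x v a • e a x := by
  have hcard : Fintype.card (Fin 3) = Module.finrank ℝ (TangentSpace (𝓡 3) x) := by
    change _ = Module.finrank ℝ E3
    simp
  have hfin : FiniteDimensional ℝ (TangentSpace (𝓡 3) x) := inferInstanceAs (FiniteDimensional ℝ E3)
  have hspan := (hE.linearIndependent hx).span_eq_top_of_card_eq_finrank' hcard
  obtain ⟨c, hc⟩ := (Submodule.mem_span_range_iff_exists_fun ℝ).1
    (hspan ▸ Submodule.mem_top : v ∈ Submodule.span ℝ (Set.range fun a => e a x))
  have : ∀ a, coord G.form e x v a = c a := by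
    intro a
    rw [coord, ← hc]
    simp only [map_sum, map_smul, sum_apply, smul_apply, hE.ortho x hx, smul_eq_mul]
    have hj : sgn a * sgn a = 1 := by fin_cases a <;> simp [sgn]
    simp only [mul_ite, mul_zero, Finset.sum_ite_eq', Finset.mem_univ, if_true]
    linear_combination c a * hj
  exact hc.symm.trans (Finset.sum_congr rfl fun a _ => by rw [this])

theorem contMDiffOn_structureFun (a b c : Fin 3) :
    ContMDiffOn (𝓡 3) 𝓘(ℝ, ℝ) ∞ (structureFun G e a b c) U :=
  G.contMDiffOn_apply ((hE.smooth a).bracket hE.isOpen (hE.smooth b)) (hE.smooth c)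

theorem contMDiffOn_connCoeff (a b c : Fin 3) :
    ContMDiffOn (𝓡 3) 𝓘(ℝ, ℝ) ∞ (connCoeff G e a b c) U := by
  have h := ((hE.contMDiffOn_structureFun a b c).sub (hE.contMDiffOn_structureFun a c b)).sub
    (hE.contMDiffOn_structureFun b c a)
  refine (contMDiffOn_const (c := (1 / 2 : ℝ)).mul h).congr fun y _ => ?_
  simp only [connCoeff, Pi.mul_apply]
  ring

theorem fdiffAt_structureFun {x : M} (hx : x ∈ U) (a b c : Fin 3) :
    FDiffAt (structureFun G e a b c) x :=
  fdiffAt_of_contMDiffOn hE.isOpen (hE.contMDiffOn_structureFun a b c) hx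

theorem fdiffAt_connCoeff {x : M} (hx : x ∈ U) (a b c : Fin 3) :
    FDiffAt (connCoeff G e a b c) x :=
  fdiffAt_of_contMDiffOn hE.isOpen (hE.contMDiffOn_connCoeff a b c) hx

theorem bracket_eq {x : M} (hx : x ∈ U) (a b : Fin 3) :
    bracket (e a) (e b) x = ∑ c, (sgn c * structureFun G e a b c x) • e c x :=
  hE.expand hx _

/-- The products of frame fields are constant, so only the bracket terms of the Koszul formula
survive. -/
theorem form_nabla {x : M} (hx : x ∈ U) (a b c : Fin 3) :
    G.form x (nabla G.form (e a) (e b) x) (e c x) = connCoeff G e a b c x := by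
  have h := G.nabla_spec (hE.diffAt hx a) (hE.diffAt hx b) (hE.diffAt hx c)
  have h0 : ∀ a b c, dirDeriv (fun y => G.form y (e a y) (e b y)) x (e c x) = 0 := by
    intro a b c
    refine dirDeriv_eq_zero (c := if a = b then sgn a else 0) ?_ _
    filter_upwards [hE.isOpen.mem_nhds hx] with y hy
    exact hE.ortho y hy a b
  simp only [koszul, h0] at h
  simp only [connCoeff, structureFun]
  linarith

theorem nabla_eq {x : M} (hx : x ∈ U) (a b : Fin 3) :
    nabla G.form (e a) (e b) x = ∑ c, (sgn c * connCoeff G e a b c x) • e c x := by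
  rw [hE.expand hx (nabla G.form (e a) (e b) x)]
  simp only [coord, hE.form_nabla hx]

/-- The field with components `f`. -/
theorem nabla_combination {x : M} (hx : x ∈ U) {X : VField M} (hX : X.DiffAt x) {f : Fin 3 → M → ℝ}
    (hf : ∀ a, FDiffAt (f a) x) :
    nabla G.form X (f 0 • e 0 + f 1 • e 1 + f 2 • e 2) x
      = ∑ a, (dirDeriv (f a) x (X x) • e a x + f a x • nabla G.form X (e a) x) := by
  have h := fun a => (hE.diffAt hx a).smul (hf a)
  rw [G.nabla_add_right hX ((h 0).add (h 1)) (h 2), G.nabla_add_right hX (h 0) (h 1)]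
  simp only [G.nabla_smul_right (hf _) hX (hE.diffAt hx _), Fin.sum_univ_three]

theorem nabla_combination_left {x : M} (hx : x ∈ U) {Y : VField M} (hY : Y.DiffAt x)
    {f : Fin 3 → M → ℝ} (hf : ∀ a, FDiffAt (f a) x) :
    nabla G.form (f 0 • e 0 + f 1 • e 1 + f 2 • e 2) Y x
      = ∑ a, f a x • nabla G.form (e a) Y x := by
  have h := fun a => (hE.diffAt hx a).smul (hf a)
  rw [G.nabla_add_left ((h 0).add (h 1)) (h 2) hY, G.nabla_add_left (h 0) (h 1) hY]
  simp only [G.nabla_smul_left (hf _) (hE.diffAt hx _) hY, Fin.sum_univ_three]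

theorem bracket_combination {x : M} (hx : x ∈ U) {X : VField M} {f : Fin 3 → M → ℝ}
    (hf : ∀ a, FDiffAt (f a) x) :
    bracket X (f 0 • e 0 + f 1 • e 1 + f 2 • e 2) x
      = ∑ a, (dirDeriv (f a) x (X x) • e a x + f a x • bracket X (e a) x) := by
  have h := fun a => (hE.diffAt hx a).smul (hf a)
  rw [bracket_add_right ((h 0).add (h 1)) (h 2), bracket_add_right (h 0) (h 1)]
  simp only [bracket_smul_right (hf _) (hE.diffAt hx _), Fin.sum_univ_three]

theorem eventually_nabla_eq {x : M} (hx : x ∈ U) (a b : Fin 3) :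
    nabla G.form (e a) (e b) =ᶠ[𝓝 x] (fun y => sgn 0 * connCoeff G e a b 0 y) • e 0
      + (fun y => sgn 1 * connCoeff G e a b 1 y) • e 1
      + (fun y => sgn 2 * connCoeff G e a b 2 y) • e 2 := by
  filter_upwards [hE.isOpen.mem_nhds hx] with y hy
  rw [hE.nabla_eq hy, Fin.sum_univ_three]
  rfl

theorem eventually_bracket_eq {x : M} (hx : x ∈ U) (a b : Fin 3) :
    bracket (e a) (e b) =ᶠ[𝓝 x] (fun y => sgn 0 * structureFun G e a b 0 y) • e 0
      + (fun y => sgn 1 * structureFun G e a b 1 y) • e 1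
      + (fun y => sgn 2 * structureFun G e a b 2 y) • e 2 := by
  filter_upwards [hE.isOpen.mem_nhds hx] with y hy
  rw [hE.bracket_eq hy, Fin.sum_univ_three]
  rfl

theorem dirDeriv_const_mul {x : M} {f : M → ℝ} (hf : FDiffAt f x) (c : ℝ)
    (v : TangentSpace (𝓡 3) x) : dirDeriv (fun y => c * f y) x v = c * dirDeriv f x v := by
  rw [dirDeriv_mul (mdifferentiableAt_const : FDiffAt (fun _ => c) x) hf, dirDeriv_const]
  ring

theorem fdiffAt_const_mul {x : M} {f : M → ℝ} (hf : FDiffAt f x) (c : ℝ) :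
    FDiffAt (fun y => c * f y) x :=
  (mdifferentiableAt_const : FDiffAt (fun _ => c) x).mul hf

/-- Covariant derivatives and brackets of frame fields are expanded in the frame on a whole
neighbourhood, so that they may be differentiated once more. -/
theorem form_curv {x : M} (hx : x ∈ U) (a b c f : Fin 3) :
    G.form x (curv G.form (e a) (e b) (e c) x) (e f x)
      = dirDeriv (connCoeff G e b c f) x (e a x) - dirDeriv (connCoeff G e a c f) x (e b x)
        + ∑ d, sgn d * (connCoeff G e b c d x * connCoeff G e a d f x
          - connCoeff G e a c d x * connCoeff G e b d f x
          - structureFun G e a b d x * connCoeff G e d c f x) := by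
  have hd := hE.diffAt hx
  have hc := fun a b c => fdiffAt_const_mul hE (hE.fdiffAt_connCoeff hx a b c) (sgn c)
  have hs := fun a b c => fdiffAt_const_mul hE (hE.fdiffAt_structureFun hx a b c) (sgn c)
  have h1 : ∀ a b c, nabla G.form (e a) (nabla G.form (e b) (e c)) x
      = ∑ d, ((sgn d * dirDeriv (connCoeff G e b c d) x (e a x)) • e d x
        + (sgn d * connCoeff G e b c d x) • nabla G.form (e a) (e d) x) := by
    intro a b c
    rw [G.nabla_congr (Filter.EventuallyEq.refl (𝓝 x) (e a)) (hE.eventually_nabla_eq hx b c),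
      hE.nabla_combination hx (hd a) (f := fun d y => sgn d * connCoeff G e b c d y)
        (fun d => hc b c d)]
    simp only [dirDeriv_const_mul hE (hE.fdiffAt_connCoeff hx _ _ _)]
  have h2 : nabla G.form (bracket (e a) (e b)) (e c) x
      = ∑ d, (sgn d * structureFun G e a b d x) • nabla G.form (e d) (e c) x := by
    rw [G.nabla_congr (hE.eventually_bracket_eq hx a b)
      (Filter.EventuallyEq.refl (𝓝 x) (e c)),
      hE.nabla_combination_left hx (hd c) (f := fun d y => sgn d * structureFun G e a b d y)
        (fun d => hs a b d)]
  simp only [curv, Pi.sub_apply, h1, h2, map_sub, sub_apply, map_sum, map_add, map_smul, sum_apply,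
    add_apply, smul_apply, smul_eq_mul, hE.form_nabla hx, hE.ortho x hx]
  simp only [Finset.sum_add_distrib, mul_ite, mul_zero, Finset.sum_ite_eq', Finset.mem_univ, if_true]
  have hf : sgn f * sgn f = 1 := by fin_cases f <;> simp [sgn]
  simp only [mul_sub, Finset.sum_sub_distrib, ← mul_assoc]
  linear_combination (dirDeriv (connCoeff G e b c f) x (e a x)
    - dirDeriv (connCoeff G e a c f) x (e b x)) * hf

/-- The Jacobi identity in terms of the structure functions. -/
theorem jacobi {x : M} (hx : x ∈ U) (a b c f : Fin 3) :
    dirDeriv (structureFun G e b c f) x (e a x)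
      + ∑ d, sgn d * structureFun G e b c d x * structureFun G e a d f x
      = - (dirDeriv (structureFun G e a b f) x (e c x)
        + ∑ d, sgn d * structureFun G e a b d x * structureFun G e c d f x)
        + (dirDeriv (structureFun G e a c f) x (e b x)
        + ∑ d, sgn d * structureFun G e a c d x * structureFun G e b d f x) := by
  have hs := fun a b c => fdiffAt_const_mul hE (hE.fdiffAt_structureFun hx a b c) (sgn c)
  have h1 : ∀ a b c, G.form x (bracket (e a) (bracket (e b) (e c)) x) (e f x)
      = dirDeriv (structureFun G e b c f) x (e a x)
        + ∑ d, sgn d * structureFun G e b c d x * structureFun G e a d f x := by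
    intro a b c
    rw [bracket_congr (Filter.EventuallyEq.refl (𝓝 x) (e a)) (hE.eventually_bracket_eq hx b c),
      hE.bracket_combination hx (f := fun d y => sgn d * structureFun G e b c d y)
        (fun d => hs b c d)]
    simp only [dirDeriv_const_mul hE (hE.fdiffAt_structureFun hx _ _ _), map_sum, map_add, map_smul,
      sum_apply, add_apply, smul_apply, smul_eq_mul, hE.ortho x hx, Finset.sum_add_distrib, mul_ite,
      mul_zero, Finset.sum_ite_eq', Finset.mem_univ, if_true]
    have hf : sgn f * sgn f = 1 := by fin_cases f <;> simp [sgn]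
    have hr : ∀ d, G.form x (bracket (e a) (e d) x) (e f x) = structureFun G e a d f x :=
      fun d => rfl
    simp only [hr]
    linear_combination dirDeriv (structureFun G e b c f) x (e a x) * hf
  have hM : IsManifold (𝓡 3) (minSmoothness ℝ 3) M := by
    rw [minSmoothness_of_isRCLikeNormedField]
    infer_instance
  have h2 : ∀ a, ContMDiffAt (𝓡 3) ((𝓡 3).prod 𝓘(ℝ, E3)) (minSmoothness ℝ 2)
      (fun y => (⟨y, e a y⟩ : TangentBundle (𝓡 3) M)) x := by
    intro a
    rw [minSmoothness_of_isRCLikeNormedField]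
    exact ((hE.smooth a).contMDiffAt hE.isOpen hx).of_le ENat.LEInfty.out
  have hj : bracket (e a) (bracket (e b) (e c)) x = bracket (bracket (e a) (e b)) (e c) x
      + bracket (e b) (bracket (e a) (e c)) x :=
    VectorField.leibniz_identity_mlieBracket_apply (h2 a) (h2 b) (h2 c)
  rw [bracket_swap (bracket (e a) (e b))] at hj
  rw [← h1, ← h1, ← h1, hj, map_add, map_neg]
  rfl

end OrthoFrame

end Frames

/-! ### Algebra of the Sasakian tensors and local adapted frames. -/

section Adapted

variable {M : Type*} [TopologicalSpace M] [ChartedSpace E3 M] [IsManifold (𝓡 3) ∞ M]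

namespace LorentzianSasakian

variable (S : LorentzianSasakian M) {x : M}

theorem xi_ne_zero (x : M) : S.xi x ≠ 0 := by
  intro h
  have := S.eta_xi x
  rw [h, map_zero] at this
  exact zero_ne_one this

/-- Since φ²ξ = 0, the formula for φ² applied to φξ makes φξ a multiple cξ, and then c² = 0. -/
theorem phi_xi (x : M) : S.phi x (S.xi x) = 0 := by
  have h0 : S.phi x (S.phi x (S.xi x)) = 0 := by
    rw [S.phi_phi, S.eta_xi, one_smul]
    exact neg_add_cancel (S.xi x)
  have h1 := S.phi_phi x (S.phi x (S.xi x))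
  rw [h0, (S.phi x).map_zero] at h1
  replace h1 := neg_add_eq_zero.1 h1.symm
  obtain ⟨c, hc⟩ : ∃ c : ℝ, S.phi x (S.xi x) = c • S.xi x := ⟨_, h1⟩
  rw [hc, map_smul, hc, smul_smul] at h0
  rw [hc, mul_self_eq_zero.1 ((smul_eq_zero.1 h0).resolve_right (S.xi_ne_zero x)), zero_smul]

theorem eta_phi (v : TangentSpace (𝓡 3) x) : S.eta x (S.phi x v) = 0 := by
  have h1 := S.phi_phi x (S.phi x v)
  rw [S.phi_phi x v, map_add, map_neg, map_smul, S.phi_xi, smul_zero, add_zero, left_eq_add] at h1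
  exact (smul_eq_zero.1 h1).resolve_right (S.xi_ne_zero x)

theorem form_xi (w : TangentSpace (𝓡 3) x) : S.metric.form x (S.xi x) w = - S.eta x w := by
  have h := S.metric_phi x (S.xi x) w
  rw [S.phi_xi, map_zero, zero_apply, S.eta_xi, one_mul] at h
  linarith

theorem form_xi_right (w : TangentSpace (𝓡 3) x) : S.metric.form x w (S.xi x) = - S.eta x w := by
  rw [S.metric.symm, S.form_xi]

theorem form_phi (v w : TangentSpace (𝓡 3) x) :
    S.metric.form x v (S.phi x w) = - S.metric.form x (S.phi x v) w := by
  have h := S.metric_phi x v (S.phi x w)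
  rw [S.phi_phi, S.eta_phi, mul_zero, add_zero, map_add, map_neg, map_smul, S.form_xi_right,
    S.eta_phi, neg_zero, smul_zero, add_zero] at h
  exact h.symm

theorem form_phi_self (v : TangentSpace (𝓡 3) x) : S.metric.form x v (S.phi x v) = 0 := by
  have h := S.form_phi v v
  rw [S.metric.symm x (S.phi x v) v] at h
  linarith

theorem smoothOn_phi {X : VField M} {U : Set M} (hX : X.SmoothOn U) :
    VField.SmoothOn (fun y => S.phi y (X y)) U :=
  ContMDiffOn.clm_bundle_apply (IB := 𝓡 3) (IM := 𝓡 3) (n := ∞) (s := U) (b := fun y : M => y)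
    (ϕ := fun y => S.phi y) S.phi_smooth.contMDiffOn hX

end LorentzianSasakian

/-- An orthonormal frame `(ξ, e₁, e₂)` with `φ e₁ = - e₂` and `φ e₂ = e₁`. -/
structure AdaptedFrame (S : LorentzianSasakian M) (U : Set M) (e : Fin 3 → VField M) : Prop
    extends OrthoFrame S.metric U e where
  zero : ∀ x ∈ U, e 0 x = S.xi x
  phi_one : ∀ x ∈ U, S.phi x (e 1 x) = - e 2 x
  phi_two : ∀ x ∈ U, S.phi x (e 2 x) = e 1 x

/-- On ξ^⊥ the endomorphism φ is an isometric quarter turn, so a single unit horizontal field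
determines the whole frame. -/
theorem AdaptedFrame.of_unit (S : LorentzianSasakian M) {U : Set M} (hU : IsOpen U) {Y : VField M}
    (hY : Y.SmoothOn U) (h0 : ∀ x ∈ U, S.eta x (Y x) = 0)
    (h1 : ∀ x ∈ U, S.metric.form x (Y x) (Y x) = 1) :
    AdaptedFrame S U ![S.xi, Y, fun y => - S.phi y (Y y)] where
  isOpen := hU
  smooth a := by
    fin_cases a
    · exact S.xi_smooth.contMDiffOn
    · exact hY
    · exact (S.smoothOn_phi hY).neg
  ortho x hx a b := by
    have h2 : S.metric.form x (S.phi x (Y x)) (Y x) = 0 := by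
      rw [S.metric.symm, S.form_phi_self]
    have h3 := h0 x hx
    have h4 := h1 x hx
    fin_cases a <;> fin_cases b
    · change S.metric.form x (S.xi x) (S.xi x) = -1
      rw [S.form_xi, S.eta_xi]
    · change S.metric.form x (S.xi x) (Y x) = 0
      rw [S.form_xi, h3, neg_zero]
    · change S.metric.form x (S.xi x) (- S.phi x (Y x)) = 0
      rw [S.form_xi, map_neg, S.eta_phi, neg_zero, neg_zero]
    · change S.metric.form x (Y x) (S.xi x) = 0
      rw [S.form_xi_right, h3, neg_zero]
    · exact h4
    · change S.metric.form x (Y x) (- S.phi x (Y x)) = 0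
      rw [map_neg, S.form_phi_self, neg_zero]
    · change S.metric.form x (- S.phi x (Y x)) (S.xi x) = 0
      rw [S.form_xi_right, map_neg, S.eta_phi, neg_zero, neg_zero]
    · change S.metric.form x (- S.phi x (Y x)) (Y x) = 0
      rw [map_neg, neg_apply, h2, neg_zero]
    · change S.metric.form x (- S.phi x (Y x)) (- S.phi x (Y x)) = 1
      rw [map_neg, map_neg, neg_apply, neg_neg, S.metric_phi, h3, h4, mul_zero, add_zero]
  zero x hx := rfl
  phi_one x hx := (neg_neg (S.phi x (Y x))).symm
  phi_two x hx := by
    change S.phi x (- S.phi x (Y x)) = Y x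
    rw [map_neg, S.phi_phi, h0 x hx, zero_smul, add_zero, neg_neg]

/-- Adapted frames exist locally. -/
theorem exists_adaptedFrame (S : LorentzianSasakian M) (x₀ : M) :
    ∃ U : Set M, x₀ ∈ U ∧ ∃ e, AdaptedFrame S U e := by
  obtain ⟨b, hb⟩ := S.metric.signature x₀
  obtain ⟨X, U, hU, hx₀, hX, hXx⟩ : ∃ (X : VField M) (U : Set M), IsOpen U ∧ x₀ ∈ U ∧
      X.SmoothOn U ∧ X x₀ = b 1 := by
    obtain ⟨s, hs, h⟩ := FiberBundle.exists_contMDiffOn_extend (𝓡 3) E3 (k := ∞)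
      (V := fun x : M => TangentSpace (𝓡 3) x) (b 1)
    obtain ⟨U, hUs, hU, hx⟩ := mem_nhds_iff.1 hs
    exact ⟨_, U, hU, hx, ContMDiffOn.mono h hUs, FiberBundle.extend_apply_self ..⟩
  -- Applying φ makes the field horizontal, and at `x₀` its squared length is 1 + η(X)² > 0, so it
  -- can be normalized nearby.
  have hX' := S.smoothOn_phi hX
  set X' : VField M := fun y => S.phi y (X y) with hX'def
  have hg := S.metric.contMDiffOn_apply hX' hX'
  set V : Set M := U ∩ (fun y => S.metric.form y (X' y) (X' y)) ⁻¹' Set.Ioi 0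
  have hV : IsOpen V := hg.continuousOn.isOpen_inter_preimage hU isOpen_Ioi
  have hpos : ∀ y ∈ V, 0 < S.metric.form y (X' y) (X' y) := fun y hy => hy.2
  have hs : ContMDiffOn (𝓡 3) 𝓘(ℝ, ℝ) ∞
      (fun y => (√(S.metric.form y (X' y) (X' y)))⁻¹) V := by
    intro y hy
    have h1 : ContDiffAt ℝ ∞ (fun t : ℝ => (√t)⁻¹) (S.metric.form y (X' y) (X' y)) :=
      (Real.contDiffAt_sqrt (hpos y hy).ne').inv (Real.sqrt_pos.2 (hpos y hy)).ne'
    exact ContMDiffAt.comp_contMDiffWithinAt (I' := 𝓘(ℝ, ℝ)) (g := fun t : ℝ => (√t)⁻¹) y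
      h1.contMDiffAt ((hg y hy.1).mono Set.inter_subset_left)
  refine ⟨V, ⟨hx₀, ?_⟩, _, AdaptedFrame.of_unit S hV
    (VField.SmoothOn.smul hs (hX'.mono Set.inter_subset_left)) ?_ ?_⟩
  · have h1 := S.metric_phi x₀ (b 1) (b 1)
    have h2 : S.metric.form x₀ (b 1) (b 1) = 1 := by rw [hb]; simp [sgn]
    simp only [Set.mem_preimage, Set.mem_Ioi, hX'def, hXx, h1, h2]
    nlinarith [mul_self_nonneg (S.eta x₀ (b 1))]
  · intro y hy
    simp [hX'def, S.eta_phi]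
  · intro y hy
    have h1 := Real.mul_self_sqrt (hpos y hy).le
    have h2 := (Real.sqrt_pos.2 (hpos y hy)).ne'
    simp only [Pi.smul_apply', map_smul, smul_apply, smul_eq_mul]
    set t := √(S.metric.form y (X' y) (X' y))
    rw [← h1]
    field_simp

end Adapted

/-! ### Structure equations of a Sasakian φ-space form. -/

section AdaptedEquations

variable {M : Type*} [TopologicalSpace M] [ChartedSpace E3 M] [IsManifold (𝓡 3) ∞ M]
  {S : LorentzianSasakian M} {U : Set M} {e : Fin 3 → VField M}

theorem connCoeff_swap (G : LorentzianMetric M) (e : Fin 3 → VField M) (a b c : Fin 3) (x : M) :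
    connCoeff G e a b c x = - connCoeff G e a c b x := by
  simp only [connCoeff]
  rw [structureFun_swap G e c b a]
  ring

theorem connCoeff_self (G : LorentzianMetric M) (e : Fin 3 → VField M) (a b : Fin 3) (x : M) :
    connCoeff G e a b b x = 0 := by
  simp only [connCoeff, structureFun_self]
  ring

namespace AdaptedFrame

variable (hE : AdaptedFrame S U e)
include hE

theorem eta_eq {x : M} (hx : x ∈ U) (v : TangentSpace (𝓡 3) x) :
    S.eta x v = - S.metric.form x v (e 0 x) := by
  rw [hE.zero x hx, S.form_xi_right, neg_neg]

/-- As η is constant on frame fields, only the bracket term of dη remains. The frame fields are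
replaced by global extensions of their germs because `d_eta` concerns globally smooth fields. -/
theorem structureFun_zero [T2Space M] {x : M} (hx : x ∈ U) (a b : Fin 3) :
    structureFun S.metric e a b 0 x = 2 * S.metric.form x (e a x) (S.phi x (e b x)) := by
  obtain ⟨X, hX, hXe⟩ := (hE.smooth a).exists_smooth_eventuallyEq hE.isOpen hx
  obtain ⟨Y, hY, hYe⟩ := (hE.smooth b).exists_smooth_eventuallyEq hE.isOpen hx
  have h := S.d_eta X Y hX hY x
  have h0 : ∀ {Z : VField M} {a : Fin 3}, Z =ᶠ[𝓝 x] e a → ∀ v,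
      dirDeriv (fun y => S.eta y (Z y)) x v = 0 := by
    intro Z a hZ v
    refine dirDeriv_eq_zero (c := - if a = 0 then sgn a else 0) ?_ v
    filter_upwards [hZ, hE.isOpen.mem_nhds hx] with y hy hyU
    rw [hE.eta_eq hyU, hy, hE.ortho y hyU]
  rw [extD, h0 hXe, h0 hYe, bracket_congr hXe hYe, hXe.self_of_nhds, hYe.self_of_nhds,
    hE.eta_eq hx] at h
  simp only [structureFun]
  linarith

theorem form_curv_zero [T2Space M] {x : M} (hx : x ∈ U) (a b f : Fin 3) :
    S.metric.form x (curv S.metric.form (e a) (e b) (e 0) x) (e f x)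
      = S.eta x (e b x) * S.metric.form x (e a x) (e f x)
        - S.eta x (e a x) * S.metric.form x (e b x) (e f x) := by
  obtain ⟨X, hX, hXe⟩ := (hE.smooth a).exists_smooth_eventuallyEq hE.isOpen hx
  obtain ⟨Y, hY, hYe⟩ := (hE.smooth b).exists_smooth_eventuallyEq hE.isOpen hx
  have h0 : S.xi =ᶠ[𝓝 x] e 0 := by
    filter_upwards [hE.isOpen.mem_nhds hx] with y hy
    exact (hE.zero y hy).symm
  rw [← curv_congr S.metric hXe hYe h0, S.curv_xi X Y hX hY, hXe.self_of_nhds, hYe.self_of_nhds]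
  simp only [map_sub, map_smul, sub_apply, smul_apply, smul_eq_mul]

theorem form_curv_phi [T2Space M] {H : ℝ} (hH : S.HasPhiSectionalCurv H) {x : M} (hx : x ∈ U) :
    S.metric.form x (curv S.metric.form (e 2) (e 1) (e 1) x) (e 2 x) = H := by
  obtain ⟨X, hX, hXe⟩ := (hE.smooth 2).exists_smooth_eventuallyEq hE.isOpen hx
  have hP : (fun y => S.phi y (X y)) =ᶠ[𝓝 x] e 1 := by
    filter_upwards [hXe, hE.isOpen.mem_nhds hx] with y hy hyU
    rw [hy, hE.phi_two y hyU]
  have h22 : S.metric.form x (e 2 x) (e 2 x) = 1 := hE.ortho x hx 2 2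
  have h11 : S.metric.form x (e 1 x) (e 1 x) = 1 := hE.ortho x hx 1 1
  have h21 : S.metric.form x (e 2 x) (e 1 x) = 0 := hE.ortho x hx 2 1
  have h20 : S.metric.form x (e 2 x) (e 0 x) = 0 := hE.ortho x hx 2 0
  have h := hH X hX x
    (by
      rw [hXe.self_of_nhds]
      intro h0
      rw [h0, map_zero] at h22
      exact zero_ne_one h22)
    (by rw [hXe.self_of_nhds, ← hE.zero x hx]; exact h20)
  rw [sectionalCurv, curv_congr S.metric hXe hP hP, hXe.self_of_nhds, hE.phi_two x hx, h22, h11,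
    h21] at h
  simpa using h

theorem structureFun_one_two [T2Space M] {x : M} (hx : x ∈ U) :
    structureFun S.metric e 1 2 0 x = 2 := by
  rw [hE.structureFun_zero hx, hE.phi_two x hx, hE.ortho x hx]
  simp [sgn]

theorem structureFun_zero_one [T2Space M] {x : M} (hx : x ∈ U) :
    structureFun S.metric e 0 1 0 x = 0 := by
  rw [hE.structureFun_zero hx, hE.phi_one x hx, map_neg, hE.ortho x hx]
  simp

theorem structureFun_zero_two [T2Space M] {x : M} (hx : x ∈ U) :
    structureFun S.metric e 0 2 0 x = 0 := by
  rw [hE.structureFun_zero hx, hE.phi_two x hx, hE.ortho x hx]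
  simp

/-- The curvature components R(eₐ, ξ)ξ form a Riccati equation along ξ for ∇ξ restricted to ξ^⊥. The
skew part of ∇ξ is fixed by dη and already accounts for the prescribed curvature, so the symmetric
part must vanish. Consequently ad ξ acts on (e₁, e₂) by an infinitesimal rotation. -/
theorem structureFun_symm_traceless [T2Space M] {x : M} (hx : x ∈ U) :
    structureFun S.metric e 0 1 1 x = 0 ∧ structureFun S.metric e 0 2 2 x = 0 ∧
      structureFun S.metric e 0 2 1 x = - structureFun S.metric e 0 1 2 x := by
  have heta : ∀ x ∈ U, S.eta x (e 0 x) = 1 ∧ S.eta x (e 1 x) = 0 ∧ S.eta x (e 2 x) = 0 := by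
    intro x hx
    refine ⟨?_, ?_, ?_⟩ <;> rw [hE.eta_eq hx, hE.ortho x hx] <;> simp [sgn]
  set C := structureFun S.metric e with hC
  have c1 : ∀ x ∈ U, C 1 2 0 x = 2 := fun x hx => hE.structureFun_one_two hx
  have c2 : ∀ x ∈ U, C 0 1 0 x = 0 := fun x hx => hE.structureFun_zero_one hx
  have c3 : ∀ x ∈ U, C 0 2 0 x = 0 := fun x hx => hE.structureFun_zero_two hx
  have hs : ∀ a b c x, C a b c x = - C b a c x := structureFun_swap S.metric e
  have h0 : ∀ a c x, C a a c x = 0 := structureFun_self S.metric e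
  have s0 : sgn 0 = -1 := rfl
  have s1 : sgn 1 = 1 := rfl
  have s2 : sgn 2 = 1 := rfl
  have d0 : ∀ (a b c : Fin 3) (k : ℝ), (∀ y ∈ U, connCoeff S.metric e a b c y = k) → ∀ x ∈ U,
      ∀ v, dirDeriv (connCoeff S.metric e a b c) x v = 0 := by
    intro a b c k h x hx v
    refine dirDeriv_eq_zero (c := k) ?_ v
    filter_upwards [hE.isOpen.mem_nhds hx] with y hy using h y hy
  have dE : ∀ (f f' : M → ℝ) (hf : ∀ y ∈ U, f y = f' y), ∀ x ∈ U, ∀ v,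
      dirDeriv f x v = dirDeriv f' x v := by
    intro f f' h x hx v
    refine dirDeriv_congr ?_ v
    filter_upwards [hE.isOpen.mem_nhds hx] with y hy using h y hy
  have g001 : ∀ x ∈ U, connCoeff S.metric e 0 0 1 x = 0 := by
    intro x hx
    simp only [connCoeff, ← hC]
    linarith [c2 x hx, h0 0 1 x]
  have g002 : ∀ x ∈ U, connCoeff S.metric e 0 0 2 x = 0 := by
    intro x hx
    simp only [connCoeff, ← hC]
    linarith [c3 x hx, h0 0 2 x]
  have g012 : ∀ x ∈ U, connCoeff S.metric e 0 1 2 x = (C 0 1 2 x - C 0 2 1 x - 2) / 2 := by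
    intro x hx
    simp only [connCoeff, ← hC]
    linarith [c1 x hx]
  have g101 : ∀ x ∈ U, connCoeff S.metric e 1 0 1 x = - C 0 1 1 x := by
    intro x hx
    simp only [connCoeff, ← hC]
    linarith [h0 1 0 x, hs 1 0 1 x]
  have g102 : ∀ x ∈ U, connCoeff S.metric e 1 0 2 x = - (C 0 1 2 x + C 0 2 1 x + 2) / 2 := by
    intro x hx
    simp only [connCoeff, ← hC]
    linarith [c1 x hx, hs 1 0 2 x]
  have g201 : ∀ x ∈ U, connCoeff S.metric e 2 0 1 x = - (C 0 1 2 x + C 0 2 1 x - 2) / 2 := by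
    intro x hx
    simp only [connCoeff, ← hC]
    linarith [c1 x hx, hs 2 0 1 x, hs 2 1 0 x]
  have g202 : ∀ x ∈ U, connCoeff S.metric e 2 0 2 x = - C 0 2 2 x := by
    intro x hx
    simp only [connCoeff, ← hC]
    linarith [h0 2 0 x, hs 2 0 2 x]
  have key : ∀ x ∈ U, ∀ a b f, _ := fun x hx a b f =>
    (hE.form_curv_zero hx a b f).symm.trans (hE.form_curv hx a b 0 f)
  have df := fun (x : M) (hx : x ∈ U) a b c => hE.fdiffAt_structureFun hx a b c
  -- Skew part of the Riccati equation: the derivatives along ξ cancel because Γ₁₀₂ and Γ₂₀₁ differ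
  -- by a constant, and the trace of the symmetric part comes out zero.
  have hA : ∀ x ∈ U, C 0 2 2 x = - C 0 1 1 x := by
    intro x hx
    have k1 := key x hx 1 0 2
    have k2 := key x hx 2 0 1
    have e12 : dirDeriv (connCoeff S.metric e 1 0 2) x (e 0 x)
        = dirDeriv (connCoeff S.metric e 2 0 1) x (e 0 x) := by
      rw [dE (connCoeff S.metric e 1 0 2) (fun y => connCoeff S.metric e 2 0 1 y - 2)
        (fun y hy => by rw [g102 y hy, g201 y hy]; ring) x hx,
        dirDeriv_sub (hE.fdiffAt_connCoeff hx _ _ _) mdifferentiableAt_const, dirDeriv_const,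
        sub_zero]
    rw [d0 0 0 2 0 g002 x hx, e12, hE.ortho x hx, hE.ortho x hx] at k1
    rw [d0 0 0 1 0 g001 x hx, hE.ortho x hx, hE.ortho x hx] at k2
    simp only [Fin.sum_univ_three, connCoeff_self, (heta x hx).1, (heta x hx).2.1, (heta x hx).2.2,
      g001 x hx, g002 x hx, g012 x hx, g101 x hx, g102 x hx, g201 x hx, g202 x hx, ← hC,
      connCoeff_swap S.metric e 0 2 1, hs 1 0, hs 2 0, c2 x hx, c3 x hx, s0, s1, s2] at k1 k2
    simp at k1 k2
    linarith
  -- Trace of the Riccati equation: tracelessness cancels the derivatives and leaves a vanishing sum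
  -- of two squares.
  have hB := by
    have k1 := key x hx 1 0 1
    have k2 := key x hx 2 0 2
    have e12 : dirDeriv (connCoeff S.metric e 2 0 2) x (e 0 x)
        = - dirDeriv (connCoeff S.metric e 1 0 1) x (e 0 x) := by
      rw [dE (connCoeff S.metric e 2 0 2) (fun y => (-1) * connCoeff S.metric e 1 0 1 y)
        (fun y hy => by rw [g202 y hy, g101 y hy, hA y hy]; ring) x hx,
        hE.dirDeriv_const_mul (hE.fdiffAt_connCoeff hx _ _ _), neg_one_mul]
    rw [d0 0 0 1 0 g001 x hx, hE.ortho x hx, hE.ortho x hx] at k1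
    rw [d0 0 0 2 0 g002 x hx, e12, hE.ortho x hx, hE.ortho x hx] at k2
    simp only [Fin.sum_univ_three, connCoeff_self, (heta x hx).1, (heta x hx).2.1, (heta x hx).2.2,
      g001 x hx, g002 x hx, g012 x hx, g101 x hx, g102 x hx, g201 x hx, g202 x hx, ← hC,
      connCoeff_swap S.metric e 0 2 1, hs 1 0, hs 2 0, c2 x hx, c3 x hx, s0, s1, s2, hA x hx]
      at k1 k2
    simp at k1 k2
    exact And.intro k1 k2
  obtain ⟨k1, k2⟩ := hB
  have hsq : C 0 1 1 x ^ 2 + ((C 0 1 2 x + C 0 2 1 x) / 2) ^ 2 = 0 := by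
    linarith
  have h3 : C 0 1 1 x = 0 := by nlinarith [sq_nonneg (C 0 1 1 x), sq_nonneg ((C 0 1 2 x + C 0 2 1 x) / 2)]
  have h4 : (C 0 1 2 x + C 0 2 1 x) / 2 = 0 := by nlinarith
  exact ⟨h3, by rw [hA x hx, h3, neg_zero], by linarith⟩

/-- The connection is now expressed by the three remaining unknown functions C₀₁₂, C₁₂₁ and C₁₂₂. -/
theorem connCoeff_values [T2Space M] {x : M} (hx : x ∈ U) :
    connCoeff S.metric e 0 0 1 x = 0 ∧ connCoeff S.metric e 0 0 2 x = 0 ∧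
    connCoeff S.metric e 0 1 2 x = structureFun S.metric e 0 1 2 x - 1 ∧
    connCoeff S.metric e 1 0 1 x = 0 ∧ connCoeff S.metric e 1 0 2 x = -1 ∧
    connCoeff S.metric e 1 1 2 x = - structureFun S.metric e 1 2 1 x ∧
    connCoeff S.metric e 2 0 1 x = 1 ∧ connCoeff S.metric e 2 0 2 x = 0 ∧
    connCoeff S.metric e 2 1 2 x = - structureFun S.metric e 1 2 2 x := by
  obtain ⟨h1, h2, h3⟩ := hE.structureFun_symm_traceless hx
  have c1 := hE.structureFun_one_two hx
  have c2 := hE.structureFun_zero_one hx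
  have c3 := hE.structureFun_zero_two hx
  simp only [connCoeff, structureFun_self, structureFun_swap S.metric e 1 0,
    structureFun_swap S.metric e 2 0, structureFun_swap S.metric e 2 1, h1, h2, h3, c1, c2, c3]
  refine ⟨?_, ?_, ?_, ?_, ?_, ?_, ?_, ?_, ?_⟩ <;> ring

theorem dirDeriv_connCoeff_one [T2Space M] {x : M} (hx : x ∈ U) (v : TangentSpace (𝓡 3) x) :
    dirDeriv (connCoeff S.metric e 1 1 2) x v = - dirDeriv (structureFun S.metric e 1 2 1) x v := by
  rw [dirDeriv_congr (f' := fun y => (-1) * structureFun S.metric e 1 2 1 y),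
    hE.dirDeriv_const_mul (hE.fdiffAt_structureFun hx _ _ _), neg_one_mul]
  filter_upwards [hE.isOpen.mem_nhds hx] with y hy
  obtain ⟨-, -, -, -, -, h, -⟩ := hE.connCoeff_values hy
  rw [h, neg_one_mul]

theorem dirDeriv_connCoeff_two [T2Space M] {x : M} (hx : x ∈ U) (v : TangentSpace (𝓡 3) x) :
    dirDeriv (connCoeff S.metric e 2 1 2) x v = - dirDeriv (structureFun S.metric e 1 2 2) x v := by
  rw [dirDeriv_congr (f' := fun y => (-1) * structureFun S.metric e 1 2 2 y),
    hE.dirDeriv_const_mul (hE.fdiffAt_structureFun hx _ _ _), neg_one_mul]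
  filter_upwards [hE.isOpen.mem_nhds hx] with y hy
  obtain ⟨-, -, -, -, -, -, -, -, h⟩ := hE.connCoeff_values hy
  rw [h, neg_one_mul]

/-- The curvature equation of a `φ`-space form. -/
theorem curvature_equation [T2Space M] {H : ℝ} (hH : S.HasPhiSectionalCurv H) {x : M}
    (hx : x ∈ U) :
    dirDeriv (structureFun S.metric e 1 2 2) x (e 1 x)
      - dirDeriv (structureFun S.metric e 1 2 1) x (e 2 x) + 3 - 2 * structureFun S.metric e 0 1 2 x
      - structureFun S.metric e 1 2 1 x ^ 2 - structureFun S.metric e 1 2 2 x ^ 2 = H := by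
  have h := (hE.form_curv hx 2 1 1 2).symm.trans (hE.form_curv_phi hH hx)
  obtain ⟨-, -, v3, v4, v5, v6, v7, v8, v9⟩ := hE.connCoeff_values hx
  have s0 : sgn 0 = -1 := rfl
  have s1 : sgn 1 = 1 := rfl
  have s2 : sgn 2 = 1 := rfl
  rw [hE.dirDeriv_connCoeff_one hx, hE.dirDeriv_connCoeff_two hx] at h
  simp only [Fin.sum_univ_three, s0, s1, s2, connCoeff_self, connCoeff_swap S.metric e 1 1 0,
    connCoeff_swap S.metric e 2 1 0,
    structureFun_swap S.metric e 2 1, hE.structureFun_one_two hx, v3, v4, v5, v6, v7, v8,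
    v9] at h
  linear_combination h

/-- The e₁- and e₂-components of the Jacobi identity for ξ, e₁, e₂. Together with
`curvature_equation` they will express the closedness of `rotForm`. -/
theorem jacobi_equations [T2Space M] {x : M} (hx : x ∈ U) :
    dirDeriv (structureFun S.metric e 1 2 1) x (e 0 x)
        + dirDeriv (structureFun S.metric e 0 1 2) x (e 1 x)
        = structureFun S.metric e 1 2 2 x * structureFun S.metric e 0 1 2 x ∧
      dirDeriv (structureFun S.metric e 1 2 2) x (e 0 x)
        + dirDeriv (structureFun S.metric e 0 1 2) x (e 2 x)
        = - structureFun S.metric e 1 2 1 x * structureFun S.metric e 0 1 2 x := by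
  have s0 : sgn 0 = -1 := rfl
  have s1 : sgn 1 = 1 := rfl
  have s2 : sgn 2 = 1 := rfl
  obtain ⟨h1, h2, h3⟩ := hE.structureFun_symm_traceless hx
  have d1 : dirDeriv (structureFun S.metric e 0 1 1) x (e 2 x) = 0 := by
    refine dirDeriv_eq_zero (c := 0) ?_ _
    filter_upwards [hE.isOpen.mem_nhds hx] with y hy using (hE.structureFun_symm_traceless hy).1
  have d2 : dirDeriv (structureFun S.metric e 0 2 2) x (e 1 x) = 0 := by
    refine dirDeriv_eq_zero (c := 0) ?_ _
    filter_upwards [hE.isOpen.mem_nhds hx] with y hy using (hE.structureFun_symm_traceless hy).2.1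
  have d3 : dirDeriv (structureFun S.metric e 0 2 1) x (e 1 x)
      = - dirDeriv (structureFun S.metric e 0 1 2) x (e 1 x) := by
    rw [dirDeriv_congr (f' := fun y => (-1) * structureFun S.metric e 0 1 2 y),
      hE.dirDeriv_const_mul (hE.fdiffAt_structureFun hx _ _ _), neg_one_mul]
    filter_upwards [hE.isOpen.mem_nhds hx] with y hy
    rw [(hE.structureFun_symm_traceless hy).2.2, neg_one_mul]
  have k1 := hE.jacobi hx 0 1 2 1
  have k2 := hE.jacobi hx 0 1 2 2
  rw [d1, d3] at k1
  rw [d2] at k2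
  simp only [Fin.sum_univ_three, s0, s1, s2, structureFun_self, structureFun_swap S.metric e 1 0,
    structureFun_swap S.metric e 2 0, structureFun_swap S.metric e 2 1, h1, h2, h3,
    hE.structureFun_zero_one hx, hE.structureFun_zero_two hx, hE.structureFun_one_two hx] at k1 k2
  exact ⟨by linear_combination k1, by linear_combination k2⟩

end AdaptedFrame

end AdaptedEquations

/-! ### The Frobenius theorem in frames and on manifolds. -/

section FrobeniusFrame

variable {𝔸 : Type*} [NormedRing 𝔸] [NormedAlgebra ℝ 𝔸] [CompleteSpace 𝔸]

/-- The linear system `∂Φ(êₐ) = Âₐ Φ` for a frame `ê` of `E3` is locally solvable if it is flat. -/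
theorem exists_frame_solution {U : Set E3} (hU : IsOpen U) {y₀ : E3} (hy₀ : y₀ ∈ U)
    {e : Fin 3 → E3 → E3} (he : ∀ a, ContDiffOn ℝ ∞ (e a) U)
    (hli : ∀ y ∈ U, LinearIndependent ℝ fun a => e a y)
    {A : Fin 3 → E3 → 𝔸} (hA : ∀ a, ContDiffOn ℝ ∞ (A a) U)
    {c : Fin 3 → Fin 3 → Fin 3 → E3 → ℝ}
    (hc : ∀ y ∈ U, ∀ a b, VectorField.lieBracket ℝ (e a) (e b) y = ∑ d, c a b d y • e d y)
    (flat : ∀ y ∈ U, ∀ a b, fderiv ℝ (A b) y (e a y) - fderiv ℝ (A a) y (e b y)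
      + A b y * A a y - A a y * A b y = ∑ d, c a b d y • A d y) :
    ∃ R > 0, Metric.ball y₀ R ⊆ U ∧ ∃ Φ : E3 → 𝔸, Φ y₀ = 1 ∧
      ContDiffOn ℝ ∞ Φ (Metric.ball y₀ R) ∧
      ∀ y ∈ Metric.ball y₀ R, ∀ a, fderiv ℝ Φ y (e a y) = A a y * Φ y := by
  set P : E3 → E3 →L[ℝ] E3 := fun y => ∑ a, (EuclideanSpace.proj a : E3 →L[ℝ] ℝ).smulRight (e a y)
    with hP
  set Q : E3 → E3 →L[ℝ] 𝔸 := fun y => ∑ a, (EuclideanSpace.proj a : E3 →L[ℝ] ℝ).smulRight (A a y)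
    with hQ
  have hPs : ∀ y a, P y (EuclideanSpace.single a 1) = e a y := by
    intro y a
    simp [hP]
  have hQs : ∀ y a, Q y (EuclideanSpace.single a 1) = A a y := by
    intro y a
    simp [hQ]
  have hPinv : ∀ y ∈ U, (P y).IsInvertible := by
    intro y hy
    have hinj : Function.Injective (P y : E3 →ₗ[ℝ] E3) := by
      rw [← LinearMap.ker_eq_bot, LinearMap.ker_eq_bot']
      intro v hv
      have h1 : ∑ a, v a • e a y = 0 := by
        rw [← hv]
        simp [hP]
      ext a
      exact Fintype.linearIndependent_iff.1 (hli y hy) (fun a => v a) h1 a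
    exact ⟨(LinearEquiv.ofInjectiveEndo _ hinj).toContinuousLinearEquiv, by ext; rfl⟩
  -- `P` sends the standard basis to the frame and `Q` sends it to the coefficients, so `B` is the
  -- one-form with B(eₐ) = Aₐ.
  set B : E3 → E3 →L[ℝ] 𝔸 := fun y => (Q y).comp (P y).inverse with hB
  have hBs : ∀ y ∈ U, ∀ a, B y (e a y) = A a y := by
    intro y hy a
    obtain ⟨L, hL⟩ := hPinv y hy
    rw [hB, ← hQs, ← hPs y a]
    simp only [ContinuousLinearMap.comp_apply, ← hL, ContinuousLinearMap.inverse_equiv]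
    simp
  have hPsm : ContDiffOn ℝ ∞ P U := by
    refine ContDiffOn.sum fun a _ => ?_
    exact contDiffOn_const.smulRight (he a)
  have hQsm : ContDiffOn ℝ ∞ Q U := by
    refine ContDiffOn.sum fun a _ => ?_
    exact contDiffOn_const.smulRight (hA a)
  have hBsm : ContDiffOn ℝ ∞ B U := by
    refine hQsm.clm_comp fun y hy => ?_
    exact (hPinv y hy).contDiffAt_map_inverse.comp_contDiffWithinAt y (hPsm y hy)
  have hspan : ∀ y ∈ U, ∀ v, ∃ w : Fin 3 → ℝ, v = ∑ a, w a • e a y := by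
    intro y hy v
    obtain ⟨L, hL⟩ := hPinv y hy
    refine ⟨fun a => L.symm v a, ?_⟩
    have h1 : P y (L.symm v) = v := by rw [← hL]; simp
    conv_lhs => rw [← h1]
    simp [hP, sum_apply]
  have hflat0 : ∀ y ∈ U, ∀ a b, fderiv ℝ B y (e a y) (e b y) + B y (e b y) * B y (e a y)
      = fderiv ℝ B y (e b y) (e a y) + B y (e a y) * B y (e b y) := by
    intro y hy a b
    have hn := hU.mem_nhds hy
    have hd : ∀ a, DifferentiableAt ℝ (e a) y := fun a =>
      ((he a).contDiffAt hn).differentiableAt (by simp)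
    have hdB : DifferentiableAt ℝ B y := (hBsm.contDiffAt hn).differentiableAt (by simp)
    -- Leibniz rule for B(eₐ) = Aₐ; skew-symmetrized, it turns the frame form of flatness into dB =
    -- B ∧ B.
    have key : ∀ a v, fderiv ℝ B y v (e a y) + B y (fderiv ℝ (e a) y v) = fderiv ℝ (A a) y v := by
      intro a v
      have h1 : (fun z => B z (e a z)) =ᶠ[𝓝 y] A a := by
        filter_upwards [hn] with z hz using hBs z hz a
      rw [← h1.fderiv_eq, fderiv_clm_apply hdB (hd a)]
      simp [add_comm]
    have h1 := key b (e a y)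
    have h2 := key a (e b y)
    have h3 := congrArg (B y) (hc y hy a b)
    rw [VectorField.lieBracket, map_sub, map_sum] at h3
    simp only [map_smul, hBs y hy] at h3
    have h4 := flat y hy a b
    rw [← h3, ← h1, ← h2] at h4
    rw [hBs y hy, hBs y hy]
    have h5 : fderiv ℝ B y (e a y) (e b y) + A b y * A a y
        - (fderiv ℝ B y (e b y) (e a y) + A a y * A b y) = 0 := by
      rw [← sub_eq_zero] at h4
      rw [← h4]
      abel
    exact sub_eq_zero.1 h5
  have hflat : ∀ y ∈ U, ∀ u v, fderiv ℝ B y u v + B y v * B y u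
      = fderiv ℝ B y v u + B y u * B y v := by
    intro y hy u v
    obtain ⟨u, rfl⟩ := hspan y hy u
    obtain ⟨v, rfl⟩ := hspan y hy v
    simp only [Fin.sum_univ_three, map_add, map_smul, add_apply, smul_apply, add_mul, mul_add,
      smul_mul_assoc, mul_smul_comm, smul_add]
    linear_combination (norm := module) (u 0 * v 0) • hflat0 y hy 0 0 + (u 0 * v 1) • hflat0 y hy 0 1 + (u 0 * v 2) • hflat0 y hy 0 2 
      + (u 1 * v 0) • hflat0 y hy 1 0 + (u 1 * v 1) • hflat0 y hy 1 1 + (u 1 * v 2) • hflat0 y hy 1 2 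
      + (u 2 * v 0) • hflat0 y hy 2 0 + (u 2 * v 1) • hflat0 y hy 2 1 + (u 2 * v 2) • hflat0 y hy 2 2
  obtain ⟨R, hR, hRU, Φ, hΦ0, hΦ⟩ := exists_fundamental_solution hU hy₀
    (hBsm.of_le ENat.LEInfty.out) hflat
  refine ⟨R, hR, hRU, Φ, hΦ0,
    contDiffOn_of_hasFDerivAt_mul Metric.isOpen_ball (hBsm.mono hRU) hΦ, fun y hy a => ?_⟩
  rw [(hΦ y hy).fderiv]
  simp [hBs y (hRU hy)]

section Manifold

variable {M : Type*} [TopologicalSpace M] [ChartedSpace E3 M] [IsManifold (𝓡 3) ∞ M]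

/-- The linear system `dΦ(eₐ) = Aₐ Φ` for a local frame `e` is locally solvable if it is flat. -/
theorem exists_manifold_frame_solution {U : Set M} (hU : IsOpen U) {x₀ : M} (hx₀ : x₀ ∈ U)
    {e : Fin 3 → VField M} (he : ∀ a, (e a).SmoothOn U)
    (hli : ∀ x ∈ U, LinearIndependent ℝ fun a => e a x)
    {A : Fin 3 → M → 𝔸} (hA : ∀ a, ContMDiffOn (𝓡 3) 𝓘(ℝ, 𝔸) ∞ (A a) U)
    {c : Fin 3 → Fin 3 → Fin 3 → M → ℝ}
    (hc : ∀ x ∈ U, ∀ a b, bracket (e a) (e b) x = ∑ d, c a b d x • e d x)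
    (flat : ∀ x ∈ U, ∀ a b, mvfderiv (𝓡 3) (A b) x (e a x) - mvfderiv (𝓡 3) (A a) x (e b x)
      + A b x * A a x - A a x * A b x = ∑ d, c a b d x • A d x) :
    ∃ V : Set M, IsOpen V ∧ x₀ ∈ V ∧ V ⊆ U ∧ ∃ Φ : M → 𝔸, Φ x₀ = 1 ∧
      ContMDiffOn (𝓡 3) 𝓘(ℝ, 𝔸) ∞ Φ V ∧
      ∀ x ∈ V, ∀ a, mvfderiv (𝓡 3) Φ x (e a x) = A a x * Φ x := by
  set ψ := extChartAt (𝓡 3) x₀ with hψ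
  have hT : IsOpen ψ.target := isOpen_extChartAt_target x₀
  have hsm : ContMDiffOn (𝓡 3) (𝓡 3) ∞ ψ.symm ψ.target := contMDiffOn_extChartAt_symm x₀
  set W : Set E3 := ψ.target ∩ ψ.symm ⁻¹' U
  have hW : IsOpen W := hsm.continuousOn.isOpen_inter_preimage hT hU
  have hsmAt : ∀ y ∈ W, ContMDiffAt (𝓡 3) (𝓡 3) ∞ ψ.symm y := fun y hy =>
    hsm.contMDiffAt (hT.mem_nhds hy.1)
  have hinv : ∀ y ∈ W, (mfderiv (𝓡 3) (𝓡 3) ψ.symm y).IsInvertible := by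
    intro y hy
    have h := isInvertible_mfderivWithin_extChartAt_symm (I := 𝓡 3) (x := x₀) hy.1
    rwa [show Set.range (𝓡 3) = Set.univ from Set.range_id, mfderivWithin_univ] at h
  -- The frame is pulled back by the inverse chart; brackets are natural under pullback, so the
  -- structure coefficients are merely composed with the chart.
  set e' : Fin 3 → E3 → E3 := fun a => VectorField.mpullback (𝓡 3) (𝓡 3) ψ.symm (e a) with he'
  have hmap : ∀ y ∈ W, ∀ a, mfderiv (𝓡 3) (𝓡 3) ψ.symm y (e' a y) = e a (ψ.symm y) := by
    intro y hy a
    obtain ⟨L, hL⟩ := hinv y hy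
    simp only [he', VectorField.mpullback_apply]
    rw [← hL, ContinuousLinearMap.inverse_equiv]
    exact L.apply_symm_apply _
  have hcomp : ∀ {f : M → 𝔸}, ∀ y ∈ W, MDifferentiableAt (𝓡 3) 𝓘(ℝ, 𝔸) f (ψ.symm y) → ∀ a,
      fderiv ℝ (fun z => f (ψ.symm z)) y (e' a y) = mvfderiv (𝓡 3) f (ψ.symm y) (e a (ψ.symm y)) := by
    intro f y hy hf a
    rw [← hmap y hy a, ← mfderiv_eq_fderiv]
    have := mfderiv_comp_apply (I := 𝓡 3) (I' := 𝓡 3) (I'' := 𝓘(ℝ, 𝔸)) y hf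
      ((hsmAt y hy).mdifferentiableAt (by simp)) (e' a y)
    exact this
  have he's : ∀ a, ContDiffOn ℝ ∞ (e' a) W := by
    intro a y hy
    have h : ContMDiffAt (𝓡 3) ((𝓡 3).prod 𝓘(ℝ, E3)) ∞
        (fun z => (⟨z, e' a z⟩ : TangentBundle (𝓡 3) E3)) y := by
      have hM : IsManifold (𝓡 3) (((⊤ : ℕ∞) : WithTop ℕ∞) + 1) M := ‹IsManifold (𝓡 3) ∞ M›
      exact ContMDiffAt.mpullback_vectorField_preimage (m := ∞) (n := ∞) ((he a).contMDiffAt hU hy.2)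
        (hsmAt y hy) (hinv y hy) (by simp)
    exact (contMDiffAt_vectorSpace_iff_contDiffAt.1 h).contDiffWithinAt
  have hA's : ∀ a, ContDiffOn ℝ ∞ (fun z => A a (ψ.symm z)) W := by
    intro a
    rw [← contMDiffOn_iff_contDiffOn]
    exact ContMDiffOn.comp (I' := 𝓡 3) (hA a) (hsm.mono Set.inter_subset_left) fun y hy => hy.2
  have hli' : ∀ y ∈ W, LinearIndependent ℝ fun a => e' a y := by
    intro y hy
    rw [Fintype.linearIndependent_iff]
    intro k hk
    refine Fintype.linearIndependent_iff.1 (hli _ hy.2) k ?_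
    let D : E3 →L[ℝ] TangentSpace (𝓡 3) (ψ.symm y) := mfderiv (𝓡 3) (𝓡 3) ψ.symm y
    have hD : ∀ a, D (e' a y) = e a (ψ.symm y) := hmap y hy
    simp only [← hD, ← map_smul, ← map_sum]
    rw [hk, map_zero]
  have hc' : ∀ y ∈ W, ∀ a b, VectorField.lieBracket ℝ (e' a) (e' b) y
      = ∑ d, c a b d (ψ.symm y) • e' d y := by
    intro y hy a b
    have hM2 : IsManifold (𝓡 3) (minSmoothness ℝ 2) M := by
      rw [minSmoothness_of_isRCLikeNormedField]
      infer_instance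
    have hM3 : IsManifold (𝓡 3) (minSmoothness ℝ 3) M := by
      rw [minSmoothness_of_isRCLikeNormedField]
      infer_instance
    have h1 := VectorField.mpullback_mlieBracket (I := 𝓡 3) (I' := 𝓡 3) (n := ∞)
      ((he a).diffAt hU hy.2) ((he b).diffAt hU hy.2) (hsmAt y hy)
      (by rw [minSmoothness_of_isRCLikeNormedField]; exact ENat.LEInfty.out)
    have h2 : VectorField.mlieBracket (𝓡 3) (e' a) (e' b) y
        = VectorField.lieBracket ℝ (e' a) (e' b) y := by
      rw [← VectorField.mlieBracketWithin_univ, VectorField.mlieBracketWithin_eq_lieBracketWithin]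
      exact congrFun VectorField.lieBracketWithin_univ y
    have h3 := hc _ hy.2 a b
    rw [← h2, ← h1, VectorField.mpullback_apply]
    simp only [bracket] at h3
    rw [h3, map_sum]
    simp only [map_smul]
    rfl
  have hx₀W : ψ x₀ ∈ W := ⟨mem_extChartAt_target x₀, by
    change ψ.symm (ψ x₀) ∈ U
    rwa [hψ, extChartAt_to_inv]⟩
  have hAd : ∀ y ∈ W, ∀ a, MDifferentiableAt (𝓡 3) 𝓘(ℝ, 𝔸) (A a) (ψ.symm y) := fun y hy a =>
    ((hA a).contMDiffAt (hU.mem_nhds hy.2)).mdifferentiableAt (by simp)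
  obtain ⟨R, hR, hRW, Φ, hΦ0, hΦs, hΦ⟩ := exists_frame_solution hW hx₀W he's hli' hA's hc'
    (by
      intro y hy a b
      rw [hcomp y hy (hAd y hy b), hcomp y hy (hAd y hy a)]
      exact flat _ hy.2 a b)
  have hψs : ContMDiffOn (𝓡 3) (𝓡 3) ∞ ψ ψ.source := by
    have := contMDiffOn_extChartAt (I := 𝓡 3) (n := ∞) (x := x₀)
    rwa [← extChartAt_source (𝓡 3)] at this
  have hSo : IsOpen ψ.source := isOpen_extChartAt_source x₀
  have hVo : IsOpen (ψ.source ∩ ψ ⁻¹' Metric.ball (ψ x₀) R) :=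
    hψs.continuousOn.isOpen_inter_preimage hSo Metric.isOpen_ball
  have hΦV : ContMDiffOn (𝓡 3) 𝓘(ℝ, 𝔸) ∞ (fun x => Φ (ψ x))
      (ψ.source ∩ ψ ⁻¹' Metric.ball (ψ x₀) R) :=
    ContMDiffOn.comp (I' := 𝓡 3) (contMDiffOn_iff_contDiffOn.2 hΦs)
      (hψs.mono Set.inter_subset_left) fun y hy => hy.2
  refine ⟨ψ.source ∩ ψ ⁻¹' Metric.ball (ψ x₀) R, hVo,
    ⟨mem_extChartAt_source x₀, Metric.mem_ball_self hR⟩, ?_, fun x => Φ (ψ x), hΦ0, hΦV, ?_⟩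
  · intro x hx
    have := (hRW hx.2).2
    rwa [Set.mem_preimage, ψ.left_inv hx.1] at this
  · intro x hx a
    have hy := hRW hx.2
    have hxx : ψ.symm (ψ x) = x := ψ.left_inv hx.1
    have hd : MDifferentiableAt (𝓡 3) 𝓘(ℝ, 𝔸) (fun x => Φ (ψ x)) (ψ.symm (ψ x)) := by
      rw [hxx]
      exact (hΦV.contMDiffAt (hVo.mem_nhds hx)).mdifferentiableAt (by simp)
    have h1 := hcomp (ψ x) hy hd a
    have h2 : (fun z => Φ (ψ (ψ.symm z))) =ᶠ[𝓝 (ψ x)] Φ := by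
      filter_upwards [hT.mem_nhds hy.1] with z hz
      rw [ψ.right_inv hz]
    rw [h2.fderiv_eq, hΦ _ hx.2 a, hxx] at h1
    exact h1.symm

/-- A vector valued function with vanishing derivative near a point is constant near it. -/
theorem eventually_eq_of_mvfderiv_eq_zero {F : Type*} [NormedAddCommGroup F] [NormedSpace ℝ F]
    {f : M → F} {x₀ : M} (h : ∀ᶠ x in 𝓝 x₀, MDifferentiableAt (𝓡 3) 𝓘(ℝ, F) f x ∧
      ∀ v, mvfderiv (𝓡 3) f x v = 0) : ∀ᶠ x in 𝓝 x₀, f x = f x₀ := by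
  set ψ := extChartAt (𝓡 3) x₀ with hψ
  have hT : IsOpen ψ.target := isOpen_extChartAt_target x₀
  have hsm : ContMDiffOn (𝓡 3) (𝓡 3) ∞ ψ.symm ψ.target := contMDiffOn_extChartAt_symm x₀
  have hx₀T : ψ x₀ ∈ ψ.target := mem_extChartAt_target x₀
  have hx₀S : x₀ ∈ ψ.source := mem_extChartAt_source x₀
  have hcont : Filter.Tendsto ψ.symm (𝓝 (ψ x₀)) (𝓝 x₀) := by
    have := (hsm.continuousOn.continuousAt (hT.mem_nhds hx₀T)).tendsto
    rwa [ψ.left_inv hx₀S] at this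
  have hd : ∀ᶠ y in 𝓝 (ψ x₀), HasFDerivAt (fun z => f (ψ.symm z)) (0 : E3 →L[ℝ] F) y := by
    filter_upwards [hcont.eventually h, hT.mem_nhds hx₀T] with y hy hyT
    have h1 : MDifferentiableAt (𝓡 3) (𝓡 3) ψ.symm y :=
      (hsm.contMDiffAt (hT.mem_nhds hyT)).mdifferentiableAt (by simp)
    have h2 : MDifferentiableAt (𝓡 3) 𝓘(ℝ, F) (fun z => f (ψ.symm z)) y := hy.1.comp y h1
    have h3 := (mdifferentiableAt_iff_differentiableAt.1 h2).hasFDerivAt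
    have h4 : fderiv ℝ (fun z => f (ψ.symm z)) y = 0 := by
      refine ContinuousLinearMap.ext fun v => ?_
      rw [← mfderiv_eq_fderiv]
      exact (mfderiv_comp_apply (I := 𝓡 3) (I' := 𝓡 3) (I'' := 𝓘(ℝ, F)) y hy.1 h1 v).trans (hy.2 _)
    rwa [h4] at h3
  obtain ⟨r, hr, hball⟩ := Metric.eventually_nhds_iff_ball.1 hd
  have hev : ∀ᶠ x in 𝓝 x₀, ψ x ∈ Metric.ball (ψ x₀) r :=
    (continuousAt_extChartAt x₀).eventually (Metric.ball_mem_nhds _ hr)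
  filter_upwards [hev, (isOpen_extChartAt_source x₀).mem_nhds hx₀S] with x hx hxS
  have := (convex_ball (ψ x₀) r).is_const_of_fderivWithin_eq_zero (𝕜 := ℝ)
    (f := fun z => f (ψ.symm z))
    (fun y hy => (hball y hy).differentiableAt.differentiableWithinAt)
    (fun y hy => (hball y hy).hasFDerivWithinAt.fderivWithin
      (Metric.isOpen_ball.uniqueDiffWithinAt hy)) hx (Metric.mem_ball_self hr)
  simpa only [ψ.left_inv hxS, ψ.left_inv hx₀S] using this

end Manifold

end FrobeniusFrame

/-! ### Special horizontal fields. -/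

section SpecialField

variable {M : Type*} [TopologicalSpace M] [ChartedSpace E3 M] [IsManifold (𝓡 3) ∞ M]

theorem mvfderiv_clm_comp {F F' : Type*} [NormedAddCommGroup F] [NormedSpace ℝ F]
    [NormedAddCommGroup F'] [NormedSpace ℝ F'] (L : F →L[ℝ] F') {f : M → F} {x : M}
    (hf : MDifferentiableAt (𝓡 3) 𝓘(ℝ, F) f x) (v : TangentSpace (𝓡 3) x) :
    mvfderiv (𝓡 3) (fun y => L (f y)) x v = L (mvfderiv (𝓡 3) f x v) := by
  have h := mfderiv_comp_apply (I := 𝓡 3) (I' := 𝓘(ℝ, F)) (I'' := 𝓘(ℝ, F')) (g := L) x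
    L.differentiableAt.mdifferentiableAt hf v
  refine h.trans ?_
  rw [mfderiv_eq_fderiv, L.fderiv]
  rfl

namespace LorentzianSasakian

variable (S : LorentzianSasakian M)

/-- A horizontal field `W` with `∇_X W = -k η(X) φ W - g(X, φ W) ξ` at `x`. -/
structure IsSpecialAt (k : ℝ) (W : VField M) (x : M) : Prop where
  diffAt : W.DiffAt x
  eta : S.eta x (W x) = 0
  nabla : ∀ X : VField M, X.DiffAt x → LorentzSasaki.nabla S.metric.form X W x
    = -(k * S.eta x (X x)) • S.phi x (W x) - S.metric.form x (X x) (S.phi x (W x)) • S.xi x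

variable {S} {k : ℝ} {W W' : VField M} {x : M}

theorem IsSpecialAt.congr (h : S.IsSpecialAt k W x) (hW : W =ᶠ[𝓝 x] W') :
    S.IsSpecialAt k W' x where
  diffAt := h.diffAt.congr hW
  eta := by rw [← hW.self_of_nhds, h.eta]
  nabla X hX := by
    rw [← S.metric.nabla_congr (Filter.EventuallyEq.refl (𝓝 x) X) hW, ← hW.self_of_nhds,
      h.nabla X hX]

/-- The special equation is linear; differences are needed to prove that special fields are
determined by one value. -/
theorem IsSpecialAt.sub (h : S.IsSpecialAt k W x) (h' : S.IsSpecialAt k W' x) :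
    S.IsSpecialAt k (W + (fun _ : M => (-1 : ℝ)) • W') x := by
  have hc : FDiffAt (fun _ : M => (-1 : ℝ)) x := mdifferentiableAt_const
  refine ⟨h.diffAt.add (h'.diffAt.smul hc), ?_, fun X hX => ?_⟩
  · simp only [Pi.add_apply, Pi.smul_apply', map_add, map_smul, h.eta, h'.eta, smul_zero, add_zero]
  · rw [S.metric.nabla_add_right hX h.diffAt (h'.diffAt.smul hc),
      S.metric.nabla_smul_right hc hX h'.diffAt, h.nabla X hX, h'.nabla X hX, dirDeriv_const]
    simp only [Pi.add_apply, Pi.smul_apply', map_add, map_smul, smul_eq_mul]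
    module

/-- The derivative ∇W is a combination of φW and ξ, both orthogonal to W. -/
theorem IsSpecialAt.dirDeriv_form_self (h : S.IsSpecialAt k W x) (v : TangentSpace (𝓡 3) x) :
    dirDeriv (fun y => S.metric.form y (W y) (W y)) x v = 0 := by
  have hX : VField.DiffAt (FiberBundle.extend E3 v) x :=
    FiberBundle.mdifferentiableAt_extend (𝓡 3) E3 v
  have h1 := S.metric.dirDeriv_form hX h.diffAt h.diffAt
  rw [FiberBundle.extend_apply_self, S.metric.symm x (W x), h.nabla _ hX] at h1
  rw [h1]
  have h2 : S.metric.form x (S.phi x (W x)) (W x) = 0 := by rw [S.metric.symm, S.form_phi_self]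
  simp only [map_sub, map_smul, sub_apply, smul_apply, h2, S.form_xi, h.eta]
  simp

end LorentzianSasakian

namespace AdaptedFrame

variable {S : LorentzianSasakian M} {U : Set M} {e : Fin 3 → VField M} (hE : AdaptedFrame S U e)
include hE

theorem eta_frame {x : M} (hx : x ∈ U) (a : Fin 3) :
    S.eta x (e a x) = if a = 0 then 1 else 0 := by
  rw [hE.eta_eq hx, hE.ortho x hx]
  fin_cases a <;> simp [sgn]

/-- The components of the closed one-form that measures the rotation of the special fields. -/
def _root_.LorentzSasaki.rotForm (G : LorentzianMetric M) (e : Fin 3 → VField M) (lam : ℝ)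
    (a : Fin 3) (x : M) : ℝ :=
  if a = 0 then lam - structureFun G e 0 1 2 x else structureFun G e 1 2 a x

theorem contMDiffOn_rotForm (lam : ℝ) (a : Fin 3) :
    ContMDiffOn (𝓡 3) 𝓘(ℝ, ℝ) ∞ (rotForm S.metric e lam a) U := by
  by_cases ha : a = 0
  · refine (contMDiffOn_const (c := lam).sub (hE.contMDiffOn_structureFun 0 1 2)).congr
      fun y _ => ?_
    simp [rotForm, ha]
  · refine (hE.contMDiffOn_structureFun 1 2 a).congr fun y _ => ?_
    simp [rotForm, ha]

theorem dirDeriv_rotForm_zero (lam : ℝ) {x : M} (hx : x ∈ U) (v : TangentSpace (𝓡 3) x) :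
    dirDeriv (rotForm S.metric e lam 0) x v = - dirDeriv (structureFun S.metric e 0 1 2) x v := by
  have h : rotForm S.metric e lam 0 = fun y => lam - structureFun S.metric e 0 1 2 y := rfl
  rw [h, dirDeriv_sub mdifferentiableAt_const (hE.fdiffAt_structureFun hx _ _ _), dirDeriv_const,
    zero_sub]

/-- The pairs (ξ, e₁) and (ξ, e₂) give the two Jacobi equations. The pair (e₁, e₂) gives the
curvature equation, and there H = 3 - 2λ is forced. -/
theorem rotForm_closed [T2Space M] {lam : ℝ} (hH : S.HasPhiSectionalCurv (3 - 2 * lam)) {x : M}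
    (hx : x ∈ U) (a b : Fin 3) :
    dirDeriv (rotForm S.metric e lam b) x (e a x) - dirDeriv (rotForm S.metric e lam a) x (e b x)
      = ∑ d, (sgn d * structureFun S.metric e a b d x) * rotForm S.metric e lam d x := by
  have s0 : sgn 0 = -1 := rfl
  have s1 : sgn 1 = 1 := rfl
  have s2 : sgn 2 = 1 := rfl
  have r0 : rotForm S.metric e lam 0 x = lam - structureFun S.metric e 0 1 2 x := rfl
  have r1 : rotForm S.metric e lam 1 = structureFun S.metric e 1 2 1 := rfl
  have r2 : rotForm S.metric e lam 2 = structureFun S.metric e 1 2 2 := rfl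
  have hd := hE.dirDeriv_rotForm_zero lam hx
  obtain ⟨h1, h2, h3⟩ := hE.structureFun_symm_traceless hx
  obtain ⟨j1, j2⟩ := hE.jacobi_equations hx
  have hc := hE.curvature_equation hH hx
  have h01 : dirDeriv (rotForm S.metric e lam 1) x (e 0 x)
      - dirDeriv (rotForm S.metric e lam 0) x (e 1 x)
      = ∑ d, (sgn d * structureFun S.metric e 0 1 d x) * rotForm S.metric e lam d x := by
    simp only [Fin.sum_univ_three, s0, s1, s2, r0, r1, r2, hd, h1, hE.structureFun_zero_one hx]
    linear_combination j1
  have h02 : dirDeriv (rotForm S.metric e lam 2) x (e 0 x)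
      - dirDeriv (rotForm S.metric e lam 0) x (e 2 x)
      = ∑ d, (sgn d * structureFun S.metric e 0 2 d x) * rotForm S.metric e lam d x := by
    simp only [Fin.sum_univ_three, s0, s1, s2, r0, r1, r2, hd, h2, h3, hE.structureFun_zero_two hx]
    linear_combination j2
  have h12 : dirDeriv (rotForm S.metric e lam 2) x (e 1 x)
      - dirDeriv (rotForm S.metric e lam 1) x (e 2 x)
      = ∑ d, (sgn d * structureFun S.metric e 1 2 d x) * rotForm S.metric e lam d x := by
    simp only [Fin.sum_univ_three, s0, s1, s2, r0, r1, r2, hE.structureFun_one_two hx]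
    linear_combination hc
  have hself : ∀ a, dirDeriv (rotForm S.metric e lam a) x (e a x)
      - dirDeriv (rotForm S.metric e lam a) x (e a x)
      = ∑ d, (sgn d * structureFun S.metric e a a d x) * rotForm S.metric e lam d x := by
    intro a
    simp [structureFun_self]
  have hswap : ∀ a b, (dirDeriv (rotForm S.metric e lam b) x (e a x)
      - dirDeriv (rotForm S.metric e lam a) x (e b x)
      = ∑ d, (sgn d * structureFun S.metric e a b d x) * rotForm S.metric e lam d x) →
      dirDeriv (rotForm S.metric e lam a) x (e b x)
      - dirDeriv (rotForm S.metric e lam b) x (e a x)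
      = ∑ d, (sgn d * structureFun S.metric e b a d x) * rotForm S.metric e lam d x := by
    intro a b h
    simp only [structureFun_swap S.metric e b a, mul_neg, neg_mul, Finset.sum_neg_distrib, ← h]
    ring
  fin_cases a <;> fin_cases b
  exacts [hself 0, h01, h02, hswap 0 1 h01, hself 1, h12, hswap 0 2 h02, hswap 1 2 h12, hself 2]

/-- A field with components `u`, `v` that rotate against the frame is special. -/
theorem isSpecialAt_of_rotation [T2Space M] {lam : ℝ} {x : M} (hx : x ∈ U) {u v : M → ℝ}
    (hu : FDiffAt u x) (hv : FDiffAt v x)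
    (hdu : ∀ a, dirDeriv u x (e a x) = - rotForm S.metric e lam a x * v x)
    (hdv : ∀ a, dirDeriv v x (e a x) = rotForm S.metric e lam a x * u x) :
    S.IsSpecialAt (lam - 1) (u • e 1 + v • e 2) x := by
  have d1 := (hE.diffAt hx 1).smul hu
  have d2 := (hE.diffAt hx 2).smul hv
  have hphi : S.phi x ((u • e 1 + v • e 2) x) = v x • e 1 x - u x • e 2 x := by
    simp only [Pi.add_apply, Pi.smul_apply', map_add, map_smul, hE.phi_one x hx, hE.phi_two x hx]
    module
  have s0 : sgn 0 = -1 := rfl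
  have s1 : sgn 1 = 1 := rfl
  have s2 : sgn 2 = 1 := rfl
  have r0 : rotForm S.metric e lam 0 x = lam - structureFun S.metric e 0 1 2 x := rfl
  have r1 : rotForm S.metric e lam 1 x = structureFun S.metric e 1 2 1 x := rfl
  have r2 : rotForm S.metric e lam 2 x = structureFun S.metric e 1 2 2 x := rfl
  obtain ⟨v1, v2, v3, v4, v5, v6, v7, v8, v9⟩ := hE.connCoeff_values hx
  have hframe : ∀ a, LorentzSasaki.nabla S.metric.form (e a) (u • e 1 + v • e 2) x
      = -((lam - 1) * S.eta x (e a x)) • S.phi x ((u • e 1 + v • e 2) x)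
        - S.metric.form x (e a x) (S.phi x ((u • e 1 + v • e 2) x)) • S.xi x := by
    intro a
    rw [S.metric.nabla_add_right (hE.diffAt hx a) d1 d2,
      S.metric.nabla_smul_right hu (hE.diffAt hx a) (hE.diffAt hx 1),
      S.metric.nabla_smul_right hv (hE.diffAt hx a) (hE.diffAt hx 2), hE.nabla_eq hx, hE.nabla_eq hx,
      hphi, hE.eta_frame hx, map_sub, map_smul, map_smul, hE.ortho x hx, hE.ortho x hx, hdu, hdv,
      ← hE.zero x hx]
    simp only [Fin.sum_univ_three, s0, s1, s2, connCoeff_self, connCoeff_swap S.metric e _ 1 0,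
      connCoeff_swap S.metric e _ 2 0, connCoeff_swap S.metric e _ 2 1]
    fin_cases a
    · simp [v1, v2, v3, r0]
      module
    · simp [v4, v5, v6, r1, s1]
      module
    · simp [v7, v8, v9, r2, s2]
      module
  have hd := d1.add d2
  refine ⟨hd, ?_, fun X hX => ?_⟩
  · simp [hE.eta_frame hx]
  · have hT := S.metric.tensorialAt_nabla hd
    obtain ⟨T, h1⟩ : ∃ T : TangentSpace (𝓡 3) x →L[ℝ] TangentSpace (𝓡 3) x, ∀ X : VField M,
        X.DiffAt x → LorentzSasaki.nabla S.metric.form X (u • e 1 + v • e 2) x = T (X x) :=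
      ⟨_, fun X hX => (TensorialAt.mkHom_apply hT hX).symm⟩
    obtain ⟨c, hc⟩ : ∃ c : Fin 3 → ℝ, X x = ∑ a, c a • e a x := ⟨_, hE.expand hx (X x)⟩
    rw [h1 X hX, hc, Fin.sum_univ_three]
    have h2 : ∀ a, T (e a x) = _ := fun a => (h1 _ (hE.diffAt hx a)).symm.trans (hframe a)
    simp only [map_add, map_smul, h2, add_apply, smul_apply, smul_eq_mul]
    module

/-- Special fields exist locally, with an arbitrary horizontal value at a point. -/
theorem exists_special [T2Space M] {lam : ℝ} (hH : S.HasPhiSectionalCurv (3 - 2 * lam)) {x₀ : M}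
    (hx₀ : x₀ ∈ U) : ∃ V : Set M, IsOpen V ∧ x₀ ∈ V ∧ V ⊆ U ∧ ∃ z : M → ℂ, z x₀ = 1 ∧
      ContMDiffOn (𝓡 3) 𝓘(ℝ, ℂ) ∞ z V ∧ (∀ x ∈ V, z x ≠ 0) ∧ ∀ f : ℂ, ∀ x ∈ V,
      S.IsSpecialAt (lam - 1) ((fun y => (f * z y).re) • e 1 + (fun y => (f * z y).im) • e 2) x := by
  -- The rotation is encoded as dz = iθz in the commutative algebra ℂ, where flatness of the system
  -- is just dθ = 0.
  let L : ℝ →L[ℝ] ℂ := (ContinuousLinearMap.id ℝ ℝ).smulRight Complex.I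
  have hL : ∀ t : ℝ, L t = t * Complex.I := fun t => rfl
  have hr := fun (x : M) (hx : x ∈ U) a =>
    fdiffAt_of_contMDiffOn hE.isOpen (hE.contMDiffOn_rotForm lam a) hx
  obtain ⟨V, hV, hxV, hVU, z, hz0, hzs, hz⟩ := exists_manifold_frame_solution hE.isOpen hx₀
    hE.smooth (fun x hx => hE.linearIndependent hx)
    (A := fun a x => L (rotForm S.metric e lam a x))
    (fun a => L.contDiff.contMDiff.comp_contMDiffOn (hE.contMDiffOn_rotForm lam a))
    (c := fun a b d x => sgn d * structureFun S.metric e a b d x)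
    (fun x hx a b => hE.bracket_eq hx a b) (by
      intro x hx a b
      rw [mvfderiv_clm_comp L (hr x hx b), mvfderiv_clm_comp L (hr x hx a), mul_comm
        (L (rotForm S.metric e lam b x)), add_sub_cancel_right, ← map_sub]
      simp only [← map_smul, ← map_sum]
      exact congrArg L (hE.rotForm_closed hH hx a b))
  have hne : IsOpen (V ∩ z ⁻¹' {0}ᶜ) :=
    hzs.continuousOn.isOpen_inter_preimage hV isOpen_compl_singleton
  refine ⟨_, hne, ⟨hxV, by simp [hz0]⟩, Set.inter_subset_left.trans hVU, z, hz0,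
    hzs.mono Set.inter_subset_left, fun x hx => hx.2, fun f x hx => ?_⟩
  have hzd : MDifferentiableAt (𝓡 3) 𝓘(ℝ, ℂ) z x :=
    (hzs.contMDiffAt (hV.mem_nhds hx.1)).mdifferentiableAt (by simp)
  let P : ℂ →L[ℝ] ℝ := Complex.reCLM ∘L ContinuousLinearMap.mul ℝ ℂ f
  let Q : ℂ →L[ℝ] ℝ := Complex.imCLM ∘L ContinuousLinearMap.mul ℝ ℂ f
  have hP : FDiffAt (fun y => (f * z y).re) x := P.differentiableAt.comp_mdifferentiableAt hzd
  have hQ : FDiffAt (fun y => (f * z y).im) x := Q.differentiableAt.comp_mdifferentiableAt hzd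
  refine hE.isSpecialAt_of_rotation (hVU hx.1) hP hQ (fun a => ?_) (fun a => ?_)
  · refine (mvfderiv_clm_comp P hzd (e a x)).trans ?_
    rw [hz x hx.1 a, hL]
    simp [P]
    ring
  · refine (mvfderiv_clm_comp Q hzd (e a x)).trans ?_
    rw [hz x hx.1 a, hL]
    simp [Q]
    ring

end AdaptedFrame

end SpecialField

/-! ### From local to global special fields. -/

section GlobalFrame

variable {M : Type*} [TopologicalSpace M] [ChartedSpace E3 M] [IsManifold (𝓡 3) ∞ M]

theorem AdaptedFrame.eq_of_eta_eq_zero {S : LorentzianSasakian M} {U : Set M}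
    {e : Fin 3 → VField M} (hE : AdaptedFrame S U e) {x : M} (hx : x ∈ U)
    {v : TangentSpace (𝓡 3) x} (hv : S.eta x v = 0) :
    v = S.metric.form x v (e 1 x) • e 1 x + S.metric.form x v (e 2 x) • e 2 x := by
  have h := hE.expand hx v
  have h0 : S.metric.form x v (e 0 x) = 0 := by
    have := hE.eta_eq hx v
    linarith
  have s1 : sgn 1 = 1 := rfl
  have s2 : sgn 2 = 1 := rfl
  rwa [Fin.sum_univ_three, coord, coord, coord, h0, mul_zero, zero_smul, zero_add, s1, s2, one_mul,
    one_mul] at h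

/-- The metric is positive definite on ξ^⊥, although it is Lorentzian on the whole tangent space. -/
theorem AdaptedFrame.eq_zero_of_form_self {S : LorentzianSasakian M} {U : Set M}
    {e : Fin 3 → VField M} (hE : AdaptedFrame S U e) {x : M} (hx : x ∈ U)
    {v : TangentSpace (𝓡 3) x} (hv : S.eta x v = 0) (h : S.metric.form x v v = 0) : v = 0 := by
  have h1 := hE.eq_of_eta_eq_zero hx hv
  have h2 : S.metric.form x v (e 1 x) ^ 2 + S.metric.form x v (e 2 x) ^ 2 = 0 := by
    rw [h1] at h
    simp only [map_add, map_smul, add_apply, smul_apply, smul_eq_mul, hE.ortho x hx] at h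
    have s1 : sgn 1 = 1 := rfl
    have s2 : sgn 2 = 1 := rfl
    simp [s1, s2] at h
    linarith
  have h3 : S.metric.form x v (e 1 x) = 0 := by
    nlinarith [sq_nonneg (S.metric.form x v (e 1 x)), sq_nonneg (S.metric.form x v (e 2 x))]
  have h4 : S.metric.form x v (e 2 x) = 0 := by
    nlinarith [sq_nonneg (S.metric.form x v (e 1 x)), sq_nonneg (S.metric.form x v (e 2 x))]
  rw [h1, h3, h4, zero_smul, zero_smul, add_zero]

theorem LorentzianSasakian.eventually_form_eq_of_isSpecialAt {S : LorentzianSasakian M} {k : ℝ}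
    {W : VField M} {x : M} (h : ∀ᶠ y in 𝓝 x, S.IsSpecialAt k W y) :
    ∀ᶠ y in 𝓝 x, S.metric.form y (W y) (W y) = S.metric.form x (W x) (W x) := by
  refine eventually_eq_of_mvfderiv_eq_zero (f := fun y => S.metric.form y (W y) (W y)) ?_
  filter_upwards [h] with y hy
  exact ⟨S.metric.fdiffAt_apply hy.diffAt hy.diffAt, hy.dirDeriv_form_self⟩

/-- On a simply connected `φ`-space form there is a global special field of unit length. -/
theorem exists_global_special [T2Space M] [SimplyConnectedSpace M] (S : LorentzianSasakian M)
    {lam : ℝ} (hH : S.HasPhiSectionalCurv (3 - 2 * lam)) :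
    ∃ Y : VField M, Y.Smooth ∧ (∀ x, S.metric.form x (Y x) (Y x) = 1) ∧
      ∀ x, S.IsSpecialAt (lam - 1) Y x := by
  choose U hxU e hE using exists_adaptedFrame S
  choose V hV hxV hVU z hz0 hzs hz hsp using fun x => (hE x).exists_special hH (hxU x)
  -- The local special fields near `i`, parametrized by ℂ; at each point of `V i` they exhaust the
  -- horizontal plane.
  let τ : M → (x : M) → ℂ → TangentSpace (𝓡 3) x := fun i x f =>
    (f * z i x).re • e i 1 x + (f * z i x).im • e i 2 x
  have hloc : LocallyPathConnectedSpace M := ChartedSpace.locallyPathConnectedSpace E3 M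
  have x₀ : M := Classical.arbitrary M
  have hτ : ∀ i f, (fun y => τ i y f)
      = (fun y => (f * z i y).re) • e i 1 + (fun y => (f * z i y).im) • e i 2 := fun i f => rfl
  have hsurj : ∀ j, ∀ x ∈ V j, ∀ w : TangentSpace (𝓡 3) x, S.eta x w = 0 → ∃ f, w = τ j x f := by
    intro j x hx w hw
    refine ⟨⟨S.metric.form x w (e j 1 x), S.metric.form x w (e j 2 x)⟩ / z j x, ?_⟩
    simp only [τ, div_mul_cancel₀ _ (hz j x hx)]
    exact (hE j).eq_of_eta_eq_zero (hVU j hx) hw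
  obtain ⟨Y, hY0, hY⟩ := exists_section_of_locally_constant_transition V hV id hxV τ
    (by
      intro i x hx f f' hff
      have hli := (hE i).linearIndependent (hVU i hx)
      have h : ((f * z i x).re - (f' * z i x).re) • e i 1 x
          + ((f * z i x).im - (f' * z i x).im) • e i 2 x = 0 := by
        have h' : τ i x f - τ i x f' = 0 := sub_eq_zero.2 hff
        rw [← h']
        simp only [τ]
        module
      have h2 := Fintype.linearIndependent_iff.1 hli
        (fun a => if a = 0 then 0 else if a = 1 then (f * z i x).re - (f' * z i x).re
          else (f * z i x).im - (f' * z i x).im)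
        (by rw [Fin.sum_univ_three]; simpa using h)
      have h3 := h2 1
      have h4 := h2 2
      simp only [Fin.isValue, one_ne_zero, if_false, if_true] at h3
      simp at h4
      exact mul_right_cancel₀ (hz i x hx) (Complex.ext (sub_eq_zero.1 h3) (sub_eq_zero.1 h4)))
    (by
      intro i j x hx f
      obtain ⟨f', hf'⟩ := hsurj j x hx.2 (τ i x f) (hsp i f x hx.1).eta
      refine ⟨f', ?_⟩
      -- The difference is special and vanishes at `x`; its squared length is locally constant,
      -- hence zero, so the two fields agree near `x`.
      set D : VField M := (fun y => τ i y f) + (fun _ : M => (-1 : ℝ)) • (fun y => τ j y f') with hD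
      have hDy : ∀ y, D y = τ i y f - τ j y f' := by
        intro y
        simp only [hD, Pi.add_apply, Pi.smul_apply']
        module
      have hsD : ∀ᶠ y in 𝓝 x, S.IsSpecialAt (lam - 1) D y := by
        filter_upwards [(hV i).mem_nhds hx.1, (hV j).mem_nhds hx.2] with y hyi hyj
        exact (hsp i f y hyi).sub (hsp j f' y hyj)
      filter_upwards [hsD, LorentzianSasakian.eventually_form_eq_of_isSpecialAt hsD,
        (hV j).mem_nhds hx.2] with y h1 h2 h3
      rw [hDy x, sub_eq_zero.2 hf', map_zero] at h2
      have h4 := (hE j).eq_zero_of_form_self (hVU j h3) h1.eta h2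
      rw [hDy] at h4
      exact sub_eq_zero.1 h4)
    x₀ 1
  have hYs : ∀ x, S.IsSpecialAt (lam - 1) Y x := by
    intro x
    obtain ⟨f, hf⟩ := hY x x (hxV x)
    exact (hsp x f x (hxV x)).congr (hf.mono fun y hy => hy.symm)
  refine ⟨Y, fun x => ?_, ?_, hYs⟩
  · obtain ⟨f, hf⟩ := hY x x (hxV x)
    have hre : ContMDiffOn (𝓡 3) 𝓘(ℝ, ℝ) ∞ (fun y => (f * z x y).re) (V x) :=
      (Complex.reCLM ∘L ContinuousLinearMap.mul ℝ ℂ f).contDiff.contMDiff.comp_contMDiffOn (hzs x)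
    have him : ContMDiffOn (𝓡 3) 𝓘(ℝ, ℝ) ∞ (fun y => (f * z x y).im) (V x) :=
      (Complex.imCLM ∘L ContinuousLinearMap.mul ℝ ℂ f).contDiff.contMDiff.comp_contMDiffOn (hzs x)
    have hsm : VField.SmoothOn (fun y => τ x y f) (V x) :=
      (VField.SmoothOn.smul hre (((hE x).smooth 1).mono (hVU x))).add
        (VField.SmoothOn.smul him (((hE x).smooth 2).mono (hVU x)))
    exact (hsm.contMDiffAt (hV x) (hxV x)).congr_of_eventuallyEq
      (hf.mono fun y hy => by simp only [hy])
  · have hlc : IsLocallyConstant fun x => S.metric.form x (Y x) (Y x) := by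
      rw [IsLocallyConstant.iff_eventually_eq]
      exact fun x => LorentzianSasakian.eventually_form_eq_of_isSpecialAt
        (Filter.Eventually.of_forall hYs)
    intro x
    rw [hlc.apply_eq_of_preconnectedSpace x x₀, hY0]
    simp only [τ, id, hz0, mul_one, Complex.one_re, Complex.one_im, one_smul, zero_smul, add_zero]
    exact (hE x₀).ortho x₀ (hxU x₀) 1 1

end GlobalFrame

/-! ### A global frame with constant brackets, and global solutions of flat systems. -/

section GlobalSolution

variable {M : Type*} [TopologicalSpace M] [ChartedSpace E3 M] [IsManifold (𝓡 3) ∞ M]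

/-- For the frame (ξ, Y, -φY) with Y special of unit length, the special equation prescribes g(∇Y,
e₂) = (λ - 1)η; comparison with `connCoeff_values` reads off the three structure functions. -/
theorem exists_global_adaptedFrame [T2Space M] [SimplyConnectedSpace M] (S : LorentzianSasakian M)
    {lam : ℝ} (hH : S.HasPhiSectionalCurv (3 - 2 * lam)) :
    ∃ e, AdaptedFrame S Set.univ e ∧
      ∀ x, structureFun S.metric e 0 1 2 x = lam ∧ structureFun S.metric e 1 2 1 x = 0 ∧
        structureFun S.metric e 1 2 2 x = 0 := by
  obtain ⟨Y, hYs, hY1, hY⟩ := exists_global_special S hH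
  have hE : AdaptedFrame S Set.univ ![S.xi, Y, fun y => - S.phi y (Y y)] :=
    AdaptedFrame.of_unit S isOpen_univ hYs.contMDiffOn (fun x _ => (hY x).eta) (fun x _ => hY1 x)
  refine ⟨_, hE, fun x => ?_⟩
  generalize he : (![S.xi, Y, fun y => - S.phi y (Y y)] : Fin 3 → VField M) = e at hE
  have hx := Set.mem_univ x
  have h1 : Y = e 1 := by rw [← he]; rfl
  rw [h1] at hY
  have key : ∀ a, connCoeff S.metric e a 1 2 x = if a = 0 then lam - 1 else 0 := by
    intro a
    rw [← hE.form_nabla hx, (hY x).nabla _ (hE.diffAt hx a), hE.phi_one x hx, hE.eta_frame hx,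
      ← hE.zero x hx]
    simp only [map_sub, map_smul, map_neg, sub_apply, smul_apply, neg_apply, hE.ortho x hx]
    by_cases ha : a = 0 <;> simp [ha, sgn]
  obtain ⟨-, -, h3, -, -, h6, -, -, h9⟩ := hE.connCoeff_values hx
  rw [key] at h3 h6 h9
  simp only [if_true, one_ne_zero, if_false] at h3 h6
  simp at h9
  exact ⟨by linarith, by linarith, by linarith⟩

variable {𝔸 : Type*} [NormedRing 𝔸] [NormedAlgebra ℝ 𝔸]

theorem mvfderiv_algebra_mul {p q : M → 𝔸} {x : M} (hp : MDifferentiableAt (𝓡 3) 𝓘(ℝ, 𝔸) p x)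
    (hq : MDifferentiableAt (𝓡 3) 𝓘(ℝ, 𝔸) q x) (v : TangentSpace (𝓡 3) x) :
    mvfderiv (𝓡 3) (fun y => p y * q y) x v
      = p x * mvfderiv (𝓡 3) q x v + mvfderiv (𝓡 3) p x v * q x := by
  have h := (hp.hasMFDerivAt.mul' hq.hasMFDerivAt).mfderiv
  have h' := congrArg (fun T : TangentSpace (𝓡 3) x →L[ℝ] 𝔸 => T v) h
  exact h'

/-- The flat linear system `dΨ(eₐ) = Aₐ Ψ` for a global frame on a simply connected manifold has a
global solution. -/
theorem exists_global_solution [CompleteSpace 𝔸] [SimplyConnectedSpace M] {e : Fin 3 → VField M}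
    (he : ∀ a, (e a).SmoothOn Set.univ) (hli : ∀ x, LinearIndependent ℝ fun a => e a x)
    (hspan : ∀ x, ∀ v : TangentSpace (𝓡 3) x, ∃ c : Fin 3 → ℝ, v = ∑ a, c a • e a x)
    {A : Fin 3 → 𝔸} {c : Fin 3 → Fin 3 → Fin 3 → M → ℝ}
    (hc : ∀ x a b, bracket (e a) (e b) x = ∑ d, c a b d x • e d x)
    (flat : ∀ x a b, A b * A a - A a * A b = ∑ d, c a b d x • A d) :
    ∃ Ψ : M → 𝔸, (∃ x, Ψ x = 1) ∧ ContMDiff (𝓡 3) 𝓘(ℝ, 𝔸) ∞ Ψ ∧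
      ∀ x a, mvfderiv (𝓡 3) Ψ x (e a x) = A a * Ψ x := by
  have hex : ∀ x₀ : M, ∃ V : Set M, IsOpen V ∧ x₀ ∈ V ∧ ∃ Φ : M → 𝔸, Φ x₀ = 1 ∧
      ContMDiffOn (𝓡 3) 𝓘(ℝ, 𝔸) ∞ Φ V ∧ (∀ x ∈ V, IsUnit (Φ x)) ∧
      ∀ x ∈ V, ∀ a, mvfderiv (𝓡 3) Φ x (e a x) = A a * Φ x := by
    intro x₀
    obtain ⟨V, hV, hxV, -, Φ, hΦ0, hΦs, hΦ⟩ := exists_manifold_frame_solution isOpen_univ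
      (Set.mem_univ x₀) he (fun x _ => hli x) (A := fun a _ => A a) (fun a => contMDiffOn_const)
      (c := c) (fun x _ a b => hc x a b) (by
        intro x _ a b
        rw [← flat x a b, mvfderiv_const, mvfderiv_const]
        simp)
    refine ⟨V ∩ Φ ⁻¹' {a | IsUnit a}, hΦs.continuousOn.isOpen_inter_preimage hV Units.isOpen,
      ⟨hxV, ?_⟩, Φ, hΦ0, hΦs.mono Set.inter_subset_left, fun x hx => hx.2, fun x hx => hΦ x hx.1⟩
    rw [Set.mem_preimage, hΦ0]
    exact isUnit_one
  choose V hV hxV Φ hΦ0 hΦs hΦu hΦ using hex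
  have hloc : LocallyPathConnectedSpace M := ChartedSpace.locallyPathConnectedSpace E3 M
  have x₀ : M := Classical.arbitrary M
  have hd : ∀ i, ∀ x ∈ V i, MDifferentiableAt (𝓡 3) 𝓘(ℝ, 𝔸) (Φ i) x := fun i x hx =>
    ((hΦs i).contMDiffAt ((hV i).mem_nhds hx)).mdifferentiableAt (by simp)
  obtain ⟨Ψ, hΨ0, hΨ⟩ := exists_section_of_locally_constant_transition V hV id hxV
    (fun i x (f : 𝔸) => Φ i x * f)
    (fun i x hx f f' h => (hΦu i x hx).mul_left_cancel h)
    (by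
      intro i j x hx f
      -- Two solutions of the same linear system differ by a locally constant right factor:
      -- differentiating Φⱼw = Φᵢf gives Φⱼ dw = 0.
      set w : M → 𝔸 := fun y => Ring.inverse (Φ j y) * (Φ i y * f) with hw
      have hinv : ∀ y ∈ V j, MDifferentiableAt (𝓡 3) 𝓘(ℝ, 𝔸) (fun y => Ring.inverse (Φ j y)) y := by
        intro y hy
        obtain ⟨r, hr⟩ := hΦu j y hy
        refine DifferentiableAt.comp_mdifferentiableAt (g := Ring.inverse) ?_ (hd j y hy)
        rw [← hr]
        exact differentiableAt_inverse r.isUnit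
      have hfac : ∀ y ∈ V j, Φ j y * w y = Φ i y * f := by
        intro y hy
        rw [hw, ← mul_assoc, Ring.mul_inverse_cancel _ (hΦu j y hy), one_mul]
      have hdc : ∀ y, MDifferentiableAt (𝓡 3) 𝓘(ℝ, 𝔸) (fun _ : M => f) y := fun y =>
        mdifferentiableAt_const
      have hdif : ∀ y ∈ V i, MDifferentiableAt (𝓡 3) 𝓘(ℝ, 𝔸) (fun y => Φ i y * f) y :=
        fun y hy => (hd i y hy).mul (hdc y)
      have hwd : ∀ y ∈ V i ∩ V j, MDifferentiableAt (𝓡 3) 𝓘(ℝ, 𝔸) w y := fun y hy =>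
        (hinv y hy.2).mul (hdif y hy.1)
      have hconst : ∀ᶠ y in 𝓝 x, w y = w x := by
        refine eventually_eq_of_mvfderiv_eq_zero ?_
        have hVij : IsOpen (V i ∩ V j) := (hV i).inter (hV j)
        filter_upwards [hVij.mem_nhds hx] with y hy
        refine ⟨hwd y hy, ?_⟩
        have h0 : ∀ a, mvfderiv (𝓡 3) w y (e a y) = 0 := by
          intro a
          have h1 := mvfderiv_algebra_mul (hd j y hy.2) (hwd y hy) (e a y)
          have h2 := mvfderiv_algebra_mul (hd i y hy.1) (hdc y) (e a y)
          have h3 : (fun y => Φ j y * w y) =ᶠ[𝓝 y] fun y => Φ i y * f := by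
            filter_upwards [(hV j).mem_nhds hy.2] with z hz using hfac z hz
          have h4 : mvfderiv (𝓡 3) (fun y => Φ j y * w y) y (e a y)
              = mvfderiv (𝓡 3) (fun y => Φ i y * f) y (e a y) :=
            congrArg (fun T : TangentSpace (𝓡 3) y →L[ℝ] 𝔸 => T (e a y)) h3.mfderiv_eq
          rw [h1, h2, hΦ j y hy.2, hΦ i y hy.1, mvfderiv_const, mul_assoc, mul_assoc, hfac y hy.2,
            zero_apply, mul_zero, zero_add, add_eq_right] at h4
          exact (hΦu j y hy.2).mul_right_eq_zero.1 h4
        intro v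
        obtain ⟨k, rfl⟩ := hspan y v
        simp only [map_sum, map_smul, h0, smul_zero, Finset.sum_const_zero]
      refine ⟨w x, ?_⟩
      filter_upwards [hconst, (hV j).mem_nhds hx.2] with y h1 h2
      rw [← h1, hfac y h2])
    x₀ 1
  have hloc' : ∀ x, ∃ f, Ψ =ᶠ[𝓝 x] fun y => Φ x y * f := fun x => hΨ x x (hxV x)
  refine ⟨Ψ, ⟨x₀, by rw [hΨ0, id, hΦ0, one_mul]⟩, fun x => ?_, fun x a => ?_⟩
  · obtain ⟨f, hf⟩ := hloc' x
    exact (((ContinuousLinearMap.mul ℝ 𝔸).flip f).contDiff.contMDiff.contMDiffAt.comp x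
      ((hΦs x).contMDiffAt ((hV x).mem_nhds (hxV x)))).congr_of_eventuallyEq hf
  · obtain ⟨f, hf⟩ := hloc' x
    have h1 : mvfderiv (𝓡 3) Ψ x (e a x) = mvfderiv (𝓡 3) (fun y => Φ x y * f) x (e a x) :=
      congrArg (fun T : TangentSpace (𝓡 3) x →L[ℝ] 𝔸 => T (e a x)) hf.mfderiv_eq
    rw [h1, mvfderiv_algebra_mul (hd x x (hxV x)) mdifferentiableAt_const, mvfderiv_const,
      hΦ x x (hxV x), hf.self_of_nhds, zero_apply, mul_zero, zero_add, mul_assoc]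

end GlobalSolution

/-! ### Clifford relations and Schur's lemma for the γ-matrices. -/

section GammaMatrices

theorem gam_zero : gam 0 = !![0, 1; 1, 0] := rfl

theorem gam_one : gam 1 = !![0, 1; -1, 0] := by
  ext i j
  fin_cases i <;> fin_cases j <;> simp [gam, pauli]

theorem gam_two : gam 2 = !![Complex.I, 0; 0, -Complex.I] := by
  ext i j
  fin_cases i <;> fin_cases j <;> simp [gam, pauli]

theorem sum_smul_gam (w : Fin 3 → ℝ) : ∑ a, (w a : ℂ) • gam a
    = !![w 2 * Complex.I, w 0 + w 1; w 0 - w 1, -(w 2 * Complex.I)] := by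
  rw [Fin.sum_univ_three, gam_zero, gam_one, gam_two]
  ext i j
  fin_cases i <;> fin_cases j <;> simp
  ring

/-- The matrices `γ'` of an oriented orthonormal frame satisfy the relations of the `γ`. -/
structure GammaRelations (A : Fin 3 → Matrix (Fin 2) (Fin 2) ℂ) : Prop where
  zero_zero : A 0 * A 0 = 1
  one_one : A 1 * A 1 = -1
  two_two : A 2 * A 2 = -1
  zero_one : A 0 * A 1 = Complex.I • A 2
  one_zero : A 1 * A 0 = -(Complex.I • A 2)
  zero_two : A 0 * A 2 = -(Complex.I • A 1)
  two_zero : A 2 * A 0 = Complex.I • A 1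
  one_two : A 1 * A 2 = -(Complex.I • A 0)
  two_one : A 2 * A 1 = Complex.I • A 0

theorem sum_smul_gam_mul_add (u v : Fin 3 → ℝ) :
    (∑ a, (u a : ℂ) • gam a) * (∑ a, (v a : ℂ) • gam a)
      + (∑ a, (v a : ℂ) • gam a) * (∑ a, (u a : ℂ) • gam a)
      = ((-2 * ∑ c, sgn c * u c * v c : ℝ) : ℂ) • 1 := by
  have s0 : sgn 0 = -1 := rfl
  have s1 : sgn 1 = 1 := rfl
  have s2 : sgn 2 = 1 := rfl
  rw [sum_smul_gam u, sum_smul_gam v, Fin.sum_univ_three, s0, s1, s2]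
  ext i j
  fin_cases i <;> fin_cases j <;> simp [Matrix.mul_apply, Fin.sum_univ_two]
  all_goals ring_nf
  all_goals simp only [Complex.I_sq]
  all_goals ring

theorem sum_smul_gam_mul_mul (u v w : Fin 3 → ℝ) :
    (∑ a, (u a : ℂ) • gam a) * (∑ a, (v a : ℂ) • gam a) * (∑ a, (w a : ℂ) • gam a)
      = -((∑ c, sgn c * u c * v c : ℝ) : ℂ) • (∑ a, (w a : ℂ) • gam a)
        + ((∑ c, sgn c * u c * w c : ℝ) : ℂ) • (∑ a, (v a : ℂ) • gam a)
        - ((∑ c, sgn c * v c * w c : ℝ) : ℂ) • (∑ a, (u a : ℂ) • gam a)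
        - (Complex.I * ((u 0 * (v 1 * w 2 - v 2 * w 1) - u 1 * (v 0 * w 2 - v 2 * w 0)
          + u 2 * (v 0 * w 1 - v 1 * w 0) : ℝ) : ℂ)) • 1 := by
  have s0 : sgn 0 = -1 := rfl
  have s1 : sgn 1 = 1 := rfl
  have s2 : sgn 2 = 1 := rfl
  rw [sum_smul_gam u, sum_smul_gam v, sum_smul_gam w]
  simp only [Fin.sum_univ_three, s0, s1, s2]
  ext i j
  fin_cases i <;> fin_cases j <;> simp [Matrix.mul_apply, Fin.sum_univ_two]
  all_goals ring_nf
  all_goals simp only [Complex.I_sq, Complex.I_pow_three]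
  all_goals ring

/-- Lorentz orthogonality gives the anticommutators. Determinant one gives γ'₀γ'₁γ'₂ = -i, which
singles out this representation from its negative and determines all mixed products. -/
theorem gammaRelations {L : Matrix (Fin 3) (Fin 3) ℝ}
    (horth : ∀ a b, ∑ c, sgn c * L c a * L c b = if a = b then sgn a else 0) (hdet : L.det = 1) :
    GammaRelations fun b => ∑ a, (L a b : ℂ) • gam a := by
  set A : Fin 3 → Matrix (Fin 2) (Fin 2) ℂ := fun b => ∑ a, (L a b : ℂ) • gam a with hA
  have s0 : sgn 0 = -1 := rfl
  have s1 : sgn 1 = 1 := rfl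
  have s2 : sgn 2 = 1 := rfl
  have hadd : ∀ a b, A a * A b + A b * A a = ((-2 * if a = b then sgn a else 0 : ℝ) : ℂ) • 1 := by
    intro a b
    rw [hA, sum_smul_gam_mul_add, horth]
  have hsq : ∀ a, A a * A a = -((sgn a : ℝ) : ℂ) • 1 := by
    intro a
    have h := hadd a a
    rw [if_pos rfl, ← two_smul ℂ] at h
    have h2 : (2 : ℂ) • (A a * A a) = (2 : ℂ) • (-((sgn a : ℝ) : ℂ) • 1) := by
      rw [h, smul_smul]
      push_cast
      congr 1
      ring
    exact smul_right_injective _ (two_ne_zero (α := ℂ)) h2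
  have hanti : ∀ a b, a ≠ b → A b * A a = -(A a * A b) := by
    intro a b hab
    have h := hadd a b
    rw [if_neg hab, mul_zero, Complex.ofReal_zero, zero_smul] at h
    exact eq_neg_of_add_eq_zero_right h
  have hvol : A 0 * A 1 * A 2 = -(Complex.I • 1) := by
    rw [Matrix.det_fin_three] at hdet
    rw [hA, sum_smul_gam_mul_mul, horth, horth, horth]
    have : L 0 0 * (L 1 1 * L 2 2 - L 2 1 * L 1 2) - L 1 0 * (L 0 1 * L 2 2 - L 2 1 * L 0 2)
          + L 2 0 * (L 0 1 * L 1 2 - L 1 1 * L 0 2) = 1 := by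
      linarith
    rw [this]
    simp
  have h00 : A 0 * A 0 = 1 := by rw [hsq, s0]; simp
  have h11 : A 1 * A 1 = -1 := by rw [hsq, s1]; simp
  have h22 : A 2 * A 2 = -1 := by rw [hsq, s2]; simp
  have h01 : A 0 * A 1 = Complex.I • A 2 := by
    have h := congrArg (· * A 2) hvol
    simp only [mul_assoc, h22, neg_mul, smul_mul_assoc, one_mul, mul_neg, mul_one] at h
    exact neg_injective h
  have h12 : A 1 * A 2 = -(Complex.I • A 0) := by
    have h := congrArg (A 0 * ·) hvol
    simp only [← mul_assoc, h00, one_mul, mul_neg, mul_smul_comm, mul_one] at h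
    exact h
  have h02 : A 0 * A 2 = -(Complex.I • A 1) := by
    have h : A 1 * (A 0 * A 1 * A 2) = A 0 * A 2 := by
      rw [← mul_assoc, ← mul_assoc, hanti 0 1 (by decide), neg_mul, mul_assoc (A 0), h11, mul_neg,
        mul_one, neg_neg]
    rw [← h, hvol, mul_neg, mul_smul_comm, mul_one]
  refine ⟨h00, h11, h22, h01, ?_, h02, ?_, h12, ?_⟩
  · rw [hanti 0 1 (by decide), h01]
  · rw [hanti 0 2 (by decide), h02, neg_neg]
  · rw [hanti 1 2 (by decide), h12, neg_neg]

theorem gammaRelations_gam : GammaRelations gam := by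
  have h := gammaRelations (L := 1) (by
    intro a b
    simp only [Fin.sum_univ_three, Matrix.one_apply]
    fin_cases a <;> fin_cases b <;> simp [sgn]) Matrix.det_one
  have h2 : (fun b => ∑ a, ((1 : Matrix (Fin 3) (Fin 3) ℝ) a b : ℂ) • gam a) = gam := by
    funext b
    simp only [Fin.sum_univ_three, Matrix.one_apply]
    fin_cases b <;> simp
  rwa [h2] at h

/-- The average of the matrix `C` over the group generated by the `γ`. -/
def intertwiner (A : Fin 3 → Matrix (Fin 2) (Fin 2) ℂ) (C : Matrix (Fin 2) (Fin 2) ℂ) :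
    Matrix (Fin 2) (Fin 2) ℂ :=
  C + A 0 * (C * gam 0) - A 1 * (C * gam 1) - A 2 * (C * gam 2)

/-- The terms of the average are AₐCγₐ⁻¹, which explains the signs; multiplication by a generator
permutes them, scalar factors cancelling. -/
theorem GammaRelations.intertwiner_mul {A : Fin 3 → Matrix (Fin 2) (Fin 2) ℂ}
    (hA : GammaRelations A) (C : Matrix (Fin 2) (Fin 2) ℂ) (b : Fin 3) :
    intertwiner A C * gam b = A b * intertwiner A C := by
  obtain ⟨a1, a2, a3, a4, a5, a6, a7, a8, a9⟩ := hA
  obtain ⟨g1, g2, g3, g4, g5, g6, g7, g8, g9⟩ := gammaRelations_gam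
  have key : ∀ {P Q R : Matrix (Fin 2) (Fin 2) ℂ}, P * Q = R → ∀ X, P * (Q * X) = R * X := by
    intro P Q R h X
    rw [← mul_assoc, h]
  simp only [intertwiner]
  fin_cases b <;>
  · simp only [Fin.zero_eta, Fin.mk_one, Fin.reduceFinMk, add_mul, sub_mul, mul_add, mul_sub, mul_assoc, g1, g2, g3, g4, g5, g6, g7, g8, g9,
      key a1, key a2, key a3, key a4, key a5, key a6, key a7, key a8, key a9, mul_neg, neg_mul,
      mul_smul_comm, smul_mul_assoc, mul_one, one_mul]
    module

/-- Summing the (k, l) entry of the average of the matrix unit Eₖₗ over k, l gives 4 plus terms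
±tr(Aₐ)tr(γₐ) = 0, so not all averages vanish. -/
theorem exists_intertwiner_ne_zero {A : Fin 3 → Matrix (Fin 2) (Fin 2) ℂ}
    (hA : ∀ a, (A a).trace = 0) :
    ∃ k l, intertwiner A (Matrix.single k l 1) ≠ 0 := by
  by_contra! h
  have h' : ∀ k l, intertwiner A (Matrix.single k l 1) k l = 0 := fun k l => by rw [h k l]; rfl
  have h0 := h' 0 0
  have h1 := h' 0 1
  have h2 := h' 1 0
  have h3 := h' 1 1
  have t := fun a => hA a
  simp only [Matrix.trace_fin_two] at t
  simp [intertwiner, Matrix.mul_apply, Fin.sum_univ_two, gam_zero, gam_one, gam_two,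
    Matrix.single_apply] at h0 h1 h2 h3
  have : (4 : ℂ) = 0 := by linear_combination h0 + h1 + h2 + h3
  norm_num at this

/-- The kernel of an intertwiner is stable under the γ-matrices, which act irreducibly on ℂ²: it is
zero or everything. -/
theorem isUnit_det_of_intertwining {A : Fin 3 → Matrix (Fin 2) (Fin 2) ℂ}
    {T : Matrix (Fin 2) (Fin 2) ℂ} (hT : ∀ b, T * gam b = A b * T) (h0 : T ≠ 0) : T.det ≠ 0 := by
  intro hdet
  obtain ⟨v, hv, hTv⟩ := Matrix.exists_mulVec_eq_zero_iff.2 hdet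
  have hk : ∀ b, T.mulVec ((gam b).mulVec v) = 0 := by
    intro b
    rw [Matrix.mulVec_mulVec, hT, ← Matrix.mulVec_mulVec, hTv, Matrix.mulVec_zero]
  have e : ∀ i, T i 0 * v 0 = 0 ∧ T i 1 * v 1 = 0 ∧ T i 0 * v 1 = 0 ∧ T i 1 * v 0 = 0 := by
    intro i
    have h1 := congrFun hTv i
    have h2 := congrFun (hk 0) i
    have h3 := congrFun (hk 1) i
    have h4 := congrFun (hk 2) i
    simp [Matrix.mulVec, dotProduct, Fin.sum_univ_two, gam_zero, gam_one, gam_two]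
      at h1 h2 h3 h4
    have h5 : T i 0 * v 0 - T i 1 * v 1 = 0 := by
      refine (mul_eq_zero.1 (?_ : Complex.I * _ = 0)).resolve_left Complex.I_ne_zero
      linear_combination h4
    refine ⟨?_, ?_, ?_, ?_⟩
    · linear_combination (h1 + h5) / 2
    · linear_combination (h1 - h5) / 2
    · linear_combination (h2 + h3) / 2
    · linear_combination (h2 - h3) / 2
  apply h0
  have hv' : v 0 ≠ 0 ∨ v 1 ≠ 0 := by
    by_contra! h
    exact hv (by ext i; fin_cases i; exacts [h.1, h.2])
  ext i j
  obtain ⟨h1, h2, h3, h4⟩ := e i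
  rcases hv' with h | h
  · fin_cases j
    exacts [(mul_eq_zero.1 h1).resolve_right h, (mul_eq_zero.1 h4).resolve_right h]
  · fin_cases j
    exacts [(mul_eq_zero.1 h3).resolve_right h, (mul_eq_zero.1 h2).resolve_right h]

theorem eq_scalar_of_commute {T : Matrix (Fin 2) (Fin 2) ℂ} (hT : ∀ b, T * gam b = gam b * T) :
    T = (T.trace / 2) • 1 := by
  have h0 := hT 0
  have h2 := hT 2
  rw [← Matrix.ext_iff] at h0 h2
  have a := h0 0 1
  have b := h2 0 1
  have c := h2 1 0
  simp [gam_zero, gam_two, Matrix.mul_apply, Fin.sum_univ_two] at a b c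
  have b' : T 0 1 = 0 := by
    refine (mul_eq_zero.1 (?_ : Complex.I * _ = 0)).resolve_left Complex.I_ne_zero
    linear_combination -b / 2
  have c' : T 1 0 = 0 := by
    refine (mul_eq_zero.1 (?_ : Complex.I * _ = 0)).resolve_left Complex.I_ne_zero
    linear_combination c / 2
  ext i j
  fin_cases i <;> fin_cases j <;> simp [Matrix.trace_fin_two, a, b', c']

end GammaMatrices

/-! ### The spin connection and its transformation law. -/

section SpinConnection

attribute [local instance] Matrix.linftyOpNormedRing Matrix.linftyOpNormedAlgebra

local instance (priority := 10000) : TopologicalSpace (Matrix (Fin 2) (Fin 2) ℂ) :=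
  (Matrix.linftyOpNormedRing (n := Fin 2) (α := ℂ)).toMetricSpace.toPseudoMetricSpace.toUniformSpace.toTopologicalSpace

variable {M : Type*} [TopologicalSpace M] [ChartedSpace E3 M] [IsManifold (𝓡 3) ∞ M]
  {G : LorentzianMetric M} {U U' : Set M} {e e' : Fin 3 → VField M} {x : M} {X : VField M}

/-- The spin representation of an infinitesimal Lorentz transformation. -/
def spinRep (Γ : Fin 3 → Fin 3 → ℝ) : Matrix (Fin 2) (Fin 2) ℂ :=
  ∑ a, ∑ b, ((1 / 4 * (sgn a * sgn b) * Γ a b : ℝ) : ℂ) • (gam a * gam b)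

theorem spinRep_eq {Γ : Fin 3 → Fin 3 → ℝ} (hΓ : ∀ a b, Γ a b = - Γ b a) :
    spinRep Γ = (Complex.I / 2) • (-(Γ 0 1 : ℂ) • gam 2 + (Γ 0 2 : ℂ) • gam 1
      - (Γ 1 2 : ℂ) • gam 0) := by
  obtain ⟨g1, g2, g3, g4, g5, g6, g7, g8, g9⟩ := gammaRelations_gam
  have s0 : sgn 0 = -1 := rfl
  have s1 : sgn 1 = 1 := rfl
  have s2 : sgn 2 = 1 := rfl
  have h0 : ∀ a, Γ a a = 0 := fun a => by linarith [hΓ a a]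
  simp only [spinRep, Fin.sum_univ_three, s0, s1, s2, g1, g2, g3, g4, g5, g6, g7, g8, g9, h0,
    hΓ 1 0, hΓ 2 0, hΓ 2 1]
  push_cast
  module

/-- This identifies `spinRep` as the lift of so(1,2): its commutator with Clifford multiplication is
the vector action. -/
theorem spinRep_commutator {Γ : Fin 3 → Fin 3 → ℝ} (hΓ : ∀ a b, Γ a b = - Γ b a) (c : Fin 3) :
    spinRep Γ * gam c - gam c * spinRep Γ = ∑ b, ((sgn b * Γ c b : ℝ) : ℂ) • gam b := by
  obtain ⟨g1, g2, g3, g4, g5, g6, g7, g8, g9⟩ := gammaRelations_gam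
  have s0 : sgn 0 = -1 := rfl
  have s1 : sgn 1 = 1 := rfl
  have s2 : sgn 2 = 1 := rfl
  have h0 : ∀ a, Γ a a = 0 := fun a => by linarith [hΓ a a]
  have hI : Complex.I / 2 * Complex.I = -1 / 2 := by
    linear_combination (1 / 2 : ℂ) * Complex.I_mul_I
  rw [spinRep_eq hΓ]
  fin_cases c <;>
  · simp only [Fin.zero_eta, Fin.mk_one, Fin.reduceFinMk, Fin.sum_univ_three, s0, s1, s2, h0,
      hΓ 1 0, hΓ 2 0, hΓ 2 1, smul_mul_assoc, mul_smul_comm, add_mul, sub_mul, mul_add, mul_sub, g1,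
      g2, g3, g4, g5, g6, g7, g8, g9, smul_add, smul_sub, smul_neg, smul_smul]
    push_cast
    have hI2 : Complex.I ^ 2 = -1 := Complex.I_sq
    match_scalars <;> ring_nf <;> simp only [hI2] <;> ring

theorem trace_spinRep {Γ : Fin 3 → Fin 3 → ℝ} (hΓ : ∀ a b, Γ a b = - Γ b a) :
    (spinRep Γ).trace = 0 := by
  rw [spinRep_eq hΓ, gam_zero, gam_one, gam_two]
  simp [Matrix.trace_fin_two]

namespace OrthoFrame

variable (hE : OrthoFrame G U e)
include hE

theorem nabla_frame_eq (hx : x ∈ U) (hX : X.DiffAt x) (a : Fin 3) :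
    nabla G.form X (e a) x = ∑ c, coord G.form e x (X x) c • nabla G.form (e c) (e a) x := by
  have hT := G.tensorialAt_nabla (hE.diffAt hx a)
  obtain ⟨T, h1⟩ : ∃ T : TangentSpace (𝓡 3) x →L[ℝ] TangentSpace (𝓡 3) x, ∀ X : VField M,
      X.DiffAt x → nabla G.form X (e a) x = T (X x) :=
    ⟨_, fun X hX => (TensorialAt.mkHom_apply hT hX).symm⟩
  rw [h1 X hX]
  conv_lhs => rw [hE.expand hx (X x)]
  simp only [map_sum, map_smul, ← h1 _ (hE.diffAt hx _)]

theorem spinConn_apply (hx : x ∈ U) (hX : X.DiffAt x) : spinConn G.form e x (X x)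
    = spinRep fun a b => G.form x (nabla G.form X (e a) x) (e b x) := by
  simp only [spinConn, spinRep, hE.nabla_frame_eq hx hX, map_sum, map_smul, sum_apply, smul_apply,
    smul_eq_mul, Finset.mul_sum, Complex.ofReal_sum, Finset.sum_smul]
  rw [Finset.sum_comm]
  refine Finset.sum_congr rfl fun a _ => ?_
  rw [Finset.sum_comm]
  refine Finset.sum_congr rfl fun b _ => Finset.sum_congr rfl fun c _ => ?_
  congr 2
  ring

theorem form_nabla_antisymm (hx : x ∈ U) (hX : X.DiffAt x) (a b : Fin 3) :
    G.form x (nabla G.form X (e a) x) (e b x) = - G.form x (nabla G.form X (e b) x) (e a x) := by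
  have h := G.dirDeriv_form hX (hE.diffAt hx a) (hE.diffAt hx b)
  rw [dirDeriv_eq_zero (c := if a = b then sgn a else 0), G.symm x (e a x)] at h
  · linarith
  · filter_upwards [hE.isOpen.mem_nhds hx] with y hy using hE.ortho y hy a b

end OrthoFrame

theorem cliff_add (G : LorentzianMetric M) (e : Fin 3 → VField M) (v w : TangentSpace (𝓡 3) x) :
    cliff G.form e x (v + w) = cliff G.form e x v + cliff G.form e x w := by
  simp only [cliff, coord, map_add, add_apply, ← Finset.sum_add_distrib]
  refine Finset.sum_congr rfl fun a _ => ?_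
  push_cast
  module

theorem cliff_smul (G : LorentzianMetric M) (e : Fin 3 → VField M) (c : ℝ)
    (v : TangentSpace (𝓡 3) x) : cliff G.form e x (c • v) = (c : ℂ) • cliff G.form e x v := by
  simp only [cliff, coord, map_smul, smul_apply, smul_eq_mul, Finset.smul_sum]
  refine Finset.sum_congr rfl fun a _ => ?_
  push_cast
  module

theorem OrthoFrame.cliff_frame (hE : OrthoFrame G U e) (hx : x ∈ U) (b : Fin 3) :
    cliff G.form e x (e b x) = gam b := by
  have s0 : sgn 0 = -1 := rfl
  have s1 : sgn 1 = 1 := rfl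
  have s2 : sgn 2 = 1 := rfl
  simp only [cliff, coord, hE.ortho x hx, Fin.sum_univ_three]
  fin_cases b <;> simp [s0, s1, s2]

theorem IsSpinLift.mul_cliff (hE' : OrthoFrame G U' e') (hx' : x ∈ U')
    {s : Matrix (Fin 2) (Fin 2) ℂ}
    (hs : IsSpinLift s (Matrix.of fun a b => coord G.form e x (e' b x) a))
    (v : TangentSpace (𝓡 3) x) : s * cliff G.form e' x v = cliff G.form e x v * s := by
  have h : ∀ b, s * gam b = cliff G.form e x (e' b x) * s := hs.2
  have hv := hE'.expand hx' v
  rw [Fin.sum_univ_three] at hv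
  rw [hv]
  simp only [cliff_add, cliff_smul, hE'.cliff_frame hx', mul_add, add_mul, mul_smul_comm,
    smul_mul_assoc, h]

/-- The entries of a matrix, as continuous linear maps. -/
def entryCLM (k l : Fin 2) : Matrix (Fin 2) (Fin 2) ℂ →L[ℝ] ℂ :=
  LinearMap.toContinuousLinearMap (Matrix.entryLinearMap ℝ ℂ k l)

/-- Jacobi's formula for the derivative of a constant determinant: s⁻¹ds lies in sl₂. -/
theorem trace_adjugate_mul_mvfderiv {s : M → Matrix (Fin 2) (Fin 2) ℂ}
    (hs : MDifferentiableAt (𝓡 3) 𝓘(ℝ, Matrix (Fin 2) (Fin 2) ℂ) s x)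
    (hdet : ∀ᶠ y in 𝓝 x, (s y).det = 1) (v : TangentSpace (𝓡 3) x) :
    ((s x).adjugate * mvfderiv (𝓡 3) s x v).trace = 0 := by
  have hd : ∀ k l, MDifferentiableAt (𝓡 3) 𝓘(ℝ, ℂ) (fun y => s y k l) x := fun k l =>
    (entryCLM k l).differentiableAt.comp_mdifferentiableAt hs
  have hm : ∀ k l, mvfderiv (𝓡 3) (fun y => s y k l) x v = mvfderiv (𝓡 3) s x v k l := fun k l =>
    mvfderiv_clm_comp (entryCLM k l) hs v
  have h1 : mvfderiv (𝓡 3) (fun y => s y 0 0 * s y 1 1 - s y 0 1 * s y 1 0) x v = 0 := by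
    have h2 : (fun y => s y 0 0 * s y 1 1 - s y 0 1 * s y 1 0) =ᶠ[𝓝 x] fun _ => (1 : ℂ) := by
      filter_upwards [hdet] with y hy
      rw [← hy, Matrix.det_fin_two]
    have h3 := congrArg (fun T : TangentSpace (𝓡 3) x →L[ℝ] ℂ => T v) (Filter.EventuallyEq.mfderiv_eq (I := 𝓡 3) (I' := 𝓘(ℝ, ℂ)) h2)
    refine h3.trans ?_
    have h4 : mvfderiv (𝓡 3) (fun _ : M => (1 : ℂ)) x = 0 := mvfderiv_const _
    exact congrArg (fun T : TangentSpace (𝓡 3) x →L[ℝ] ℂ => T v) h4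
  have h5 := mvfderiv_fun_sub (I := 𝓡 3) (x := x) (g := fun y => s y 0 0 * s y 1 1)
    (g' := fun y => s y 0 1 * s y 1 0) ((hd 0 0).mul (hd 1 1)) ((hd 0 1).mul (hd 1 0))
  rw [h5] at h1
  rw [sub_apply, mvfderiv_algebra_mul (hd 0 0) (hd 1 1), mvfderiv_algebra_mul (hd 0 1) (hd 1 0), hm,
    hm, hm, hm] at h1
  rw [Matrix.adjugate_fin_two, Matrix.trace_fin_two]
  simp only [Matrix.mul_apply, Fin.sum_univ_two, Matrix.of_apply, Matrix.cons_val', Matrix.cons_val_zero,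
    Matrix.cons_val_one, Matrix.cons_val_fin_one]
  linear_combination h1

/-- Clifford multiplication is parallel: its covariant derivative by the spin connection is Clifford
multiplication by ∇Y. -/
theorem mvfderiv_cliff (hE : OrthoFrame G U e) (hx : x ∈ U) (hX : X.DiffAt x) {Y : VField M}
    (hY : Y.DiffAt x) :
    MDifferentiableAt (𝓡 3) 𝓘(ℝ, Matrix (Fin 2) (Fin 2) ℂ) (fun y => cliff G.form e y (Y y)) x ∧
    mvfderiv (𝓡 3) (fun y => cliff G.form e y (Y y)) x (X x)
      = cliff G.form e x (nabla G.form X Y x)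
        - (spinConn G.form e x (X x) * cliff G.form e x (Y x)
          - cliff G.form e x (Y x) * spinConn G.form e x (X x)) := by
  let L : Fin 3 → ℝ →L[ℝ] Matrix (Fin 2) (Fin 2) ℂ := fun a =>
    (ContinuousLinearMap.id ℝ ℝ).smulRight (sgn a • gam a)
  have hL : ∀ a t, L a t = ((sgn a * t : ℝ) : ℂ) • gam a := by
    intro a t
    change t • sgn a • gam a = _
    rw [smul_smul, mul_comm]
    rfl
  have hf := fun a => G.fdiffAt_apply hY (hE.diffAt hx a)
  have hd : ∀ a, MDifferentiableAt (𝓡 3) 𝓘(ℝ, Matrix (Fin 2) (Fin 2) ℂ)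
      (fun y => L a (G.form y (Y y) (e a y))) x := fun a =>
    (L a).differentiableAt.comp_mdifferentiableAt (hf a)
  have hm : ∀ a, mvfderiv (𝓡 3) (fun y => L a (G.form y (Y y) (e a y))) x (X x)
      = L a (G.form x (nabla G.form X Y x) (e a x) + G.form x (Y x) (nabla G.form X (e a) x)) := by
    intro a
    rw [mvfderiv_clm_comp (L a) (hf a), ← G.dirDeriv_form hX hY (hE.diffAt hx a)]
    rfl
  have heq : (fun y => cliff G.form e y (Y y)) = fun y => L 0 (G.form y (Y y) (e 0 y))
      + L 1 (G.form y (Y y) (e 1 y)) + L 2 (G.form y (Y y) (e 2 y)) := by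
    funext y
    simp only [cliff, coord, Fin.sum_univ_three, hL]
  have hΓ := hE.form_nabla_antisymm hx hX
  refine ⟨heq ▸ ((hd 0).add (hd 1)).add (hd 2), ?_⟩
  have h01 := mvfderiv_fun_add (I := 𝓡 3) (x := x)
    (g := fun y => L 0 (G.form y (Y y) (e 0 y))) (g' := fun y => L 1 (G.form y (Y y) (e 1 y)))
    (hd 0) (hd 1)
  have h012 := mvfderiv_fun_add (I := 𝓡 3) (x := x)
    (g := fun y => L 0 (G.form y (Y y) (e 0 y)) + L 1 (G.form y (Y y) (e 1 y)))
    (g' := fun y => L 2 (G.form y (Y y) (e 2 y))) ((hd 0).add (hd 1)) (hd 2)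
  rw [heq, h012, add_apply, h01, add_apply, hm, hm, hm, hE.spinConn_apply hx hX]
  have hcom := spinRep_commutator hΓ
  have hexp : ∀ a, G.form x (Y x) (nabla G.form X (e a) x)
      = - ∑ c, coord G.form e x (Y x) c * G.form x (nabla G.form X (e c) x) (e a x) := by
    intro a
    conv_lhs => rw [hE.expand hx (Y x)]
    simp only [map_sum, map_smul, sum_apply, smul_apply, smul_eq_mul, ← Finset.sum_neg_distrib]
    refine Finset.sum_congr rfl fun c _ => ?_
    rw [G.symm x (e c x), hΓ a c]
    ring
  set Γ : Fin 3 → Fin 3 → ℝ := fun a b => G.form x (nabla G.form X (e a) x) (e b x) with hΓd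
  have hc2 : spinRep Γ * cliff G.form e x (Y x) - cliff G.form e x (Y x) * spinRep Γ
      = ∑ c, (coord G.form e x (Y x) c : ℂ) • ∑ b, ((sgn b * Γ c b : ℝ) : ℂ) • gam b := by
    rw [cliff, Finset.mul_sum, Finset.sum_mul, ← Finset.sum_sub_distrib]
    refine Finset.sum_congr rfl fun c _ => ?_
    rw [← hcom, mul_smul_comm, smul_mul_assoc, smul_sub]
  rw [hc2, hexp, hexp, hexp]
  simp only [hL, cliff, coord, Fin.sum_univ_three, hΓd]
  push_cast
  module

/-- The transformation law of the spin connection under a change of frame. -/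
theorem mvfderiv_spinLift (hE : OrthoFrame G U e) (hE' : OrthoFrame G U' e') (hx : x ∈ U)
    (hx' : x ∈ U') {s : M → Matrix (Fin 2) (Fin 2) ℂ}
    (hs : MDifferentiableAt (𝓡 3) 𝓘(ℝ, Matrix (Fin 2) (Fin 2) ℂ) s x)
    (hlift : ∀ᶠ y in 𝓝 x,
      IsSpinLift (s y) (Matrix.of fun a b => coord G.form e y (e' b y) a))
    (v : TangentSpace (𝓡 3) x) : mvfderiv (𝓡 3) s x v
      = s x * spinConn G.form e' x v - spinConn G.form e x v * s x := by
  obtain ⟨X, hX, rfl⟩ : ∃ X : VField M, X.DiffAt x ∧ X x = v :=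
    ⟨FiberBundle.extend E3 v, FiberBundle.mdifferentiableAt_extend (𝓡 3) E3 v,
      FiberBundle.extend_apply_self ..⟩
  have hsx := hlift.self_of_nhds
  have hadj : (s x).adjugate * s x = 1 := by rw [Matrix.adjugate_mul, hsx.1, one_smul]
  have hadj' : s x * (s x).adjugate = 1 := by rw [Matrix.mul_adjugate, hsx.1, one_smul]
  have hc : ∀ v, s x * cliff G.form e' x v = cliff G.form e x v * s x := hsx.mul_cliff hE' hx'
  set ds := mvfderiv (𝓡 3) s x (X x) with hds
  set P := spinConn G.form e x (X x) with hP
  set Q := spinConn G.form e' x (X x) with hQ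
  have hPtr : P.trace = 0 := by
    rw [hP, hE.spinConn_apply hx hX]
    exact trace_spinRep (hE.form_nabla_antisymm hx hX)
  have hQtr : Q.trace = 0 := by
    rw [hQ, hE'.spinConn_apply hx' hX]
    exact trace_spinRep (hE'.form_nabla_antisymm hx' hX)
  have hQc : ∀ b, Q * gam b - gam b * Q = cliff G.form e' x (nabla G.form X (e' b) x) := by
    intro b
    rw [hQ, hE'.spinConn_apply hx' hX, spinRep_commutator (hE'.form_nabla_antisymm hx' hX)]
    rfl
  have hder : ∀ b, ds * gam b = cliff G.form e x (e' b x) * ds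
      + (cliff G.form e x (nabla G.form X (e' b) x)
        - (P * cliff G.form e x (e' b x) - cliff G.form e x (e' b x) * P)) * s x := by
    intro b
    obtain ⟨hd, hm⟩ := mvfderiv_cliff hE hx hX (hE'.diffAt hx' b)
    rw [← hm, ← mvfderiv_algebra_mul hd hs]
    have h1 : (fun y => s y * gam b) =ᶠ[𝓝 x] fun y => cliff G.form e y (e' b y) * s y := by
      filter_upwards [hlift] with y hy using hy.2 b
    have h2 := congrArg (fun T : TangentSpace (𝓡 3) x →L[ℝ] Matrix (Fin 2) (Fin 2) ℂ => T (X x))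
      (Filter.EventuallyEq.mfderiv_eq (I := 𝓡 3) (I' := 𝓘(ℝ, Matrix (Fin 2) (Fin 2) ℂ)) h1)
    refine Eq.trans ?_ h2
    have h3 := mvfderiv_algebra_mul hs
      (mdifferentiableAt_const : MDifferentiableAt (𝓡 3) 𝓘(ℝ, Matrix (Fin 2) (Fin 2) ℂ)
        (fun _ : M => gam b) x) (X x)
    have h4 : mvfderiv (𝓡 3) (fun _ : M => gam b) x (X x) = 0 :=
      congrArg (fun T : TangentSpace (𝓡 3) x →L[ℝ] Matrix (Fin 2) (Fin 2) ℂ => T (X x))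
        (mvfderiv_const _ : mvfderiv (𝓡 3) (fun _ : M => gam b) x = 0)
    rw [h4, mul_zero, zero_add] at h3
    exact h3.symm
  -- `W` measures the failure of the transformation law. Differentiating the lift relation shows
  -- that it intertwines like `s`, so s⁻¹W commutes with the γ-matrices and is scalar; being
  -- traceless as well, it vanishes.
  set W := ds + P * s x - s x * Q with hW
  have hWc : ∀ b, W * gam b = cliff G.form e x (e' b x) * W := by
    intro b
    have h1 : s x * gam b = cliff G.form e x (e' b x) * s x := hsx.2 b
    have h2 := hc (nabla G.form X (e' b) x)
    have h3 := hQc b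
    rw [← sub_eq_zero] at h3
    rw [hW, sub_mul, add_mul, hder b, mul_sub, mul_add, mul_assoc P, h1, ← mul_assoc _ (s x) Q, ← h1,
      sub_mul (cliff G.form e x (nabla G.form X (e' b) x)), ← h2]
    have h4 : s x * (Q * gam b - gam b * Q - cliff G.form e' x (nabla G.form X (e' b) x)) = 0 := by
      rw [h3, mul_zero]
    rw [← sub_eq_zero, ← neg_eq_zero, ← h4]
    noncomm_ring
    rw [h1]
    abel
  have hT : ∀ b, (s x).adjugate * W * gam b = gam b * ((s x).adjugate * W) := by
    intro b
    have h1 : s x * gam b = cliff G.form e x (e' b x) * s x := hsx.2 b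
    have h2 : gam b * (s x).adjugate = (s x).adjugate * cliff G.form e x (e' b x) := by
      calc gam b * (s x).adjugate = (s x).adjugate * (s x * gam b) * (s x).adjugate := by
            rw [← mul_assoc (s x).adjugate, hadj, one_mul]
        _ = _ := by rw [h1, mul_assoc, mul_assoc, hadj', mul_one]
    rw [mul_assoc, hWc, ← mul_assoc, ← h2, mul_assoc]
  have htr : ((s x).adjugate * W).trace = 0 := by
    rw [hW, mul_sub, mul_add, Matrix.trace_sub, Matrix.trace_add,
      trace_adjugate_mul_mvfderiv hs (hlift.mono fun y hy => hy.1), Matrix.trace_mul_comm _ (P * s x),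
      mul_assoc, hadj', mul_one, hPtr, ← mul_assoc, hadj, one_mul, hQtr]
    simp
  have h0 := eq_scalar_of_commute hT
  rw [htr, zero_div, zero_smul] at h0
  have hW0 : W = 0 := by
    rw [← one_mul W, ← hadj', mul_assoc, h0, mul_zero]
  rw [hW] at hW0
  rw [sub_eq_zero] at hW0
  rw [← hW0, add_sub_cancel_right]

end SpinConnection

/-! ### Transition matrices between orthonormal frames. -/

section Transition

variable {M : Type*} [TopologicalSpace M] [ChartedSpace E3 M] [IsManifold (𝓡 3) ∞ M]
  {G : LorentzianMetric M} {S : LorentzianSasakian M} {U U' : Set M} {e e' : Fin 3 → VField M} {x : M}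

theorem sgn_mul_self (a : Fin 3) : sgn a * sgn a = 1 := by
  fin_cases a <;> simp [sgn]

theorem OrthoFrame.sum_coord_mul_coord (hE : OrthoFrame G U e) (hE' : OrthoFrame G U' e')
    (hx : x ∈ U) (hx' : x ∈ U') (a b : Fin 3) :
    ∑ c, sgn c * coord G.form e x (e' a x) c * coord G.form e x (e' b x) c
      = if a = b then sgn a else 0 := by
  rw [← hE'.ortho x hx' a b]
  conv_rhs => rw [hE.expand hx (e' b x)]
  simp only [map_sum, map_smul, smul_eq_mul]
  refine Finset.sum_congr rfl fun c _ => ?_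
  simp only [coord]
  linear_combination (G.form x (e' a x) (e c x) * sgn c * G.form x (e' b x) (e c x)) * sgn_mul_self c

theorem det_sq_of_lorentz {L : Matrix (Fin 3) (Fin 3) ℝ}
    (h : ∀ a b, ∑ c, sgn c * L c a * L c b = if a = b then sgn a else 0) : L.det ^ 2 = 1 := by
  have h1 : L.transpose * (Matrix.diagonal sgn * L) = Matrix.diagonal sgn := by
    ext a b
    rw [Matrix.diagonal_apply, ← h a b, Matrix.mul_apply]
    refine Finset.sum_congr rfl fun c _ => ?_
    rw [Matrix.diagonal_mul, Matrix.transpose_apply]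
    ring
  have h2 := congrArg Matrix.det h1
  rw [Matrix.det_mul, Matrix.det_mul, Matrix.det_transpose, Matrix.det_diagonal,
    Fin.prod_univ_three] at h2
  simp only [show sgn 0 = -1 from rfl, show sgn 1 = 1 from rfl, show sgn 2 = 1 from rfl] at h2
  linarith

/-- Orthogonality gives det² = 1; written in the adapted frame, the orientation expression is the
determinant itself, so its positivity selects +1. -/
theorem AdaptedFrame.det_coord (hA : AdaptedFrame S U' e') (hE : OrthoFrame S.metric U e)
    (hx : x ∈ U) (hx' : x ∈ U')
    (hor : 0 < S.eta x (e 0 x) * S.metric.form x (e 1 x) (S.phi x (e 2 x))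
      + S.eta x (e 1 x) * S.metric.form x (e 2 x) (S.phi x (e 0 x))
      + S.eta x (e 2 x) * S.metric.form x (e 0 x) (S.phi x (e 1 x))) :
    (Matrix.of fun a b => coord S.metric.form e x (e' b x) a).det = 1 := by
  have hphi : ∀ v w : TangentSpace (𝓡 3) x, S.metric.form x v (S.phi x w)
      = S.metric.form x w (e' 2 x) * S.metric.form x v (e' 1 x)
        - S.metric.form x w (e' 1 x) * S.metric.form x v (e' 2 x) := by
    intro v w
    conv_lhs => rw [hA.expand hx' w]
    simp only [Fin.sum_univ_three, map_add, map_smul, hA.zero x hx', S.phi_xi, hA.phi_one x hx',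
      hA.phi_two x hx', map_neg, map_zero, smul_eq_mul, coord,
      show sgn 1 = 1 from rfl, show sgn 2 = 1 from rfl]
    ring
  rw [hphi, hphi, hphi, hA.eta_eq hx', hA.eta_eq hx', hA.eta_eq hx'] at hor
  have hsq := det_sq_of_lorentz (L := Matrix.of fun a b => coord S.metric.form e x (e' b x) a)
    fun a b => hE.sum_coord_mul_coord hA.toOrthoFrame hx hx' a b
  have hpos : 0 < (Matrix.of fun a b => coord S.metric.form e x (e' b x) a).det := by
    rw [Matrix.det_fin_three]
    simp only [Matrix.of_apply, coord, show sgn 0 = -1 from rfl, show sgn 1 = 1 from rfl,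
      show sgn 2 = 1 from rfl, S.metric.symm x (e' _ x)]
    linarith
  nlinarith

end Transition

/-! ### Lifting to the spin group. -/

section Lift

attribute [local instance] Matrix.linftyOpNormedRing Matrix.linftyOpNormedAlgebra

local instance (priority := 10000) : TopologicalSpace (Matrix (Fin 2) (Fin 2) ℂ) :=
  (Matrix.linftyOpNormedRing (n := Fin 2) (α := ℂ)).toMetricSpace.toPseudoMetricSpace.toUniformSpace.toTopologicalSpace

namespace IsSpinLift

variable {s s' : Matrix (Fin 2) (Fin 2) ℂ} {L : Matrix (Fin 3) (Fin 3) ℝ}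

theorem neg (h : IsSpinLift s L) : IsSpinLift (-s) L := by
  refine ⟨by rw [Matrix.det_neg, h.1]; simp, fun b => ?_⟩
  rw [neg_mul, h.2, mul_neg]

theorem ne_zero (h : IsSpinLift s L) : s ≠ 0 := by
  rintro rfl
  have := h.1
  simp at this

/-- By Schur's lemma s⁻¹s' is a scalar c, and the determinants give c² = 1. -/
theorem eq_or_eq_neg (h : IsSpinLift s L) (h' : IsSpinLift s' L) : s' = s ∨ s' = -s := by
  have hadj : s.adjugate * s = 1 := by rw [Matrix.adjugate_mul, h.1, one_smul]
  have hadj' : s * s.adjugate = 1 := by rw [Matrix.mul_adjugate, h.1, one_smul]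
  have hT : ∀ b, s.adjugate * s' * gam b = gam b * (s.adjugate * s') := by
    intro b
    calc s.adjugate * s' * gam b = s.adjugate * ((∑ a, (L a b : ℂ) • gam a) * (s * s.adjugate)) * s' := by
          rw [hadj', mul_one, mul_assoc, h'.2, mul_assoc]
      _ = s.adjugate * ((∑ a, (L a b : ℂ) • gam a) * s) * (s.adjugate * s') := by
          simp only [mul_assoc]
      _ = _ := by rw [← h.2, ← mul_assoc s.adjugate, hadj, one_mul]
  have h1 := eq_scalar_of_commute hT
  set c := (s.adjugate * s').trace / 2
  have h2 : s' = c • s := by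
    rw [← one_mul s', ← hadj', mul_assoc, h1, mul_smul_comm, mul_one]
  have h3 := h'.1
  rw [h2, Matrix.det_smul, h.1, mul_one, Fintype.card_fin] at h3
  rcases (sq_eq_sq_iff_eq_or_eq_neg.1 (h3.trans (one_pow 2).symm)) with h4 | h4
  · exact Or.inl (by rw [h2, h4, one_smul])
  · exact Or.inr (by rw [h2, h4, neg_one_smul])

end IsSpinLift

/-- The sign is locally constant: whichever of s' + s and s - s' is nonzero at `x` remains nonzero
nearby. -/
theorem eventually_eq_or_eq_neg {X : Type*} [TopologicalSpace X]
    {s s' : X → Matrix (Fin 2) (Fin 2) ℂ} {L : X → Matrix (Fin 3) (Fin 3) ℝ} {x : X}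
    (hs : ContinuousAt s x) (hs' : ContinuousAt s' x)
    (h : ∀ᶠ y in 𝓝 x, IsSpinLift (s y) (L y)) (h' : ∀ᶠ y in 𝓝 x, IsSpinLift (s' y) (L y)) :
    (∀ᶠ y in 𝓝 x, s' y = s y) ∨ ∀ᶠ y in 𝓝 x, s' y = - s y := by
  have h0 := h.self_of_nhds
  have key : ∀ m : Matrix (Fin 2) (Fin 2) ℂ, m ≠ 0 → m + m ≠ 0 := fun m hm h => hm (by
    rw [← two_smul ℂ, smul_eq_zero] at h
    exact h.resolve_left two_ne_zero)
  rcases h0.eq_or_eq_neg h'.self_of_nhds with h1 | h1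
  · left
    have h2 : ∀ᶠ y in 𝓝 x, s' y + s y ≠ 0 :=
      (hs'.add hs).eventually_ne (by rw [Pi.add_apply, h1]; exact key _ h0.ne_zero)
    filter_upwards [h, h', h2] with y hy hy' hy2
    exact (hy.eq_or_eq_neg hy').resolve_right fun h3 => hy2 (by rw [h3, neg_add_cancel])
  · right
    have h2 : ∀ᶠ y in 𝓝 x, s y - s' y ≠ 0 :=
      (hs.sub hs').eventually_ne (by rw [Pi.sub_apply, h1, sub_neg_eq_add]; exact key _ h0.ne_zero)
    filter_upwards [h, h', h2] with y hy hy' hy2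
    exact (hy.eq_or_eq_neg hy').resolve_left fun h3 => hy2 (by rw [h3, sub_self])

/-- A smooth local square root of a nonzero complex number. -/
theorem exists_smooth_sqrt {d₀ : ℂ} (h0 : d₀ ≠ 0) : ∃ N : Set ℂ, IsOpen N ∧ d₀ ∈ N ∧ ∃ q : ℂ → ℂ,
    ContDiffOn ℝ ∞ q N ∧ ∀ d ∈ N, q d ^ 2 = d ∧ q d ≠ 0 := by
  obtain ⟨w, hw⟩ := IsAlgClosed.exists_pow_nat_eq d₀ (n := 2) two_pos
  have hw0 : w ≠ 0 := by
    rintro rfl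
    exact h0 (by rw [← hw]; simp)
  refine ⟨(fun d => d / d₀) ⁻¹' Complex.slitPlane,
    Complex.isOpen_slitPlane.preimage (continuous_id.div_const _), ?_,
    -- Dividing by `d₀` moves the base point to 1, where the principal logarithm is smooth.
    fun d => w * Complex.exp (Complex.log (d / d₀) / 2), ?_, ?_⟩
  · rw [Set.mem_preimage, div_self h0]
    exact Complex.one_mem_slitPlane
  · intro d hd
    have h1 : ContDiffAt ℂ ∞ (fun d => w * Complex.exp (Complex.log (d / d₀) / 2)) d :=
      contDiffAt_const.mul (((Complex.contDiffAt_log hd).comp d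
        (contDiffAt_id.div_const d₀)).div_const 2).cexp
    exact (h1.restrict_scalars ℝ).contDiffWithinAt
  · intro d hd
    have h1 : d / d₀ ≠ 0 := Complex.slitPlane_ne_zero hd
    refine ⟨?_, mul_ne_zero hw0 (Complex.exp_ne_zero _)⟩
    rw [mul_pow, ← Complex.exp_nat_mul, hw, Nat.cast_ofNat, mul_div_cancel₀ _ two_ne_zero,
      Complex.exp_log h1, mul_div_cancel₀ _ h0]

variable {M : Type*} [TopologicalSpace M] [ChartedSpace E3 M] [IsManifold (𝓡 3) ∞ M]

theorem contMDiffOn_matrix_mul {f g : M → Matrix (Fin 2) (Fin 2) ℂ} {U : Set M}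
    (hf : ContMDiffOn (𝓡 3) 𝓘(ℝ, Matrix (Fin 2) (Fin 2) ℂ) ∞ f U)
    (hg : ContMDiffOn (𝓡 3) 𝓘(ℝ, Matrix (Fin 2) (Fin 2) ℂ) ∞ g U) :
    ContMDiffOn (𝓡 3) 𝓘(ℝ, Matrix (Fin 2) (Fin 2) ℂ) ∞ (fun y => f y * g y) U :=
  (contDiff_mul (𝕜 := ℝ) (𝔸 := Matrix (Fin 2) (Fin 2) ℂ)).contMDiff.comp_contMDiffOn (hf.prodMk_space hg)

theorem contMDiffOn_smul_const {f : M → ℂ} {U : Set M} (hf : ContMDiffOn (𝓡 3) 𝓘(ℝ, ℂ) ∞ f U)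
    (m : Matrix (Fin 2) (Fin 2) ℂ) :
    ContMDiffOn (𝓡 3) 𝓘(ℝ, Matrix (Fin 2) (Fin 2) ℂ) ∞ (fun y => f y • m) U := by
  let T : ℂ →L[ℝ] Matrix (Fin 2) (Fin 2) ℂ :=
    LinearMap.toContinuousLinearMap ((LinearMap.toSpanSingleton ℂ _ m).restrictScalars ℝ)
  exact T.contDiff.contMDiff.comp_contMDiffOn hf

theorem contMDiffOn_matrix {f : M → Matrix (Fin 2) (Fin 2) ℂ} {U : Set M}
    (hf : ∀ k l, ContMDiffOn (𝓡 3) 𝓘(ℝ, ℂ) ∞ (fun y => f y k l) U) :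
    ContMDiffOn (𝓡 3) 𝓘(ℝ, Matrix (Fin 2) (Fin 2) ℂ) ∞ f U := by
  have h : f = fun y => (f y 0 0 • Matrix.single 0 0 1 + f y 0 1 • Matrix.single 0 1 1)
      + (f y 1 0 • Matrix.single 1 0 1 + f y 1 1 • Matrix.single 1 1 1) := by
    funext y
    ext i j
    fin_cases i <;> fin_cases j <;> simp
  rw [h]
  have h1 := fun k l => contMDiffOn_smul_const (hf k l) (Matrix.single k l 1)
  exact ((h1 0 0).add (h1 0 1)).add ((h1 1 0).add (h1 1 1))

theorem contDiff_matrix_det : ContDiff ℝ ∞ (Matrix.det : Matrix (Fin 2) (Fin 2) ℂ → ℂ) := by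
  have h : (Matrix.det : Matrix (Fin 2) (Fin 2) ℂ → ℂ) = fun m =>
      entryCLM 0 0 m * entryCLM 1 1 m - entryCLM 0 1 m * entryCLM 1 0 m := by
    funext m
    exact Matrix.det_fin_two m
  rw [h]
  exact ((entryCLM 0 0).contDiff.mul (entryCLM 1 1).contDiff).sub
    ((entryCLM 0 1).contDiff.mul (entryCLM 1 0).contDiff)

theorem OrthoFrame.contMDiffOn_cliff {G : LorentzianMetric M} {U V : Set M} {e : Fin 3 → VField M}
    (hE : OrthoFrame G U e) {X : VField M} (hX : X.SmoothOn V) :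
    ContMDiffOn (𝓡 3) 𝓘(ℝ, Matrix (Fin 2) (Fin 2) ℂ) ∞ (fun y => cliff G.form e y (X y)) (U ∩ V) := by
  have h : ∀ a, ContMDiffOn (𝓡 3) 𝓘(ℝ, Matrix (Fin 2) (Fin 2) ℂ) ∞
      (fun y => ((sgn a * G.form y (X y) (e a y) : ℝ) : ℂ) • gam a) (U ∩ V) := fun a =>
    contMDiffOn_smul_const ((Complex.ofRealCLM.contDiff.contMDiff.comp_contMDiffOn
      (((contDiff_const (c := sgn a)).mul contDiff_id).contMDiff.comp_contMDiffOn
        (G.contMDiffOn_apply (hX.mono Set.inter_subset_right)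
          ((hE.smooth a).mono Set.inter_subset_left))))) _
  have h2 : (fun y => cliff G.form e y (X y)) = fun y =>
      ((sgn 0 * G.form y (X y) (e 0 y) : ℝ) : ℂ) • gam 0
      + ((sgn 1 * G.form y (X y) (e 1 y) : ℝ) : ℂ) • gam 1
      + ((sgn 2 * G.form y (X y) (e 2 y) : ℝ) : ℂ) • gam 2 := by
    funext y
    simp only [cliff, coord, Fin.sum_univ_three]
  rw [h2]
  exact ((h 0).add (h 1)).add (h 2)

/-- An average of a fixed matrix gives a smooth intertwiner, invertible at `x₀`; dividing by a local
square root of its determinant makes it a lift. -/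
theorem exists_local_spinLift {G : LorentzianMetric M} {U : Set M} {e e' : Fin 3 → VField M}
    (hE : OrthoFrame G U e) (hE' : OrthoFrame G U e')
    (hdet : ∀ y ∈ U, (Matrix.of fun a b => coord G.form e y (e' b y) a).det = 1)
    {x₀ : M} (hx₀ : x₀ ∈ U) :
    ∃ V ⊆ U, IsOpen V ∧ x₀ ∈ V ∧ ∃ s : M → Matrix (Fin 2) (Fin 2) ℂ,
      ContMDiffOn (𝓡 3) 𝓘(ℝ, Matrix (Fin 2) (Fin 2) ℂ) ∞ s V ∧
      ∀ y ∈ V, IsSpinLift (s y) (Matrix.of fun a b => coord G.form e y (e' b y) a) := by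
  obtain ⟨k, l, hkl⟩ := exists_intertwiner_ne_zero
    (A := fun b => cliff G.form e x₀ (e' b x₀)) fun b => by
      rw [cliff, sum_smul_gam, Matrix.trace_fin_two_of, add_neg_cancel]
  set C : Matrix (Fin 2) (Fin 2) ℂ := Matrix.single k l 1
  set T : M → Matrix (Fin 2) (Fin 2) ℂ := fun y =>
    intertwiner (fun b => cliff G.form e y (e' b y)) C with hT
  have hTmul : ∀ y ∈ U, ∀ b, T y * gam b = cliff G.form e y (e' b y) * T y := fun y hy b =>
    (gammaRelations (L := Matrix.of fun a b => coord G.form e y (e' b y) a)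
      (fun a b => hE.sum_coord_mul_coord hE' hy hy a b) (hdet y hy)).intertwiner_mul C b
  have hTs : ContMDiffOn (𝓡 3) 𝓘(ℝ, Matrix (Fin 2) (Fin 2) ℂ) ∞ T U := by
    have h : ∀ b (m : Matrix (Fin 2) (Fin 2) ℂ), ContMDiffOn (𝓡 3) 𝓘(ℝ, Matrix (Fin 2) (Fin 2) ℂ) ∞
        (fun y => cliff G.form e y (e' b y) * m) U := fun b m =>
      contMDiffOn_matrix_mul ((hE.contMDiffOn_cliff (hE'.smooth b)).mono (Set.subset_inter le_rfl le_rfl))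
        contMDiffOn_const
    exact ((contMDiffOn_const.add (h 0 _)).sub (h 1 _)).sub (h 2 _)
  have hdT : ContMDiffOn (𝓡 3) 𝓘(ℝ, ℂ) ∞ (fun y => (T y).det) U :=
    contDiff_matrix_det.contMDiff.comp_contMDiffOn hTs
  obtain ⟨N, hN, hN0, q, hq, hq2⟩ := exists_smooth_sqrt
    (isUnit_det_of_intertwining (hTmul x₀ hx₀) hkl)
  refine ⟨U ∩ (fun y => (T y).det) ⁻¹' N, Set.inter_subset_left,
    hdT.continuousOn.isOpen_inter_preimage hE.isOpen hN, ⟨hx₀, hN0⟩,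
    fun y => (q (T y).det)⁻¹ • T y, ?_, ?_⟩
  · have h1 : ContMDiffOn (𝓡 3) 𝓘(ℝ, ℂ) ∞ (fun y => (q (T y).det)⁻¹)
        (U ∩ (fun y => (T y).det) ⁻¹' N) :=
      (hq.inv fun d hd => (hq2 d hd).2).contMDiffOn.comp (hdT.mono Set.inter_subset_left)
        Set.inter_subset_right
    have h2 := contMDiffOn_matrix_mul (contMDiffOn_smul_const h1 1) (hTs.mono Set.inter_subset_left)
    simpa only [smul_mul_assoc, one_mul] using h2
  · rintro y ⟨hy, hyN⟩
    obtain ⟨h1, h2⟩ := hq2 _ hyN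
    refine ⟨?_, fun b => ?_⟩
    · rw [Matrix.det_smul, Fintype.card_fin, inv_pow, h1, inv_mul_cancel₀]
      rw [← h1]
      exact pow_ne_zero 2 h2
    · rw [smul_mul_assoc, hTmul y hy b, mul_smul_comm]
      rfl

theorem IsSpinLift.comp {G : LorentzianMetric M} {U : Set M} {e e' e'' : Fin 3 → VField M} {x : M}
    (hE' : OrthoFrame G U e') (hx : x ∈ U) {s s' : Matrix (Fin 2) (Fin 2) ℂ}
    (hs : IsSpinLift s (Matrix.of fun a b => coord G.form e x (e' b x) a))
    (hs' : IsSpinLift s' (Matrix.of fun a b => coord G.form e' x (e'' b x) a)) :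
    IsSpinLift (s * s') (Matrix.of fun a b => coord G.form e x (e'' b x) a) := by
  refine ⟨by rw [Matrix.det_mul, hs.1, hs'.1, one_mul], fun b => ?_⟩
  have h := hs'.2 b
  change s' * gam b = cliff G.form e' x (e'' b x) * s' at h
  change _ = cliff G.form e x (e'' b x) * _
  rw [mul_assoc, h, ← mul_assoc, hs.mul_cliff hE' hx, mul_assoc]

namespace SpinStructure

variable {M : Type u} [TopologicalSpace M] [ChartedSpace E3 M] [IsManifold (𝓡 3) ∞ M]
  {S : LorentzianSasakian M} (P : SpinStructure.{u, w} S) {E : Fin 3 → VField M}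

theorem orthoFrame (i : P.ι) : OrthoFrame S.metric (P.U i) (P.e i) :=
  ⟨P.isOpen_U i, P.e_smooth i, P.orthonormal i⟩

theorem contMDiffOn_lift (i j : P.ι) :
    ContMDiffOn (𝓡 3) 𝓘(ℝ, Matrix (Fin 2) (Fin 2) ℂ) ∞ (P.lift i j) (P.U i ∩ P.U j) :=
  contMDiffOn_matrix (P.lift_smooth i j)

/-- The coherent choices of lifts over all frames at once form a double covering of M: the cocycle
carries a lift in one frame to all others, so only one sign is free. A simply connected base admits
a section. -/
theorem exists_global_lift [SimplyConnectedSpace M] (hE : AdaptedFrame S Set.univ E) :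
    ∃ s : P.ι → M → Matrix (Fin 2) (Fin 2) ℂ,
      (∀ i, ContMDiffOn (𝓡 3) 𝓘(ℝ, Matrix (Fin 2) (Fin 2) ℂ) ∞ (s i) (P.U i)) ∧
      (∀ i, ∀ x ∈ P.U i,
        IsSpinLift (s i x) (Matrix.of fun a b => coord S.metric.form (P.e i) x (E b x) a)) ∧
      ∀ i j, ∀ x ∈ P.U i ∩ P.U j, P.lift i j x * s j x = s i x := by
  classical
  have _ := ChartedSpace.locallyPathConnectedSpace E3 M
  choose idx hidx using P.cover
  have hloc : ∀ x₀, ∃ V ⊆ P.U (idx x₀), IsOpen V ∧ x₀ ∈ V ∧ ∃ s : M → Matrix (Fin 2) (Fin 2) ℂ,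
      ContMDiffOn (𝓡 3) 𝓘(ℝ, Matrix (Fin 2) (Fin 2) ℂ) ∞ s V ∧ ∀ y ∈ V, IsSpinLift (s y)
        (Matrix.of fun a b => coord S.metric.form (P.e (idx x₀)) y (E b y) a) := fun x₀ =>
    exists_local_spinLift (P.orthoFrame _) ⟨P.isOpen_U _, fun a => (hE.smooth a).mono (Set.subset_univ _),
      fun x _ => hE.ortho x (Set.mem_univ x)⟩
      (fun y hy => hE.det_coord (P.orthoFrame _) hy (Set.mem_univ y) (P.oriented _ y hy)) (hidx x₀)
  choose V hVU hV hxV t ht hlift using hloc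
  have hlift' : ∀ x₀, ∀ y ∈ V x₀, ∀ i, y ∈ P.U i → IsSpinLift (P.lift i (idx x₀) y * t x₀ y)
      (Matrix.of fun a b => coord S.metric.form (P.e i) y (E b y) a) := fun x₀ y hy i hi =>
    IsSpinLift.comp (P.orthoFrame _) (hVU _ hy) (P.lift_spec i _ y ⟨hi, hVU _ hy⟩) (hlift x₀ y hy)
  have hts : ∀ x₀ i, ContMDiffOn (𝓡 3) 𝓘(ℝ, Matrix (Fin 2) (Fin 2) ℂ) ∞
      (fun y => P.lift i (idx x₀) y * t x₀ y) (P.U i ∩ V x₀) := fun x₀ i =>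
    contMDiffOn_matrix_mul ((P.contMDiffOn_lift _ _).mono fun y hy => ⟨hy.1, hVU _ hy.2⟩)
      ((ht x₀).mono Set.inter_subset_right)
  have inst : Nonempty M := inferInstance
  obtain ⟨x₀⟩ := inst
  -- The Boolean is the common sign. Indices whose domain misses the point receive the value 0, so
  -- that all families have one type.
  let τ : M → (y : M) → Bool → P.ι → Matrix (Fin 2) (Fin 2) ℂ := fun x₀ y b i =>
    if y ∈ P.U i then (if b then P.lift i (idx x₀) y * t x₀ y
      else - (P.lift i (idx x₀) y * t x₀ y)) else 0
  have τ_pos : ∀ x₀ y b i, y ∈ P.U i → τ x₀ y b i = if b then P.lift i (idx x₀) y * t x₀ y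
      else - (P.lift i (idx x₀) y * t x₀ y) := fun x₀ y b i h => if_pos h
  have τ_neg : ∀ x₀ y b i, y ∉ P.U i → τ x₀ y b i = 0 := fun x₀ y b i h => if_neg h
  have inj : ∀ x₀, ∀ y ∈ V x₀, Function.Injective (τ x₀ y) := by
    intro x₁ y hy b b' hbb
    have hy' := hVU _ hy
    have h1 := congrFun hbb (idx x₁)
    have h2 := (hlift' x₁ y hy _ hy').ne_zero
    rw [τ_pos _ _ _ _ hy', τ_pos _ _ _ _ hy'] at h1
    have h3 : ∀ m : Matrix (Fin 2) (Fin 2) ℂ, m ≠ 0 → m ≠ -m := fun m hm h => hm (by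
        rw [eq_neg_iff_add_eq_zero, ← two_smul ℂ, smul_eq_zero] at h
        exact h.resolve_left two_ne_zero)
    cases b <;> cases b'
    · rfl
    · exact absurd h1.symm (h3 _ h2)
    · exact absurd h1 (h3 _ h2)
    · rfl
  have trans : ∀ x₁ x₂, ∀ y ∈ V x₁ ∩ V x₂, ∀ b, ∃ b', ∀ᶠ z in 𝓝 y, τ x₁ z b = τ x₂ z b' := by
    intro x₁ x₂ y hy b
    have hU1 := hVU _ hy.1
    have hU2 := hVU _ hy.2
    have hopen := ((hV x₁).inter (hV x₂)).mem_nhds hy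
    have h1 := eventually_eq_or_eq_neg
      (s := t x₁) (s' := fun z => P.lift (idx x₁) (idx x₂) z * t x₂ z)
      (L := fun z => Matrix.of fun a b => coord S.metric.form (P.e (idx x₁)) z (E b z) a)
      (((ht x₁).continuousOn).continuousAt ((hV x₁).mem_nhds hy.1))
      ((hts x₂ (idx x₁)).continuousOn.continuousAt
        (((P.isOpen_U _).inter (hV x₂)).mem_nhds ⟨hU1, hy.2⟩))
      (by filter_upwards [hopen] with z hz using hlift x₁ z hz.1)
      (by filter_upwards [hopen] with z hz using hlift' x₂ z hz.2 _ (hVU _ hz.1))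
    -- The cocycle reduces the comparison in every frame to that in the frame `idx x₁`, so one sign
    -- serves all indices.
    have h2 : ∀ z ∈ V x₁ ∩ V x₂, ∀ i, z ∈ P.U i → P.lift i (idx x₂) z * t x₂ z
        = P.lift i (idx x₁) z * (P.lift (idx x₁) (idx x₂) z * t x₂ z) := fun z hz i hi => by
      rw [← mul_assoc, P.cocycle i _ _ z ⟨⟨hi, hVU _ hz.1⟩, hVU _ hz.2⟩]
    rcases h1 with h1 | h1
    · refine ⟨b, ?_⟩
      filter_upwards [h1, hopen] with z hz hzV
      funext i
      by_cases hi : z ∈ P.U i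
      · rw [τ_pos _ _ _ _ hi, τ_pos _ _ _ _ hi, h2 z hzV i hi, hz]
      · rw [τ_neg _ _ _ _ hi, τ_neg _ _ _ _ hi]
    · refine ⟨!b, ?_⟩
      filter_upwards [h1, hopen] with z hz hzV
      funext i
      by_cases hi : z ∈ P.U i
      · rw [τ_pos _ _ _ _ hi, τ_pos _ _ _ _ hi, h2 z hzV i hi, hz]
        cases b <;> simp
      · rw [τ_neg _ _ _ _ hi, τ_neg _ _ _ _ hi]
  obtain ⟨σ, -, hσ⟩ := exists_section_of_locally_constant_transition (F := Bool)
    (B := fun _ => P.ι → Matrix (Fin 2) (Fin 2) ℂ) V hV id hxV τ inj trans x₀ true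
  have key : ∀ i, ∀ x ∈ P.U i, ∃ b : Bool, ∀ᶠ y in 𝓝 x, y ∈ V x ∧ ∀ j, y ∈ P.U j →
      σ y j = if b then P.lift j (idx x) y * t x y else - (P.lift j (idx x) y * t x y) := by
    intro i x hx
    obtain ⟨b, hb⟩ := hσ x x (hxV x)
    refine ⟨b, ?_⟩
    filter_upwards [hb, (hV x).mem_nhds (hxV x)] with y hy hyV
    exact ⟨hyV, fun j hj => (congrFun hy j).trans (τ_pos _ _ _ _ hj)⟩
  refine ⟨fun i x => σ x i, fun i x hx => ?_, fun i x hx => ?_, fun i j x hx => ?_⟩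
  · obtain ⟨b, hb⟩ := key i x hx
    have h1 := (hts x i).contMDiffAt (((P.isOpen_U i).inter (hV x)).mem_nhds ⟨hx, hxV x⟩)
    have h2 : (fun y => σ y i) =ᶠ[𝓝 x] fun y => if b then P.lift i (idx x) y * t x y
        else - (P.lift i (idx x) y * t x y) := by
      filter_upwards [hb, (P.isOpen_U i).mem_nhds hx] with y hy hyU using hy.2 i hyU
    refine (ContMDiffAt.congr_of_eventuallyEq ?_ h2).contMDiffWithinAt
    cases b
    · exact h1.neg
    · exact h1
  · obtain ⟨b, hb⟩ := key i x hx
    change IsSpinLift (σ x i) _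
    rw [hb.self_of_nhds.2 i hx]
    have h1 := hlift' x x (hxV x) i hx
    cases b
    · exact h1.neg
    · exact h1
  · obtain ⟨b, hb⟩ := key i x hx.1
    change _ * σ x j = σ x i
    rw [hb.self_of_nhds.2 i hx.1, hb.self_of_nhds.2 j hx.2,
      ← P.cocycle i j (idx x) x ⟨hx, hidx x⟩]
    cases b <;> simp [mul_assoc]

end SpinStructure

end Lift

/-! ### Construction of the quasi-Killing spinors. -/

section Spinors

attribute [local instance] Matrix.linftyOpNormedRing Matrix.linftyOpNormedAlgebra

local instance (priority := 10000) : TopologicalSpace (Matrix (Fin 2) (Fin 2) ℂ) :=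
  (Matrix.linftyOpNormedRing (n := Fin 2) (α := ℂ)).toMetricSpace.toPseudoMetricSpace.toUniformSpace.toTopologicalSpace

variable {M : Type u} [TopologicalSpace M] [ChartedSpace E3 M] [IsManifold (𝓡 3) ∞ M]
  {S : LorentzianSasakian M} {E : Fin 3 → VField M}

namespace AdaptedFrame

/-- A global frame gives the spin structure with one chart and trivial cocycle. -/
theorem spinStructure_nonempty (hE : AdaptedFrame S Set.univ E) :
    Nonempty (SpinStructure.{u, w} S) := by
  have hx : ∀ x : M, x ∈ Set.univ := Set.mem_univ
  refine ⟨{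
    ι := PUnit
    U := fun _ => Set.univ
    e := fun _ => E
    lift := fun _ _ _ => 1
    isOpen_U := fun _ => isOpen_univ
    cover := fun x => ⟨⟨⟩, hx x⟩
    e_smooth := fun _ a => hE.smooth a
    orthonormal := fun _ x hx a b => hE.ortho x hx a b
    oriented := fun _ x hx => ?_
    timeOriented := fun _ x hx => by rw [hE.eta_frame hx, if_pos rfl]; exact one_pos
    lift_smooth := fun _ _ _ _ => contMDiffOn_const
    lift_spec := fun _ _ x _ => ⟨Matrix.det_one, fun b => ?_⟩
    cocycle := fun _ _ _ _ _ => one_mul _ }⟩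
  · rw [hE.eta_frame hx, hE.eta_frame hx, hE.eta_frame hx, hE.phi_two x hx, hE.ortho x hx]
    simp [sgn]
  · change _ = cliff S.metric.form E x (E b x) * 1
    rw [hE.toOrthoFrame.cliff_frame (hx x), one_mul, mul_one]

theorem spinConn_eq [T2Space M] (hE : AdaptedFrame S Set.univ E) {lam : ℝ} {x : M}
    (h : structureFun S.metric E 0 1 2 x = lam ∧ structureFun S.metric E 1 2 1 x = 0 ∧
        structureFun S.metric E 1 2 2 x = 0) (v : TangentSpace (𝓡 3) x) :
    spinConn S.metric.form E x v = (-(Complex.I / 2)) • ((((lam - 1) * coord S.metric.form E x v 0 : ℝ) : ℂ) • gam 0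
      + (coord S.metric.form E x v 1 : ℂ) • gam 1 + (coord S.metric.form E x v 2 : ℂ) • gam 2) := by
  have hx := Set.mem_univ x
  obtain ⟨X, hX, rfl⟩ : ∃ X : VField M, X.DiffAt x ∧ X x = v :=
    ⟨FiberBundle.extend E3 v, FiberBundle.mdifferentiableAt_extend (𝓡 3) E3 v,
      FiberBundle.extend_apply_self ..⟩
  obtain ⟨h1, h2, h3, h4, h5, h6, h7, h8, h9⟩ := hE.connCoeff_values hx
  have key : ∀ a b, S.metric.form x (nabla S.metric.form X (E a) x) (E b x)
      = ∑ c, coord S.metric.form E x (X x) c * connCoeff S.metric E c a b x := by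
    intro a b
    rw [hE.nabla_frame_eq hx hX]
    simp only [map_sum, map_smul, sum_apply, smul_apply, smul_eq_mul, hE.form_nabla hx]
  rw [hE.spinConn_apply hx hX, spinRep_eq (hE.form_nabla_antisymm hx hX), key, key, key]
  simp only [Fin.sum_univ_three, h1, h2, h3, h4, h5, h6, h7, h8, h9, h.1, h.2.1, h.2.2]
  push_cast
  module

/-- The flat connection forms whose parallel sections are the quasi-Killing spinors. -/
def _root_.LorentzSasaki.killingForm (t : ℝ) : Fin 3 → Matrix (Fin 2) (Fin 2) ℂ :=
  ![(Complex.I * (t : ℂ) ^ 2) • gam 0, (Complex.I * (t : ℂ)) • gam 1, (Complex.I * (t : ℂ)) • gam 2]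

/-- Flatness for [e₁,e₂] = -2ξ holds for every t, since A₀ carries t². For [ξ,e₁] = λe₂ and [ξ,e₂] =
-λe₁ it reads 2t³ = λt, which is `ht`. -/
theorem exists_killing_matrix [T2Space M] [SimplyConnectedSpace M] (hE : AdaptedFrame S Set.univ E)
    {lam t : ℝ} (ht : t * (2 * t ^ 2 - lam) = 0)
    (h : ∀ x, structureFun S.metric E 0 1 2 x = lam ∧ structureFun S.metric E 1 2 1 x = 0 ∧
        structureFun S.metric E 1 2 2 x = 0) :
    ∃ Ψ : M → Matrix (Fin 2) (Fin 2) ℂ, (∃ x, Ψ x = 1) ∧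
      ContMDiff (𝓡 3) 𝓘(ℝ, Matrix (Fin 2) (Fin 2) ℂ) ∞ Ψ ∧
      ∀ x a, mvfderiv (𝓡 3) Ψ x (E a x) = killingForm t a * Ψ x := by
  refine exists_global_solution (A := killingForm t)
    (c := fun a b d x => sgn d * structureFun S.metric E a b d x) hE.smooth
    (fun x => hE.linearIndependent (Set.mem_univ x))
    (fun x v => ⟨_, hE.expand (Set.mem_univ x) v⟩)
    (fun x a b => hE.bracket_eq (Set.mem_univ x) a b) fun x a b => ?_
  have hx := Set.mem_univ x
  obtain ⟨h1, h2, h3⟩ := hE.structureFun_symm_traceless hx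
  have c1 := hE.structureFun_one_two hx
  have c2 := hE.structureFun_zero_one hx
  have c3 := hE.structureFun_zero_two hx
  obtain ⟨l1, l2, l3⟩ := h x
  obtain ⟨g1, g2, g3, g4, g5, g6, g7, g8, g9⟩ := gammaRelations_gam
  have k0 : killingForm t 0 = (Complex.I * (t : ℂ) ^ 2) • gam 0 := rfl
  have k1 : killingForm t 1 = (Complex.I * (t : ℂ)) • gam 1 := rfl
  have k2 : killingForm t 2 = (Complex.I * (t : ℂ)) • gam 2 := rfl
  have hI3 : Complex.I ^ 3 = -Complex.I := Complex.I_pow_three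
  have ht' : (t : ℂ) ^ 3 = lam / 2 * t := by
    have : t ^ 3 = lam / 2 * t := by linarith
    exact_mod_cast this
  simp only [Fin.sum_univ_three, show sgn 0 = -1 from rfl, show sgn 1 = 1 from rfl,
    show sgn 2 = 1 from rfl]
  have hab : ∀ m : Matrix (Fin 2) (Fin 2) ℂ, ∀ r : ℝ, r • m = (r : ℂ) • m := fun m r => rfl
  fin_cases a <;> fin_cases b <;>
  · simp only [Fin.zero_eta, Fin.mk_one, Fin.reduceFinMk, structureFun_self,
      structureFun_swap S.metric E 1 0, structureFun_swap S.metric E 2 0,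
      structureFun_swap S.metric E 2 1, h1, h2, h3, c1, c2, c3, l1, l2, l3, k0, k1, k2,
      smul_mul_assoc, mul_smul_comm, g1, g2, g3, g4, g5, g6, g7, g8, g9, hab]
    push_cast
    match_scalars <;> ring_nf <;> simp only [hI3, ht'] <;> ring

end AdaptedFrame

/-- The evaluation of matrices on a vector, as a continuous linear map. -/
def mulVecCLM (f : Fin 2 → ℂ) : Matrix (Fin 2) (Fin 2) ℂ →L[ℝ] Fin 2 → ℂ :=
  LinearMap.toContinuousLinearMap
    { toFun := fun m => m.mulVec f
      map_add' := fun m n => Matrix.add_mulVec m n f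
      map_smul' := fun r m => Matrix.smul_mulVec r m f }

theorem mulVecCLM_apply (f : Fin 2 → ℂ) (m : Matrix (Fin 2) (Fin 2) ℂ) :
    mulVecCLM f m = m.mulVec f := rfl

/-- In frame i the spinor is sᵢΨf with f a fixed nonzero vector. The transformation law ds = sω' -
ωs cancels the spin connection of that frame, reducing the equation to one in the global frame;
there it compares coefficients of the γ-matrices. -/
theorem exists_isSqK [T2Space M] [SimplyConnectedSpace M] (hE : AdaptedFrame S Set.univ E)
    {lam t : ℝ} (ht : t * (2 * t ^ 2 - lam) = 0)
    (h : ∀ x, structureFun S.metric E 0 1 2 x = lam ∧ structureFun S.metric E 1 2 1 x = 0 ∧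
        structureFun S.metric E 1 2 2 x = 0) (P : SpinStructure.{u, w} S) :
    ∃ ψ : Spinor P, ψ.Nontrivial ∧ ψ.IsSqK (t - 1 / 2) (t ^ 2 - t + 1 - lam / 2) := by
  obtain ⟨Ψ, ⟨x₀, hx₀⟩, hΨ, hdΨ⟩ := hE.exists_killing_matrix ht h
  obtain ⟨s, hs, hlift, hcomp⟩ := P.exists_global_lift hE
  set f : Fin 2 → ℂ := Pi.single 0 1 with hf
  have hsΨ : ∀ i, ContMDiffOn (𝓡 3) 𝓘(ℝ, Matrix (Fin 2) (Fin 2) ℂ) ∞ (fun x => s i x * Ψ x) (P.U i) :=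
    fun i => contMDiffOn_matrix_mul (hs i) hΨ.contMDiffOn
  let ψ : Spinor P :=
    { comp := fun i x => mulVecCLM f (s i x * Ψ x)
      smooth := fun i => (mulVecCLM f).contDiff.contMDiff.comp_contMDiffOn (hsΨ i)
      compatible := fun i j x hx => by
        rw [mulVecCLM_apply, mulVecCLM_apply, Matrix.mulVec_mulVec, ← mul_assoc, hcomp i j x hx] }
  have hψ : ∀ i x, ψ.comp i x = (s i x * Ψ x).mulVec f := fun i x => rfl
  refine ⟨ψ, ?_, ?_⟩
  · obtain ⟨i, hi⟩ := P.cover x₀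
    refine ⟨i, x₀, hi, fun h0 => ?_⟩
    rw [hψ, hx₀, mul_one] at h0
    have h1 : (s i x₀).det = 0 := Matrix.exists_mulVec_eq_zero_iff.1 ⟨f, by simp [hf], h0⟩
    rw [(hlift i x₀ hi).1] at h1
    exact one_ne_zero h1
  · intro i x hx v
    have hU := (P.isOpen_U i).mem_nhds hx
    have hxu := Set.mem_univ x
    have hsd := ((hs i).contMDiffAt hU).mdifferentiableAt (by simp)
    have hΨd := (hΨ x).mdifferentiableAt (n := ∞) (by simp)
    have hsΨd := ((hsΨ i).contMDiffAt hU).mdifferentiableAt (by simp)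
    have hds := mvfderiv_spinLift (P.orthoFrame i) hE.toOrthoFrame hx hxu hsd
      (by filter_upwards [hU] with y hy using hlift i y hy) v
    have hdv : mvfderiv (𝓡 3) Ψ x v
        = (∑ a, (coord S.metric.form E x v a : ℂ) • killingForm t a) * Ψ x := by
      conv_lhs => rw [hE.expand hxu v]
      rw [map_sum, Finset.sum_mul]
      refine Finset.sum_congr rfl fun a _ => ?_
      rw [map_smul, hdΨ, smul_mul_assoc]
      rfl
    have hc := fun w => (hlift i x hx).mul_cliff hE.toOrthoFrame hxu w
    have hxi : cliff S.metric.form E x (S.xi x) = gam 0 := by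
      rw [← hE.zero x hxu, hE.toOrthoFrame.cliff_frame hxu]
    have heta : S.eta x v = coord S.metric.form E x v 0 := by
      rw [hE.eta_eq hxu, coord, show sgn 0 = -1 from rfl, neg_one_mul]
    have hdψ : mvfderiv (𝓡 3) (ψ.comp i) x v
        = (s i x * mvfderiv (𝓡 3) Ψ x v + mvfderiv (𝓡 3) (s i) x v * Ψ x).mulVec f := by
      rw [← mvfderiv_algebra_mul hsd hΨd]
      exact mvfderiv_clm_comp (mulVecCLM f) hsΨd v
    rw [Spinor.nabla, Spinor.clifford, Spinor.clifford, hdψ, hψ, Matrix.mulVec_mulVec,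
      Matrix.mulVec_mulVec, Matrix.mulVec_mulVec, ← Matrix.add_mulVec, ← Matrix.smul_mulVec,
      ← Matrix.smul_mulVec, ← Matrix.add_mulVec]
    congr 1
    rw [← mul_assoc (cliff _ _ _ _), ← mul_assoc (cliff _ _ _ _), ← hc, ← hc, hxi, hds, hdv, heta]
    -- The γ₁ and γ₂ coefficients i(t - 1/2) give the first type parameter. The γ₀ coefficient is
    -- i(t² - (λ - 1)/2), and its excess over i(t - 1/2) gives the second.
    have key : (∑ a, (coord S.metric.form E x v a : ℂ) • killingForm t a)
        + spinConn S.metric.form E x v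
        = (((t - 1 / 2 : ℝ) : ℂ) * Complex.I) • cliff S.metric.form E x v
          + (((t ^ 2 - t + 1 - lam / 2 : ℝ) : ℂ) * Complex.I
            * (coord S.metric.form E x v 0 : ℂ)) • gam 0 := by
      rw [hE.spinConn_eq (h x), cliff]
      simp only [Fin.sum_univ_three, killingForm, Matrix.cons_val_zero, Matrix.cons_val_one,
        Matrix.cons_val]
      push_cast
      module
    have key2 := congrArg (fun m => s i x * m * Ψ x) key
    simp only [mul_add, add_mul, mul_smul_comm, smul_mul_assoc] at key2
    rw [← key2, sub_mul, mul_assoc (spinConn _ _ _ _)]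
    simp only [mul_assoc]
    abel

end Spinors

end LorentzSasaki

end

/-- With λ = (3 - H)/2, the equation t(2t² - λ) = 0 has the roots 0 and ±√(3 - H)/2. At a nonzero
root t² = λ/2, so the second parameter simplifies to 1 - t. -/
theorem mainTheorem10 {M : Type u} [TopologicalSpace M]
    [ChartedSpace (EuclideanSpace ℝ (Fin 3)) M] [IsManifold (𝓡 3) ∞ M]
    [T2Space M] [SecondCountableTopology M] [SimplyConnectedSpace M]
    (S : LorentzSasaki.LorentzianSasakian M) (H : ℝ) (hH : S.HasPhiSectionalCurv H) :
    Nonempty (LorentzSasaki.SpinStructure.{u, w} S) ∧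
    ∀ P : LorentzSasaki.SpinStructure.{u, w} S,
      (∃ ψ : LorentzSasaki.Spinor P, ψ.Nontrivial ∧ ψ.IsSqK (-1 / 2) ((H + 1) / 4)) ∧
      (H < 3 →
        (∃ ψ : LorentzSasaki.Spinor P, ψ.Nontrivial ∧
          ψ.IsSqK ((-1 + √(3 - H)) / 2) ((2 - √(3 - H)) / 2)) ∧
        (∃ ψ : LorentzSasaki.Spinor P, ψ.Nontrivial ∧
          ψ.IsSqK ((-1 - √(3 - H)) / 2) ((2 + √(3 - H)) / 2))) := by
  obtain ⟨E, hE, h⟩ := LorentzSasaki.exists_global_adaptedFrame S (lam := (3 - H) / 2)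
    (by rwa [mul_div_cancel₀ _ two_ne_zero, sub_sub_cancel])
  refine ⟨hE.spinStructure_nonempty, fun P => ⟨?_, fun hH3 => ?_⟩⟩
  · convert LorentzSasaki.exists_isSqK hE (t := 0) (zero_mul _) h P using 4 <;> ring
  · have hsq : √(3 - H) ^ 2 = 3 - H := Real.sq_sqrt (by linarith)
    constructor
    · convert LorentzSasaki.exists_isSqK hE (t := √(3 - H) / 2) (by rw [div_pow, hsq]; ring) h P
        using 4
      · ring
      · linear_combination (-1 / 4 : ℝ) * hsq
    · convert LorentzSasaki.exists_isSqK hE (t := -√(3 - H) / 2)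
        (by rw [div_pow, neg_sq, hsq]; ring) h P using 4
      · ring
      · linear_combination (-1 / 4 : ℝ) * hsq
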